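/- Let $N\ge 1$ and $m$ be integers, and let $k<0$ be either an even integer, or an element of $\tfrac12+\mathbb Z$, in which case $4\mid N$. Write $z=x+iy\in\mathbb H$, $e(w)=e^{2\pi i w}$, $q=e(z)$; powers of complex numbers are principal values. For $\gamma=\begin{pmatrix}a&b\\c&d\end{pmatrix}\in\Gamma_0(N)$ put $(f|_k\gamma)(z)=j(\gamma,z)^{-2k}f(\gamma z)$, where $j(\gamma,z)=\sqrt{cz+d}$ if $k\in\mathbb Z$ and $j(\gamma,z)=\left(\frac cd\right)\varepsilon_d^{-1}\sqrt{cz+d}$ otherwise, with $\varepsilon_d=1$ or $i$ according as $d\equiv1$ or $3 \pmod 4$, and with $\left(\frac cd\right)=-\left(\frac{c}{|d|}\right)$ if $c,d<0$, $\left(\frac cd\right)=\left(\frac c{|d|}\right)$ otherwise. Let $\Delta_k=-y^2(\partial_x^2+\partial_y^2)+iky(\partial_x+i\partial_y)$ and $\xi_kf=2iy^k\,\overline{\partial f/\partial\bar z}$. Let $H^!_k(N)$ be the space of smooth $f:\mathbb H\to\mathbb C$ with $f|_k\gamma=f$ for all $\gamma\in\Gamma_0(N)$, $\Delta_kf=0$,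 and at most (linear) exponential growth at all cusps; let $H_k(N)$ be the subspace of those $f$ for which $\xi_kf$ is a cusp form of weight $2-k$ for $\Gamma_0(N)$, and let $M_{2-k}(N)$ be the space of holomorphic modular forms of weight $2-k$ for $\Gamma_0(N)$ (in both cases for the above multiplier). For $s\in\mathbb C$ let $\mathcal M_{0,k}(y,s)=y^{s-k/2}$ and, for $n\ne0$, $\mathcal M_{n,k}(y,s)=\Gamma(2s)^{-1}(4\pi|n|y)^{-k/2}M_{\frac k2\mathrm{sgn}(n),\,s-\frac12}(4\pi|n|y)$ with the Whittaker function $M_{\mu,\nu}$; put $\varphi_{m,k}(z,s)=\mathcal M_{m,k}(y,s)e(mx)$ and $$F_{m,k,N}(z,s)=\sum_{\gamma\in\Gamma_\infty\backslash\Gamma_0(N)}(\varphi_{m,k}(\cdot,s)|_k\gamma)(z),\qquad \Gamma_\infty=\left\{\pm\begin{pmatrix}1&n\\0&1\end{pmatrix}:n\in\mathbb Z\right\}.$$ Let $$c_{m,k}(n,s)=2\pi i^{-k}\sum_{c>0}\frac{K_k(m,n,Nc)}{Nc}\times\begin{cases}|mn|^{\frac{1-k}2}J_{2s-1}\!\left(\frac{4\pi\sqrt{|mn|}}{Nc}\right),&mn>0,\\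 |mn|^{\frac{1-k}2}I_{2s-1}\!\left(\frac{4\pi\sqrt{|mn|}}{Nc}\right),&mn<0,\\ 2^{k-1}\pi^{s+\frac k2-1}|m+n|^{s-\frac k2}(Nc)^{1-2s},&mn=0,\ m+n\ne0,\\ 2^{2k-2}\pi^{k-1}\Gamma(2s)(2Nc)^{1-2s},&m=n=0,\end{cases}$$ where $J,I$ are the Bessel functions and $K_k(m,n,c)=\sum_{v\,(c)^*}\chi(v)\,e\!\left(\frac{m\bar v+nv}{c}\right)$, $v\bar v\equiv1\pmod c$, with $\chi(v)=1$ if $k\in\mathbb Z$ and $\chi(v)=\left(\frac cv\right)^{2k}\varepsilon_v^{2k}$ otherwise (with representatives $v\geq 0$). Then the series defining $F_{m,k,N}(z,1-k/2)$ converges absolutely, and the function $F_{m,k,N}(\cdot,1-k/2)$ lies in $H_k(N)$ if $m<0$; in $H^!_k(N)$ if $m>0$; and, if $m=0$, in $H^!_k(N)$ with $\xi_kF_{0,k,N}(\cdot,1-k/2)\in M_{2-k}(N)$. Moreover, all series below (including those defining the coefficients) converge absolutely, and $$F_{m,k,N}(z,1-\tfrac k2)=\mathfrak m_{m,k}(y)q^m+\frac{(4\pi)^{1-k}}{(1-k)\Gamma(1-k)}c_{m,k}(0,1-\tfrac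 k2)+\sum_{n>0}c_{m,k}(n,1-\tfrac k2)n^{k-1}q^n+\sum_{n<0}c_{m,k}(n,1-\tfrac k2)|n|^{k-1}\frac{\Gamma(1-k,-4\pi ny)}{\Gamma(1-k)}q^n,$$ where $\Gamma(a,x)=\int_x^\infty e^{-t}t^{a-1}\,dt$ (for $x<0$ along the real axis with $\arg t=\pi$ for $t<0$) and $$\mathfrak m_{m,k}(y)=\begin{cases}y^{1-k},&m=0,\\ 1-\frac{\Gamma(1-k,-4\pi my)}{\Gamma(1-k)},&m<0,\\ (-1)^{k-1}\left[1-\frac{\Gamma(1-k,-4\pi my)}{\Gamma(1-k)}\right],&m>0.\end{cases}$$ -/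

import Mathlib

noncomputable section

open scoped UpperHalfPlane MatrixGroups ContDiff Nat

namespace WeakMaass

/-! ### Special functions -/

/-- `e(w) = exp(2πiw)`; in particular `q ^ n = e(nz)`. -/
def e (w : ℂ) : ℂ := Complex.exp (2 * Real.pi * Complex.I * w)

/-- Kummer's confluent hypergeometric function `M(a, b, x)`. -/
def kummerM (a b x : ℂ) : ℂ :=
  ∑' n : ℕ, (ascPochhammer ℂ n).eval a / (ascPochhammer ℂ n).eval b * x ^ n / (n ! : ℂ)

/-- The Whittaker function `M_{μ,ν}(y)`, for `y > 0`. -/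
def whittakerM (μ ν : ℂ) (y : ℝ) : ℂ :=
  Complex.exp (-(y : ℂ) / 2) * (y : ℂ) ^ (ν + 1 / 2) * kummerM (ν - μ + 1 / 2) (1 + 2 * ν) y

/-- The Bessel function `J_α(x)`, for `x > 0`.  At a pole of `Γ` Mathlib has `Γ = 0`, so that the
reciprocal has the correct value `0` there. -/
def besselJ (α : ℂ) (x : ℝ) : ℂ :=
  ((x : ℂ) / 2) ^ α *
    ∑' j : ℕ, (-((x : ℂ) ^ 2 / 4)) ^ j / ((j ! : ℂ) * Complex.Gamma (α + j + 1))

/-- The modified Bessel function `I_α(x)`, for `x > 0`. -/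
def besselI (α : ℂ) (x : ℝ) : ℂ :=
  ((x : ℂ) / 2) ^ α *
    ∑' j : ℕ, ((x : ℂ) ^ 2 / 4) ^ j / ((j ! : ℂ) * Complex.Gamma (α + j + 1))

/-- The incomplete gamma function `Γ(a, x) = ∫_x^∞ e^{-t} t^{a-1} dt` for real `a > 0` and real
`x`.  For `x < 0` the integral runs along the real axis, with the principal branch of `t^{a-1}`
(argument `π` on the negative axis). -/
def incGamma (a x : ℝ) : ℂ :=
  ∫ t in Set.Ioi x, Complex.exp (-(t : ℂ)) * (t : ℂ) ^ ((a : ℂ) - 1)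

/-! ### The multiplier system and the slash operator -/

/-- The extended quadratic residue symbol `(c/d)` for odd `d` of either sign:
`(c/d) = (c/|d|)`, except that `(c/d) = -(c/|d|)` if both `c` and `d` are negative
(and `(0/±1) = 1`). -/
def quadSymbol (c d : ℤ) : ℤ :=
  if c < 0 ∧ d < 0 then -jacobiSym c d.natAbs else jacobiSym c d.natAbs

/-- `ε_d` for odd `d`: it is `1` if `d ≡ 1 (mod 4)` and `i` if `d ≡ 3 (mod 4)`. -/
def eps (d : ℤ) : ℂ := if d % 4 = 1 then 1 else Complex.I

/-- The weight is an integer. -/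
def IsIntegral (k : ℝ) : Prop := ∃ l : ℤ, k = l

/-- `c z + d` for `γ = (a b; c d)`. -/
def cocycle (γ : SL(2, ℤ)) (z : ℍ) : ℂ := (γ 1 0 : ℂ) * (z : ℂ) + (γ 1 1 : ℂ)

open Classical in
/-- The factor `j(γ, z)`. It is `√(cz+d)` for integral `k` and `(c/d) ε_d⁻¹ √(cz+d)` for
half-integral `k`, with the principal branch of the square root. -/
def jFactor (k : ℝ) (γ : SL(2, ℤ)) (z : ℍ) : ℂ :=
  if IsIntegral k then cocycle γ z ^ (1 / 2 : ℂ)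
  else (quadSymbol (γ 1 0) (γ 1 1) : ℂ) * (eps (γ 1 1))⁻¹ * cocycle γ z ^ (1 / 2 : ℂ)

/-- The slash operator `(f|_k γ)(z) = j(γ, z)^{-2k} f(γz)` (here `2k` is an integer). -/
def slash (k : ℝ) (f : ℍ → ℂ) (γ : SL(2, ℤ)) (z : ℍ) : ℂ :=
  jFactor k γ z ^ (-2 * (k : ℂ)) * f (γ • z)

/-! ### Differential operators on functions on the upper half plane -/

/-- `∂f/∂x`. -/
def dx (f : ℍ → ℂ) (z : ℍ) : ℂ := fderiv ℝ (f ∘ UpperHalfPlane.ofComplex) (z : ℂ) 1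

/-- `∂f/∂y`. -/
def dy (f : ℍ → ℂ) (z : ℍ) : ℂ := fderiv ℝ (f ∘ UpperHalfPlane.ofComplex) (z : ℂ) Complex.I

/-- The weight `k` hyperbolic Laplacian
`Δ_k = -y²(∂²/∂x² + ∂²/∂y²) + iky(∂/∂x + i∂/∂y)`. -/
def laplacian (k : ℝ) (f : ℍ → ℂ) (z : ℍ) : ℂ :=
  -(z.im : ℂ) ^ 2 * (dx (dx f) z + dy (dy f) z) +
    Complex.I * k * z.im * (dx f z + Complex.I * dy f z)

/-- `ξ_k f = 2 i y^k · conj(∂f/∂z̄)`, where `∂/∂z̄ = (∂/∂x + i∂/∂y)/2`. -/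
def xi (k : ℝ) (f : ℍ → ℂ) (z : ℍ) : ℂ :=
  2 * Complex.I * ((z.im ^ k : ℝ) : ℂ) *
    (starRingEnd ℂ) ((dx f z + Complex.I * dy f z) / 2)

/-- `f` is smooth in the real sense. -/
def IsSmooth (f : ℍ → ℂ) : Prop :=
  ContDiffOn ℝ ∞ (f ∘ UpperHalfPlane.ofComplex) {w : ℂ | 0 < w.im}

/-- `f` is holomorphic. -/
def IsHolomorphic (f : ℍ → ℂ) : Prop :=
  DifferentiableOn ℂ (f ∘ UpperHalfPlane.ofComplex) {w : ℂ | 0 < w.im}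

/-! ### Spaces of automorphic forms -/

/-- Weight `k` invariance under `Γ₀(N)`. -/
def IsInvariant (k : ℝ) (N : ℕ) (f : ℍ → ℂ) : Prop :=
  ∀ γ ∈ CongruenceSubgroup.Gamma0 N, slash k f γ = f

/-- The absolute value of `f|_k α` for `α ∈ SL₂(ℤ)`, which describes `f` near the cusp `α∞`.
It does not depend on the choice of a root of unity in the half-integral weight slash operator. -/
def absAtCusp (k : ℝ) (f : ℍ → ℂ) (α : SL(2, ℤ)) (z : ℍ) : ℝ :=
  ‖cocycle α z‖ ^ (-k) * ‖f (α • z)‖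

/-- The space `H^!_k(N)` of harmonic weak Maass forms of weight `k` for `Γ₀(N)`: smooth,
`Γ₀(N)`-invariant, annihilated by `Δ_k`, and of at most (linear) exponential growth at all cusps. -/
def harmonicWeakMaassForms (k : ℝ) (N : ℕ) : Set (ℍ → ℂ) :=
  {f | IsSmooth f ∧ IsInvariant k N f ∧ (∀ z, laplacian k f z = 0) ∧
    ∀ α : SL(2, ℤ), ∃ C : ℝ,
      absAtCusp k f α =O[UpperHalfPlane.atImInfty] fun z : ℍ => Real.exp (C * z.im)}

/-- The space `M_k(N)` of modular forms of weight `k` for `Γ₀(N)`. -/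
def modularForms (k : ℝ) (N : ℕ) : Set (ℍ → ℂ) :=
  {f | IsHolomorphic f ∧ IsInvariant k N f ∧
    ∀ α : SL(2, ℤ), UpperHalfPlane.IsBoundedAtImInfty (absAtCusp k f α)}

/-- The space `S_k(N)` of cusp forms of weight `k` for `Γ₀(N)`. -/
def cuspForms (k : ℝ) (N : ℕ) : Set (ℍ → ℂ) :=
  {f | IsHolomorphic f ∧ IsInvariant k N f ∧
    ∀ α : SL(2, ℤ), UpperHalfPlane.IsZeroAtImInfty (absAtCusp k f α)}

/-- The subspace `H_k(N)` of those `f ∈ H^!_k(N)` for which `ξ_k f` is a cusp form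
(of weight `2 - k`). -/
def harmonicMaassFormsCuspidal (k : ℝ) (N : ℕ) : Set (ℍ → ℂ) :=
  {f | f ∈ harmonicWeakMaassForms k N ∧ xi k f ∈ cuspForms (2 - k) N}

/-! ### The Poincaré series -/

/-- `𝓜_{n,k}(y, s)`. -/
def curlyM (n : ℤ) (k : ℝ) (y : ℝ) (s : ℂ) : ℂ :=
  if n = 0 then (y : ℂ) ^ (s - k / 2)
  else (Complex.Gamma (2 * s))⁻¹ * ((4 * Real.pi * |(n : ℝ)| * y : ℝ) : ℂ) ^ (-(k : ℂ) / 2) *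
    whittakerM ((k : ℂ) / 2 * (n.sign : ℂ)) (s - 1 / 2) (4 * Real.pi * |(n : ℝ)| * y)

/-- `φ_{m,k}(z, s) = 𝓜_{m,k}(y, s) e(mx)`. -/
def phi (m : ℤ) (k : ℝ) (s : ℂ) (z : ℍ) : ℂ :=
  curlyM m k z.im s * e ((m : ℂ) * z.re)

/-- `Γ_∞ = {±(1 n; 0 1) : n ∈ ℤ}`. -/
def GammaInfty : Subgroup SL(2, ℤ) where
  carrier := {γ | ∃ n : ℤ, γ = ModularGroup.T ^ n ∨ γ = -ModularGroup.T ^ n}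
  one_mem' := ⟨0, Or.inl (by simp)⟩
  mul_mem' := by
    rintro _ _ ⟨a, rfl | rfl⟩ ⟨b, rfl | rfl⟩ <;> refine ⟨a + b, ?_⟩ <;> simp [zpow_add]
  inv_mem' := by
    rintro _ ⟨a, rfl | rfl⟩ <;> refine ⟨-a, ?_⟩
    · simp
    · right
      rw [zpow_neg]
      apply inv_eq_of_mul_eq_one_left
      simp

/-- The set of cosets `Γ_∞ \ Γ₀(N)`. -/
abbrev Cosets (N : ℕ) : Type :=
  Quotient (QuotientGroup.rightRel (GammaInfty.subgroupOf (CongruenceSubgroup.Gamma0 N)))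

/-- The term `(φ_{m,k}(·, s)|_k γ)(z)` of the Poincaré series for the coset `Γ_∞ γ`.  It does not
depend on the representative when `k` is even, or half-integral with `4 ∣ N`. -/
def poincareTerm (m : ℤ) (k : ℝ) (N : ℕ) (z : ℍ) (s : ℂ) (g : Cosets N) : ℂ :=
  slash k (phi m k s) (g.out : SL(2, ℤ)) z

/-- The Poincaré series `F_{m,k,N}(z, s)`. -/
def poincare (m : ℤ) (k : ℝ) (N : ℕ) (z : ℍ) (s : ℂ) : ℂ :=
  ∑' g : Cosets N, poincareTerm m k N z s g

/-! ### Fourier coefficients -/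

open Classical in
/-- The generalized Kloosterman sum `K_k(m, n, c)`; `((v : ZMod c)⁻¹).val` is an inverse of `v`
modulo `c`. -/
def kloosterman (k : ℝ) (m n : ℤ) (c : ℕ) : ℂ :=
  ∑ v ∈ (Finset.range c).filter fun v => v.Coprime c,
    (if IsIntegral k then 1
      else (quadSymbol c v : ℂ) ^ (2 * (k : ℂ)) * eps v ^ (2 * (k : ℂ))) *
    e (((m : ℂ) * (((v : ZMod c)⁻¹).val : ℂ) + (n : ℂ) * (v : ℂ)) / (c : ℂ))

/-- The factor of `K_k(m,n,c)/c` (with `c` in place of `Nc`) in the series for `c_{m,k}(n, s)`. -/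
def coeffWeight (m : ℤ) (k : ℝ) (n : ℤ) (s : ℂ) (c : ℕ) : ℂ :=
  if 0 < m * n then
    ((|(m * n : ℝ)| ^ ((1 - k) / 2) : ℝ) : ℂ) *
      besselJ (2 * s - 1) (4 * Real.pi * √|(m * n : ℝ)| / c)
  else if m * n < 0 then
    ((|(m * n : ℝ)| ^ ((1 - k) / 2) : ℝ) : ℂ) *
      besselI (2 * s - 1) (4 * Real.pi * √|(m * n : ℝ)| / c)
  else if m + n ≠ 0 then
    (2 : ℂ) ^ ((k : ℂ) - 1) * (Real.pi : ℂ) ^ (s + k / 2 - 1) *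
      ((|(m + n : ℝ)| : ℝ) : ℂ) ^ (s - k / 2) * (c : ℂ) ^ (1 - 2 * s)
  else
    (2 : ℂ) ^ (2 * (k : ℂ) - 2) * (Real.pi : ℂ) ^ ((k : ℂ) - 1) * Complex.Gamma (2 * s) *
      (2 * (c : ℂ)) ^ (1 - 2 * s)

/-- The `c`-th term of the series for `c_{m,k}(n, s)`. -/
def coeffTerm (m : ℤ) (k : ℝ) (N : ℕ) (n : ℤ) (s : ℂ) (c : ℕ+) : ℂ :=
  kloosterman k m n (N * c) / ((N * c : ℕ) : ℂ) * coeffWeight m k n s (N * c)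

/-- The coefficient `c_{m,k}(n, s)` (for level `N`). -/
def coeff (m : ℤ) (k : ℝ) (N : ℕ) (n : ℤ) (s : ℂ) : ℂ :=
  2 * Real.pi * Complex.I ^ (-(k : ℂ)) * ∑' c : ℕ+, coeffTerm m k N n s c

/-- The function `𝔪_{m,k}(y)`; `(-1)^{k-1}` is the principal value `exp(πi(k-1))`. -/
def frakM (m : ℤ) (k : ℝ) (y : ℝ) : ℂ :=
  if m = 0 then ((y ^ (1 - k) : ℝ) : ℂ)
  else if m < 0 then
    1 - incGamma (1 - k) (-4 * Real.pi * m * y) / Complex.Gamma (1 - k)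
  else
    (-1 : ℂ) ^ ((k : ℂ) - 1) *
      (1 - incGamma (1 - k) (-4 * Real.pi * m * y) / Complex.Gamma (1 - k))

/-- The term of index `n > 0` of the holomorphic part of the expansion at `s = 1 - k/2`. -/
def posTerm (m : ℤ) (k : ℝ) (N : ℕ) (z : ℍ) (n : ℤ) : ℂ :=
  coeff m k N n (1 - k / 2) * ((n : ℝ) ^ (k - 1) : ℝ) * e (n * z)

/-- The term of index `n < 0` of the non-holomorphic part of the expansion at `s = 1 - k/2`. -/
def negTerm (m : ℤ) (k : ℝ) (N : ℕ) (z : ℍ) (n : ℤ) : ℂ :=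
  coeff m k N n (1 - k / 2) * (|(n : ℝ)| ^ (k - 1) : ℝ) *
    (incGamma (1 - k) (-4 * Real.pi * n * z.im) / Complex.Gamma (1 - k)) * e (n * z)

end WeakMaass

end

open scoped UpperHalfPlane

noncomputable section

open scoped UpperHalfPlane MatrixGroups ContDiff Nat FourierTransform NumberTheorySymbols

namespace WeakMaass


/-! ### The theta multiplier -/

/-! At `s = 1 - k/2` the Whittaker function degenerates. Euler's integral for Kummer's function
gives, for either sign of `m`, `φ(z) = A y^{1-k} ∫₀¹ κ(u) e(m((1-u)z + u z̄)) du` with `κ(u) = (1-k)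
u^{-k}` (`phi_eq`). Slashing by `γ` and writing `|w|² = w w̄` turns the Poincaré series into `A
y^{1-k}` times a sum of unimodular multiples of `(cz+d)⁻¹ (cz̄+d)^{k-1} ∫₀¹ κ(u) e(m((1-u)γz + u
γz̄)) du` (`slash_phi_eq`). The total exponent `2 - k` exceeds 2, hence absolute convergence. Sums
of this type are closed under both Wirtinger derivatives with no loss of convergence, hence
smoothness (`hasWirtingerAt_kernelSum`, `contDiffOn_kernelSum`).

Invariance needs the cocycle relation for the theta factor. It is verified on `T`, `-1` and `(1 0; 4
1)`, by comparing signs of quadratic symbols with branch jumps of the square root, and these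
matrices generate `Γ₀(4)` (`isThetaCompatible_of_mem`).

One integration by parts in `u` collapses the antiholomorphic derivative of a summand to `y^{-k}`
times the conjugate of a summand of the holomorphic Poincaré series of weight `2 - k` and index `-m`
(`kernelTerm_dzbar_identity`). So `ξ_k F` is a multiple of that series, and `Δ_k F = 0` follows
since `Δ_k` factors through `∂/∂z̄`. At all cusps the terms are compared with one lattice sum `∑
‖(c,d)‖^{-a}`, `a > 2`. For `m < 0` a small power of `|cz+d|` is given up in exchange for decay in
`y`.

For the Fourier expansion, Poisson summation over `d ≡ v` modulo `Nc` leads to the Fourier transform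
of the kernel on a horizontal line. Expanding the exponential produces averages of `((1-u)/w +
u/w̄)^j`, which times `w⁻¹ w̄^{k-1}` are multiples of its `j`-th derivative (`lineSum_eq`). The
transform is therefore `₀F₁(; 2-k; ·)`, a Bessel function, times the transform of `w⁻¹ w̄^{k-1}`,
which is an exponential for `ν ≥ 0` and acquires an incomplete gamma factor for `ν < 0`
(`fourier_lineBase`). Summing over `v` gives the Kloosterman sums, `amplitude_eq_coeffWeight`
matches the constants, and the identity coset contributes the term of index `m` (`frakM_mul_e`). -/

lemma jacobiSym_four_mul_sub_one {u : ℤ} (hu : u ≠ 0) :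
    J(u | 4 * u.natAbs - 1) = u.sign := by
  have hpos : 0 < u.natAbs := Int.natAbs_pos.mpr hu
  have hodd : Odd (4 * u.natAbs - 1) := ⟨2 * u.natAbs - 1, by omega⟩
  -- Modulo `4|u| - 1` the number `4|u|` is 1, and 4 is a square. For `u < 0` the sign comes from
  -- `(-1/n)` with `n ≡ 3 (mod 4)`.
  have key : J((u.natAbs : ℤ) | 4 * u.natAbs - 1) = 1 := by
    have h1 : J(4 * (u.natAbs : ℤ) | 4 * u.natAbs - 1) = 1 := by
      have : (4 * (u.natAbs : ℤ)) % ((4 * u.natAbs - 1 : ℕ) : ℤ) =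
          1 % ((4 * u.natAbs - 1 : ℕ) : ℤ) := by
        apply Int.emod_emod_of_dvd _ (dvd_refl _) |>.symm.trans
        have : (4 * (u.natAbs : ℤ)) = 1 + ((4 * u.natAbs - 1 : ℕ) : ℤ) := by omega
        rw [this]; simp
      rw [jacobiSym.mod_left' this, jacobiSym.one_left]
    rwa [jacobiSym.mul_left, jacobiSym.at_four hodd, one_mul] at h1
  rcases lt_or_gt_of_ne hu with h | h
  · have hu' : u = -(u.natAbs : ℤ) := by omega
    have h3 : ((4 * u.natAbs - 1 : ℕ)) % 4 = 3 := by omega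
    rw [Int.sign_eq_neg_one_of_neg h]
    conv_lhs => rw [hu']
    rw [Int.natAbs_neg, Int.natAbs_natCast, jacobiSym.neg _ hodd, key, mul_one,
      ZMod.χ₄_nat_three_mod_four h3]
  · have hu' : u = (u.natAbs : ℤ) := by omega
    rw [Int.sign_eq_one_of_pos h]
    rw [← hu'] at key
    exact key

/-- Here `n' ≡ -n ≡ (4|u| - 1) n` modulo `4|u|`. The symbol `(u/·)` is multiplicative and has period
`4|u|` on odd numbers, so the previous lemma supplies the factor. -/
lemma jacobiSym_of_add_eq {u : ℤ} (hu : u ≠ 0) {n n' : ℕ} (hn : Odd n) (hn' : Odd n')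
    (h : n + n' = 4 * u.natAbs) : J(u | n') = u.sign * J(u | n) := by
  have hpos : 0 < u.natAbs := Int.natAbs_pos.mpr hu
  have hn0 : n ≠ 0 := by rintro rfl; simp at hn
  have hodd : Odd (4 * u.natAbs - 1) := ⟨2 * u.natAbs - 1, by omega⟩
  rw [← jacobiSym_four_mul_sub_one hu, ← jacobiSym.mul_right' _ (by omega) hn0,
    jacobiSym.mod_right u hn', jacobiSym.mod_right u (hodd.mul hn)]
  congr 1
  refine (Nat.ModEq.add_right_cancel' n ?_ : n' ≡ (4 * u.natAbs - 1) * n [MOD 4 * u.natAbs])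
  have e1 : n' + n = 4 * u.natAbs := by omega
  have e2 : (4 * u.natAbs - 1) * n + n = 4 * u.natAbs * n := by
    rw [← Nat.succ_mul]; congr 1; omega
  rw [e1, e2]
  exact ((Nat.modEq_zero_iff_dvd.mpr dvd_rfl)).trans
    ((Nat.modEq_zero_iff_dvd.mpr (dvd_mul_right _ _)).symm)

lemma jacobiSym_four_mul {u : ℤ} {n : ℕ} (hn : Odd n) : J(4 * u | n) = J(u | n) := by
  rw [jacobiSym.mul_left, jacobiSym.at_four hn, one_mul]

lemma jacobiSym_congr_of_modEq {u : ℤ} {n n' : ℕ} (hn : Odd n) (hn' : Odd n')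
    (h : n ≡ n' [MOD 4 * u.natAbs]) : J(u | n) = J(u | n') := by
  rw [jacobiSym.mod_right u hn, jacobiSym.mod_right u hn']
  exact congrArg _ h

/-- With `c = 4u` the Jacobi symbol is `(u/|d|)`, of period `|c|` in `|d|`. If `d` and `d + c` have
the same sign, `|d|` moves by `|c|`. Otherwise `|d| + |d + c| = |c|`, and the factor `sign u` of the
reflection is absorbed by the convention for two negative entries. -/
lemma quadSymbol_add_right {c d : ℤ} (hc : 4 ∣ c) (hd : Odd d) :
    quadSymbol c (d + c) = quadSymbol c d := by
  obtain ⟨u, rfl⟩ := hc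
  have hd1 : Odd (d + 4 * u) := hd.add_even ⟨2 * u, by ring⟩
  have ho : Odd d.natAbs := Int.natAbs_odd.mpr hd
  have ho1 : Odd (d + 4 * u).natAbs := Int.natAbs_odd.mpr hd1
  have hd0 : d ≠ 0 := by rintro rfl; simp at hd
  have hd10 : d + 4 * u ≠ 0 := by intro h; rw [h] at hd1; simp at hd1
  unfold quadSymbol
  rw [jacobiSym_four_mul ho, jacobiSym_four_mul ho1]
  rcases eq_or_ne u 0 with rfl | hu
  · simp
  have pos_of : ∀ a b : ℕ, (a : ℤ) = b + 4 * u.natAbs → a ≡ b [MOD 4 * u.natAbs] := by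
    intro a b h
    have : a = b + 4 * u.natAbs := by exact_mod_cast h
    rw [this]; simp [Nat.ModEq]
  rcases lt_or_gt_of_ne hd0 with h1 | h1 <;> rcases lt_or_gt_of_ne hd10 with h2 | h2
  · have : J(u | (d + 4 * u).natAbs) = J(u | d.natAbs) := by
      rcases lt_or_gt_of_ne hu with h3 | h3
      · exact jacobiSym_congr_of_modEq ho1 ho (pos_of _ _ (by omega))
      · exact (jacobiSym_congr_of_modEq ho ho1 (pos_of _ _ (by omega))).symm
    simp [this, h1, h2]
  · have h3 : 0 < u := by omega
    have := jacobiSym_of_add_eq hu ho ho1 (by omega)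
    rw [Int.sign_eq_one_of_pos h3, one_mul] at this
    rw [if_neg (by omega), if_neg (by omega), this]
  · have h3 : u < 0 := by omega
    have := jacobiSym_of_add_eq hu ho ho1 (by omega)
    rw [Int.sign_eq_neg_one_of_neg h3] at this
    rw [if_pos (by omega), if_neg (by omega), this]; ring
  · have : J(u | (d + 4 * u).natAbs) = J(u | d.natAbs) := by
      rcases lt_or_gt_of_ne hu with h3 | h3
      · exact (jacobiSym_congr_of_modEq ho ho1 (pos_of _ _ (by omega))).symm
      · exact jacobiSym_congr_of_modEq ho1 ho (pos_of _ _ (by omega))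
    rw [if_neg (by omega), if_neg (by omega), this]

/-- The Jacobi symbol only sees `c` modulo `|d|`, so just the sign convention can change. It changes
exactly when the square root in `isThetaCompatible_lowerFour` jumps. -/
lemma quadSymbol_add_left (c d : ℤ) : quadSymbol (c + 4 * d) d =
    (if (c < 0 ∧ d < 0) ↔ (c + 4 * d < 0 ∧ d < 0) then 1 else -1) * quadSymbol c d := by
  have : J(c + 4 * d | d.natAbs) = J(c | d.natAbs) := by
    apply jacobiSym.mod_left'
    have : (d.natAbs : ℤ) ∣ 4 * d := (Int.natAbs_dvd.mpr dvd_rfl).mul_left 4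
    rw [Int.add_emod, Int.emod_eq_zero_of_dvd this]; simp
  unfold quadSymbol
  rw [this]
  split_ifs <;> first | ring1 | (exfalso; tauto)

lemma quadSymbol_neg_neg {c d : ℤ} (hd : Odd d) (hc : c ≠ 0) :
    quadSymbol (-c) (-d) = -c.sign * (if d % 4 = 1 then 1 else -1) * quadSymbol c d := by
  have ho : Odd d.natAbs := Int.natAbs_odd.mpr hd
  have hd0 : d ≠ 0 := by rintro rfl; simp at hd
  have hd2 : d % 2 = 1 := Int.odd_iff.mp hd
  unfold quadSymbol
  rw [Int.natAbs_neg, jacobiSym.neg _ ho]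
  rcases lt_or_gt_of_ne hc with h1 | h1 <;> rcases lt_or_gt_of_ne hd0 with h2 | h2 <;>
    (first | rw [Int.sign_eq_neg_one_of_neg h1] | rw [Int.sign_eq_one_of_pos h1]) <;>
    by_cases h3 : d % 4 = 1 <;>
    (first
      | rw [ZMod.χ₄_nat_three_mod_four (n := d.natAbs) (by omega)]
      | rw [ZMod.χ₄_nat_one_mod_four (n := d.natAbs) (by omega)]) <;>
    simp [h1, h2, h3, not_lt.mpr h1.le, not_lt.mpr h2.le]

lemma quadSymbol_sq {c d : ℤ} (h : IsCoprime c d) : quadSymbol c d ^ 2 = 1 := by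
  have : J(c | d.natAbs) ^ 2 = 1 := jacobiSym.sq_one (by
    rw [Int.isCoprime_iff_gcd_eq_one] at h
    simpa only [Int.gcd, Int.natAbs_natCast] using h)
  unfold quadSymbol
  split_ifs <;> simp [this]

/-! ### Principal square roots of products -/

/-- Since `0 < arg v < π`, each of the three alternatives forces `arg w + arg v ≤ π`: a larger sum
would make its sine, hence `Im (wv)`, negative. The logarithms then add without correction. -/
lemma sqrt_mul_of_arg_add_le {w v : ℂ} (hv : 0 < v.im) (hw : w ≠ 0)
    (h : w.im < 0 ∨ w.arg = 0 ∨ 0 ≤ (w * v).im) :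
    (w * v) ^ (1 / 2 : ℂ) = w ^ (1 / 2 : ℂ) * v ^ (1 / 2 : ℂ) := by
  have hv0 : v ≠ 0 := by rintro rfl; simp at hv
  have h1 := Complex.neg_pi_lt_arg w
  have h2 : 0 < v.arg := (lt_of_le_of_ne (Complex.arg_nonneg_iff.mpr hv.le) fun h => by
    have := (Complex.arg_eq_zero_iff.mp h.symm).2; linarith)
  have h4 : v.arg < Real.pi := Complex.arg_lt_pi_iff.mpr (Or.inr hv.ne')
  have h5 := Complex.arg_le_pi w
  have hs : w.arg + v.arg ≤ Real.pi := by
    by_contra! hc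
    rcases h with h | h | h
    · have := Complex.arg_neg_iff.mpr h; linarith
    · linarith
    · have him : (w * v).im = ‖w‖ * ‖v‖ * Real.sin (w.arg + v.arg) := by
        rw [Real.sin_add, Complex.mul_im]
        nth_rewrite 1 [← Complex.norm_mul_cos_arg w]
        nth_rewrite 1 [← Complex.norm_mul_sin_arg w]
        nth_rewrite 1 [← Complex.norm_mul_cos_arg v]
        nth_rewrite 1 [← Complex.norm_mul_sin_arg v]
        ring
      have hneg : Real.sin (w.arg + v.arg) < 0 := by
        have := Real.sin_pos_of_pos_of_lt_pi (x := w.arg + v.arg - Real.pi) (by linarith)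
          (by linarith)
        rw [Real.sin_sub_pi] at this; linarith
      have : 0 < ‖w‖ * ‖v‖ := by positivity
      nlinarith
  rw [Complex.cpow_def_of_ne_zero (mul_ne_zero hw hv0), Complex.cpow_def_of_ne_zero hw,
    Complex.cpow_def_of_ne_zero hv0, Complex.log_mul hw hv0 ⟨by linarith, hs⟩, add_mul,
    Complex.exp_add]

/-- The arguments add up to more than `π`, so the logarithm of the product loses `2πi`, which the
exponent `1/2` turns into the factor `-1`. -/
lemma sqrt_mul_of_lt_arg_add {w v : ℂ} (hv : 0 < v.im) (hw : w ≠ 0)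
    (hw' : 0 ≤ w.im) (h : (w * v).im < 0) :
    (w * v) ^ (1 / 2 : ℂ) = -(w ^ (1 / 2 : ℂ) * v ^ (1 / 2 : ℂ)) := by
  have hv0 : v ≠ 0 := by rintro rfl; simp at hv
  have h1 : 0 ≤ w.arg := Complex.arg_nonneg_iff.mpr hw'
  have h3 : 0 ≤ v.arg := Complex.arg_nonneg_iff.mpr hv.le
  have h4 : v.arg < Real.pi := Complex.arg_lt_pi_iff.mpr (Or.inr hv.ne')
  have h5 := Complex.arg_le_pi w
  have hs : Real.pi < w.arg + v.arg := by
    by_contra! hc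
    have h6 := Complex.arg_mul hw hv0 ⟨by linarith [Real.pi_pos], hc⟩
    have : 0 ≤ (w * v).im := Complex.arg_nonneg_iff.mp (by rw [h6]; positivity)
    linarith
  have hlog : Complex.log (w * v) = Complex.log w + Complex.log v - 2 * Real.pi * Complex.I := by
    rw [← Complex.log_exp (x := Complex.log w + Complex.log v - 2 * Real.pi * Complex.I)]
    · rw [Complex.exp_sub, Complex.exp_add, Complex.exp_log hw, Complex.exp_log hv0,
        Complex.exp_two_pi_mul_I, div_one]
    · simp [Complex.log_im]; linarith
    · simp [Complex.log_im]; linarith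
  rw [Complex.cpow_def_of_ne_zero (mul_ne_zero hw hv0), Complex.cpow_def_of_ne_zero hw,
    Complex.cpow_def_of_ne_zero hv0, hlog, ← Complex.exp_add]
  have : (Complex.log w + Complex.log v - 2 * Real.pi * Complex.I) * (1 / 2) =
      Complex.log w * (1 / 2) + Complex.log v * (1 / 2) - Real.pi * Complex.I := by ring
  rw [this, Complex.exp_sub, Complex.exp_pi_mul_I, div_neg, div_one]

lemma sqrt_neg_of_im_pos {w : ℂ} (hw : 0 < w.im) :
    (-w) ^ (1 / 2 : ℂ) = -(Complex.I * w ^ (1 / 2 : ℂ)) := by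
  have hw0 : w ≠ 0 := by rintro rfl; simp at hw
  have hlog : Complex.log (-w) = Complex.log w - Real.pi * Complex.I := by
    simp only [Complex.log, norm_neg, Complex.arg_neg_eq_arg_sub_pi_of_im_pos hw]
    push_cast; ring
  rw [Complex.cpow_def_of_ne_zero (neg_ne_zero.mpr hw0), Complex.cpow_def_of_ne_zero hw0, hlog]
  have : (Complex.log w - Real.pi * Complex.I) * (1 / 2) =
      Complex.log w * (1 / 2) - Real.pi / 2 * Complex.I := by ring
  rw [this, Complex.exp_sub, Complex.exp_pi_div_two_mul_I, div_eq_mul_inv, Complex.inv_I]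
  ring

lemma sqrt_neg_of_im_neg {w : ℂ} (hw : w.im < 0) :
    (-w) ^ (1 / 2 : ℂ) = Complex.I * w ^ (1 / 2 : ℂ) := by
  have := sqrt_neg_of_im_pos (w := -w) (by simpa using hw)
  rw [neg_neg] at this
  rw [this]
  linear_combination (-w) ^ (1 / 2 : ℂ) * Complex.I_mul_I

/-! ### The theta automorphy factor -/

/-- The automorphy factor `(c/d) ε_d⁻¹ √(cz+d)` of the theta function. -/
def thetaFactor (γ : SL(2, ℤ)) (z : ℍ) : ℂ :=
  (quadSymbol (γ 1 0) (γ 1 1) : ℂ) * (eps (γ 1 1))⁻¹ * cocycle γ z ^ (1 / 2 : ℂ)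

lemma cocycle_eq_denom (γ : SL(2, ℤ)) (z : ℍ) : cocycle γ z = UpperHalfPlane.denom γ z := by
  rw [ModularGroup.denom_apply]; rfl

lemma cocycle_ne_zero (γ : SL(2, ℤ)) (z : ℍ) : cocycle γ z ≠ 0 := by
  rw [cocycle_eq_denom]; exact UpperHalfPlane.denom_ne_zero _ _

lemma coe_smul (γ : SL(2, ℤ)) (z : ℍ) :
    ((γ • z : ℍ) : ℂ) = ((γ 0 0 : ℂ) * z + γ 0 1) / cocycle γ z := by
  rw [UpperHalfPlane.specialLinearGroup_apply]; simp [cocycle]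

lemma sl_det (γ : SL(2, ℤ)) : γ 0 0 * γ 1 1 - γ 0 1 * γ 1 0 = 1 := by
  have := γ.det_coe
  rwa [Matrix.det_fin_two] at this

lemma isCoprime_row (γ : SL(2, ℤ)) : IsCoprime (γ 1 0) (γ 1 1) :=
  ⟨-γ 0 1, γ 0 0, by linear_combination sl_det γ⟩

lemma cocycle_mul (γ γ' : SL(2, ℤ)) (z : ℍ) :
    cocycle (γ * γ') z = cocycle γ (γ' • z) * cocycle γ' z := by
  have h := cocycle_ne_zero γ' z
  rw [cocycle, cocycle, coe_smul]
  simp only [Matrix.SpecialLinearGroup.coe_mul, Matrix.mul_apply, Fin.sum_univ_two]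
  field_simp
  rw [cocycle]; push_cast; ring

lemma im_smul (γ : SL(2, ℤ)) (z : ℍ) : (γ • z).im = z.im / ‖cocycle γ z‖ ^ 2 := by
  rw [ModularGroup.im_smul_eq_div_normSq, cocycle_eq_denom, Complex.normSq_eq_norm_sq]

lemma mem_Gamma0_iff {N : ℕ} {γ : SL(2, ℤ)} :
    γ ∈ CongruenceSubgroup.Gamma0 N ↔ (N : ℤ) ∣ γ 1 0 := by
  rw [CongruenceSubgroup.Gamma0_mem, ZMod.intCast_zmod_eq_zero_iff_dvd]

lemma eps_congr {d d' : ℤ} (h : d % 4 = d' % 4) : eps d = eps d' := by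
  unfold eps; rw [h]

/-- The generator `(1 0; 4 1)` of `Γ₀(4)`. -/
def lowerFour : SL(2, ℤ) := ⟨!![1, 0; 4, 1], by simp [Matrix.det_fin_two]⟩

lemma mul_lowerFour (γ : SL(2, ℤ)) :
    (γ * lowerFour) 1 0 = γ 1 0 + 4 * γ 1 1 ∧ (γ * lowerFour) 1 1 = γ 1 1 := by
  rw [Matrix.SpecialLinearGroup.coe_mul]
  simp [lowerFour, Matrix.mul_apply, Fin.sum_univ_two]; ring

lemma mul_T_zpow (γ : SL(2, ℤ)) (n : ℤ) :
    (γ * ModularGroup.T ^ n) 1 0 = γ 1 0 ∧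
      (γ * ModularGroup.T ^ n) 1 1 = γ 1 1 + n * γ 1 0 := by
  simp [ModularGroup.coe_T_zpow, Matrix.mul_apply, Fin.sum_univ_two]; ring

lemma odd_of_mem {γ : SL(2, ℤ)} (h : γ ∈ CongruenceSubgroup.Gamma0 4) : Odd (γ 1 1) := by
  obtain ⟨u, hu⟩ := mem_Gamma0_iff.mp h
  have := sl_det γ
  rw [hu] at this
  by_contra hd
  obtain ⟨v, hv⟩ := Int.not_odd_iff_even.mp hd
  rw [hv] at this
  push_cast at this
  have h2 : 2 * (γ 0 0 * v - 2 * (γ 0 1 * u)) = 1 := by linear_combination this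
  omega

/-- The elements `g` of `Γ₀(4)` for which the theta factor satisfies the cocycle relation. -/
def IsThetaCompatible (g : SL(2, ℤ)) : Prop :=
  g ∈ CongruenceSubgroup.Gamma0 4 ∧ ∀ γ ∈ CongruenceSubgroup.Gamma0 4, ∀ z : ℍ,
    thetaFactor (γ * g) z = thetaFactor γ (g • z) * thetaFactor g z

lemma thetaFactor_one (z : ℍ) : thetaFactor 1 z = 1 := by
  simp [thetaFactor, quadSymbol, eps, cocycle]

lemma IsThetaCompatible.one : IsThetaCompatible 1 :=
  ⟨one_mem _, fun γ _ z => by simp [thetaFactor_one]⟩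

/-- The relation is required for all left factors in `Γ₀(4)`, so it passes to products and inverses
of the right factor. Thus checking generators suffices. -/
lemma IsThetaCompatible.mul {g h : SL(2, ℤ)} (hg : IsThetaCompatible g)
    (hh : IsThetaCompatible h) : IsThetaCompatible (g * h) :=
  ⟨mul_mem hg.1 hh.1, fun γ hγ z => by
    rw [← mul_assoc, hh.2 _ (mul_mem hγ hg.1), hg.2 _ hγ, hh.2 _ hg.1, mul_smul, mul_assoc]⟩

lemma IsThetaCompatible.inv {g : SL(2, ℤ)} (hg : IsThetaCompatible g) :
    IsThetaCompatible g⁻¹ :=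
  ⟨inv_mem hg.1, fun γ hγ z => by
    have h1 := hg.2 _ (mul_mem hγ (inv_mem hg.1)) (g⁻¹ • z)
    have h2 := hg.2 _ (inv_mem hg.1) (g⁻¹ • z)
    rw [inv_mul_cancel, thetaFactor_one, smul_inv_smul] at h2
    rw [inv_mul_cancel_right, smul_inv_smul] at h1
    have h3 : thetaFactor g (g⁻¹ • z) ≠ 0 := right_ne_zero_of_mul (h2 ▸ one_ne_zero)
    apply mul_right_cancel₀ h3
    rw [← h1, mul_assoc, ← h2, mul_one]⟩

lemma isThetaCompatible_T : IsThetaCompatible ModularGroup.T := by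
  refine ⟨mem_Gamma0_iff.mpr (by simp [ModularGroup.T]), fun γ hγ z => ?_⟩
  have hT : thetaFactor ModularGroup.T z = 1 := by
    simp [thetaFactor, quadSymbol, eps, cocycle, ModularGroup.T]
  have hr := mul_T_zpow γ 1
  rw [zpow_one, one_mul] at hr
  have hc : (4 : ℤ) ∣ γ 1 0 := mem_Gamma0_iff.mp hγ
  rw [hT, mul_one, thetaFactor, thetaFactor, hr.1, hr.2, quadSymbol_add_right hc (odd_of_mem hγ),
    eps_congr (d := γ 1 1 + γ 1 0) (d' := γ 1 1) (by omega), cocycle_mul]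
  congr 3
  simp [cocycle, ModularGroup.T]

lemma neg_one_sqrt : (-1 : ℂ) ^ (1 / 2 : ℂ) = Complex.I := by
  rw [Complex.cpow_def_of_ne_zero (by simp), Complex.log_neg_one,
    show (Real.pi : ℂ) * Complex.I * (1 / 2) = Real.pi / 2 * Complex.I by ring,
    Complex.exp_pi_div_two_mul_I]

lemma thetaFactor_neg_one (z : ℍ) : thetaFactor (-1) z = 1 := by
  simp only [thetaFactor, cocycle]
  have : ((((-1 : SL(2, ℤ)) 1 0 : ℤ) : ℂ) * z + ((-1 : SL(2, ℤ)) 1 1 : ℤ)) = -1 := by simp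
  rw [this, neg_one_sqrt]
  simp [quadSymbol, eps]

/-- For `c ≠ 0`, `√(-w)` differs from `√w` by `±i` according to the sign of `c`. The passage from
`ε_d` to `ε_{-d}` and the sign in `quadSymbol_neg_neg` compensate. For `c = 0` the square root is
only evaluated at `±1`. -/
lemma isThetaCompatible_neg_one : IsThetaCompatible (-1) := by
  refine ⟨mem_Gamma0_iff.mpr (by simp), fun γ hγ z => ?_⟩
  have h1 := neg_one_sqrt
  have hI := thetaFactor_neg_one z
  have hodd := odd_of_mem hγ
  have hz : (-1 : SL(2, ℤ)) • z = z := by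
    ext; rw [coe_smul]; simp [cocycle]
  have hcoc : cocycle (γ * -1) z = -cocycle γ z := by simp [cocycle]; ring
  have hr : (γ * -1) 1 0 = -γ 1 0 ∧ (γ * -1) 1 1 = -γ 1 1 := by simp
  rw [hI, mul_one, hz, thetaFactor, thetaFactor, hr.1, hr.2, hcoc]
  have him : (cocycle γ z).im = γ 1 0 * z.im := by simp [cocycle]
  have hd2 : γ 1 1 % 2 = 1 := Int.odd_iff.mp hodd
  rcases eq_or_ne (γ 1 0) 0 with hc | hc
  · have hdet := sl_det γ
    rw [hc, mul_zero, sub_zero] at hdet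
    have hcz : cocycle γ z = γ 1 1 := by simp [cocycle, hc]
    rw [hcz, hc]
    rcases Int.eq_one_or_neg_one_of_mul_eq_one' hdet with ⟨_, h⟩ | ⟨_, h⟩ <;> rw [h] <;>
      simp [quadSymbol, eps] <;> rw [← one_div, h1] <;> simp
  · rw [quadSymbol_neg_neg hodd hc]
    have e1 : (if γ 1 1 % 4 = 1 then (1 : ℤ) else -1) * (eps (-γ 1 1))⁻¹ =
        -Complex.I * (eps (γ 1 1))⁻¹ := by
      unfold eps
      by_cases h : γ 1 1 % 4 = 1
      · rw [if_pos h, if_pos h, if_neg (by omega)]; simp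
      · rw [if_neg h, if_neg h, if_pos (by omega)]; simp
    rcases lt_or_gt_of_ne hc with h | h
    · rw [sqrt_neg_of_im_neg (by rw [him]; exact mul_neg_of_neg_of_pos (by exact_mod_cast h) z.im_pos),
        Int.sign_eq_neg_one_of_neg h]
      push_cast at e1 ⊢
      linear_combination (quadSymbol (γ 1 0) (γ 1 1) : ℂ) * Complex.I *
        cocycle γ z ^ (1 / 2 : ℂ) * e1 - (quadSymbol (γ 1 0) (γ 1 1) : ℂ) * (eps (γ 1 1))⁻¹ *
        cocycle γ z ^ (1 / 2 : ℂ) * Complex.I_mul_I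
    · rw [sqrt_neg_of_im_pos (by rw [him]; exact mul_pos (by exact_mod_cast h) z.im_pos),
        Int.sign_eq_one_of_pos h]
      push_cast at e1 ⊢
      linear_combination (quadSymbol (γ 1 0) (γ 1 1) : ℂ) * Complex.I *
        cocycle γ z ^ (1 / 2 : ℂ) * e1 - (quadSymbol (γ 1 0) (γ 1 1) : ℂ) * (eps (γ 1 1))⁻¹ *
        cocycle γ z ^ (1 / 2 : ℂ) * Complex.I_mul_I

/-- With `w` the cocycle of `γ` at the moved point and `v = 4z + 1`, the imaginary parts of `w` and
`wv` have the signs of `c` and `c + 4d`. The root of `wv` is `-√w √v` exactly when `c ≥ 0 > c + 4d`;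
this forces `d < 0` and is precisely the case in which the convention in `quadSymbol` switches. -/
lemma isThetaCompatible_lowerFour : IsThetaCompatible lowerFour := by
  refine ⟨mem_Gamma0_iff.mpr (by simp [lowerFour]), fun γ hγ z => ?_⟩
  have hcL : cocycle lowerFour z = 4 * z + 1 := by simp [cocycle, lowerFour]
  have hL : thetaFactor lowerFour z = (4 * (z : ℂ) + 1) ^ (1 / 2 : ℂ) := by
    rw [thetaFactor, hcL]; simp [lowerFour, quadSymbol, eps]
  have hv : 0 < (4 * (z : ℂ) + 1).im := by simpa using z.im_pos
  have hw0 := cocycle_ne_zero γ (lowerFour • z)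
  have hodd := odd_of_mem hγ
  have hr := mul_lowerFour γ
  have him : (cocycle γ (lowerFour • z) * (4 * (z : ℂ) + 1)).im =
      (γ 1 0 + 4 * γ 1 1 : ℤ) * z.im := by
    rw [← hcL, ← cocycle_mul, cocycle, hr.1, hr.2]; simp
  have him2 : (cocycle γ (lowerFour • z)).im = γ 1 0 * (lowerFour • z).im := by
    simp [cocycle]
  have hy := z.im_pos
  have hy2 := (lowerFour • z).im_pos
  rw [hL, thetaFactor, thetaFactor, cocycle_mul, hcL, hr.1, hr.2, quadSymbol_add_left]
  split_ifs with h
  · rw [sqrt_mul_of_arg_add_le hv hw0]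
    · push_cast; ring
    · rw [him, him2]
      rcases lt_trichotomy (γ 1 0) 0 with h1 | h1 | h1
      · exact Or.inl (mul_neg_of_neg_of_pos (by exact_mod_cast h1) hy2)
      · rcases lt_or_ge (γ 1 1) 0 with h2 | h2
        · omega
        · right; left
          rw [cocycle, h1]
          simpa using Complex.arg_ofReal_of_nonneg (x := γ 1 1) (by exact_mod_cast h2)
      · right; right
        refine mul_nonneg ?_ hy.le
        have : 0 ≤ γ 1 0 + 4 * γ 1 1 := by
          by_contra hh
          omega
        exact_mod_cast this
  · rw [sqrt_mul_of_lt_arg_add hv hw0]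
    · push_cast; ring
    · rw [him2]
      refine mul_nonneg ?_ hy2.le
      have : 0 ≤ γ 1 0 := by omega
      exact_mod_cast this
    · rw [him]
      refine mul_neg_of_neg_of_pos ?_ hy
      have : γ 1 0 + 4 * γ 1 1 < 0 := by omega
      exact_mod_cast this

/-! ### Euclid's algorithm on bottom rows and generators of `Γ₀(4)`. -/

lemma exists_two_mul_abs_add_mul_le (x : ℤ) {m : ℤ} (hm : m ≠ 0) :
    ∃ n : ℤ, 2 * |x + n * m| ≤ |m| := by
  have h1 := Int.emod_add_mul_ediv x m
  have h2 := Int.emod_nonneg x hm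
  have h3 := Int.emod_lt_abs x hm
  by_cases h : 2 * (x % m) ≤ |m|
  · refine ⟨-(x / m), ?_⟩
    rw [show x + -(x / m) * m = x % m by linear_combination -h1, abs_of_nonneg h2]; exact h
  · refine ⟨-(x / m) - m.sign, ?_⟩
    have hs := Int.sign_mul_self_eq_abs m
    rw [show x + (-(x / m) - m.sign) * m = x % m - |m| by linear_combination -h1 - hs,
      abs_of_nonpos (by omega)]
    omega

lemma eq_T_zpow_or_neg_of_row {γ : SL(2, ℤ)} (h : γ 1 0 = 0) :
    ∃ n : ℤ, γ = ModularGroup.T ^ n ∨ γ = -ModularGroup.T ^ n := by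
  have hdet := sl_det γ
  rw [h, mul_zero, sub_zero] at hdet
  rcases Int.eq_one_or_neg_one_of_mul_eq_one' hdet with ⟨h1, h2⟩ | ⟨h1, h2⟩
  · refine ⟨γ 0 1, Or.inl ?_⟩
    ext i j
    rw [ModularGroup.coe_T_zpow]
    fin_cases i <;> fin_cases j <;> simp [h, h1, h2]
  · refine ⟨-γ 0 1, Or.inr ?_⟩
    ext i j
    rw [Matrix.SpecialLinearGroup.coe_neg, ModularGroup.coe_T_zpow]
    fin_cases i <;> fin_cases j <;> simp [h, h1, h2]

lemma mem_GammaInfty_iff {γ : SL(2, ℤ)} : γ ∈ GammaInfty ↔ γ 1 0 = 0 := by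
  refine ⟨?_, eq_T_zpow_or_neg_of_row⟩
  rintro ⟨n, rfl | rfl⟩ <;> simp [ModularGroup.coe_T_zpow]

/-- Descent on `|c|`: a power of `T` replaces `d` by its least absolute residue modulo `c`, then a
power of `lowerFour` does the same for `c` modulo `4d`. At `c = 0` only `±T^n` remain. -/
lemma isThetaCompatible_of_mem (γ : SL(2, ℤ)) (hγ : γ ∈ CongruenceSubgroup.Gamma0 4) :
    IsThetaCompatible γ := by
  let K : Subgroup SL(2, ℤ) :=
    { carrier := {g | IsThetaCompatible g}
      one_mem' := IsThetaCompatible.one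
      mul_mem' := fun h h' => h.mul h'
      inv_mem' := fun h => h.inv }
  have hT : ModularGroup.T ∈ K := isThetaCompatible_T
  have hL : lowerFour ∈ K := isThetaCompatible_lowerFour
  have hN : -1 ∈ K := isThetaCompatible_neg_one
  have hrowL : ∀ (g : SL(2, ℤ)) (n : ℤ), (g * lowerFour ^ n) 1 0 = g 1 0 + n * (4 * g 1 1) ∧
      (g * lowerFour ^ n) 1 1 = g 1 1 := by
    intro g n
    have : ∀ n : ℤ, ((lowerFour ^ n : SL(2, ℤ)) : Matrix (Fin 2) (Fin 2) ℤ) =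
        !![1, 0; 4 * n, 1] := by
      intro n
      induction n with
      | zero => simp [Matrix.one_fin_two]
      | succ n ih =>
        rw [zpow_add, zpow_one, Matrix.SpecialLinearGroup.coe_mul, ih]
        simp [lowerFour]; ring
      | pred n ih =>
        rw [zpow_sub, zpow_one, Matrix.SpecialLinearGroup.coe_mul, ih,
          Matrix.SpecialLinearGroup.coe_inv]
        simp [lowerFour, Matrix.adjugate_fin_two]; ring
    simp [this, Matrix.mul_apply, Fin.sum_univ_two]; ring
  change γ ∈ K
  induction hn : (γ 1 0).natAbs using Nat.strong_induction_on generalizing γ with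
  | _ n ih =>
    rcases eq_or_ne (γ 1 0) 0 with hc | hc
    · obtain ⟨l, h | h⟩ := eq_T_zpow_or_neg_of_row hc
      · rw [h]; exact zpow_mem hT l
      · rw [h, ← neg_one_mul]; exact mul_mem hN (zpow_mem hT l)
    · obtain ⟨l, hl⟩ := exists_two_mul_abs_add_mul_le (γ 1 1) hc
      have hr := mul_T_zpow γ l
      set γ1 := γ * ModularGroup.T ^ l with hγ1
      have hγ1m : γ1 ∈ CongruenceSubgroup.Gamma0 4 := mul_mem hγ (zpow_mem isThetaCompatible_T.1 l)
      have hodd := odd_of_mem hγ1m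
      have h40 : (4 : ℤ) ∣ γ 1 0 := mem_Gamma0_iff.mp hγ
      have hd2 := Int.odd_iff.mp hodd
      obtain ⟨l', hl'⟩ := exists_two_mul_abs_add_mul_le (γ1 1 0) (m := 4 * γ1 1 1) (by omega)
      have hr' := hrowL γ1 l'
      -- The two reductions give `|c'| ≤ 2|d₁| ≤ |c|`. Equality on the right is impossible because
      -- `4 ∣ c` and `d₁` is odd.
      have hlt : ((γ1 * lowerFour ^ l') 1 0).natAbs < n := by
        rw [← hn, hr'.1]
        rw [← hr.2] at hl
        rw [Int.abs_eq_natAbs, Int.abs_eq_natAbs] at hl hl'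
        omega
      have hmem := ih _ hlt (γ1 * lowerFour ^ l')
        (mul_mem hγ1m (zpow_mem isThetaCompatible_lowerFour.1 l')) rfl
      have e : γ = γ1 * lowerFour ^ l' * (lowerFour ^ l')⁻¹ * (ModularGroup.T ^ l)⁻¹ := by
        rw [hγ1]; group
      rw [e]
      exact mul_mem (mul_mem hmem (inv_mem (zpow_mem hL _))) (inv_mem (zpow_mem hT _))

lemma thetaFactor_mul {γ γ' : SL(2, ℤ)} (hγ : γ ∈ CongruenceSubgroup.Gamma0 4)
    (hγ' : γ' ∈ CongruenceSubgroup.Gamma0 4) (z : ℍ) :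
    thetaFactor (γ * γ') z = thetaFactor γ (γ' • z) * thetaFactor γ' z :=
  (isThetaCompatible_of_mem γ' hγ').2 γ hγ z

/-! ### The automorphy factor of weight `k` -/

/-- The weight is even, or half-integral with `4 ∣ N`. -/
def IsAdmissible (k : ℝ) (N : ℕ) : Prop :=
  (∃ l : ℤ, k = 2 * l) ∨ ((∃ l : ℤ, k = l + 1 / 2) ∧ 4 ∣ N)

lemma IsAdmissible.two_sub {k : ℝ} {N : ℕ} (h : IsAdmissible k N) : IsAdmissible (2 - k) N := by
  rcases h with ⟨l, hl⟩ | ⟨⟨l, hl⟩, hN⟩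
  · exact Or.inl ⟨1 - l, by rw [hl]; push_cast; ring⟩
  · exact Or.inr ⟨⟨1 - l, by rw [hl]; push_cast; ring⟩, hN⟩

lemma not_isIntegral_half {k : ℝ} {l : ℤ} (h : k = l + 1 / 2) : ¬ IsIntegral k := by
  rintro ⟨n, hn⟩
  have : (2 * n : ℝ) = 2 * l + 1 := by rw [← hn, h]; ring
  have : 2 * n = 2 * l + 1 := by exact_mod_cast this
  omega

lemma Gamma0_le_of_dvd {M N : ℕ} (h : M ∣ N) :
    CongruenceSubgroup.Gamma0 N ≤ CongruenceSubgroup.Gamma0 M := fun _ hγ =>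
  mem_Gamma0_iff.mpr ((Int.natCast_dvd_natCast.mpr h).trans (mem_Gamma0_iff.mp hγ))

open Classical in
/-- The root of unity in the automorphy factor of weight `k`. -/
def multiplier (k : ℝ) (c d : ℤ) : ℂ :=
  if IsIntegral k then 1 else (quadSymbol c d : ℂ) ^ (2 * (k : ℂ)) * eps d ^ (2 * (k : ℂ))

lemma quadSymbol_eq {c d : ℤ} (h : IsCoprime c d) :
    quadSymbol c d = 1 ∨ quadSymbol c d = -1 := by
  simpa using sq_eq_sq_iff_eq_or_eq_neg.mp ((quadSymbol_sq h).trans (one_pow 2).symm)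

/-- `j(γ, z)^{-2k}`. -/
def autFactor (k : ℝ) (γ : SL(2, ℤ)) (z : ℍ) : ℂ := jFactor k γ z ^ (-2 * (k : ℂ))

lemma eps_ne_zero (d : ℤ) : eps d ≠ 0 := by unfold eps; split_ifs <;> simp

lemma autFactor_mul {k : ℝ} {N : ℕ} (hk : IsAdmissible k N) {γ γ' : SL(2, ℤ)}
    (hγ : γ ∈ CongruenceSubgroup.Gamma0 N) (hγ' : γ' ∈ CongruenceSubgroup.Gamma0 N) (z : ℍ) :
    autFactor k (γ * γ') z = autFactor k γ (γ' • z) * autFactor k γ' z := by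
  rcases hk with ⟨l, hl⟩ | ⟨⟨l, hl⟩, hN⟩
  · have hI : IsIntegral k := ⟨2 * l, by rw [hl]; push_cast; ring⟩
    have key : ∀ (g : SL(2, ℤ)) (w : ℍ), autFactor k g w = cocycle g w ^ (-2 * l) := by
      intro g w
      rw [autFactor, jFactor, if_pos hI]
      have : (-2 * (k : ℂ)) = ((2 * (-2 * l) : ℤ) : ℂ) := by rw [hl]; push_cast; ring
      rw [this, Complex.cpow_intCast, zpow_mul]
      congr 1
      norm_cast
      rw [← Complex.cpow_nat_mul]
      simp
    rw [key, key, key, cocycle_mul, mul_zpow]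
  · have hI := not_isIntegral_half hl
    have key : ∀ (g : SL(2, ℤ)) (w : ℍ), autFactor k g w = thetaFactor g w ^ (-2 * l - 1) := by
      intro g w
      rw [autFactor, jFactor, if_neg hI]
      have : (-2 * (k : ℂ)) = ((-2 * l - 1 : ℤ) : ℂ) := by rw [hl]; push_cast; ring
      rw [this, Complex.cpow_intCast]
      rfl
    rw [key, key, key, thetaFactor_mul (Gamma0_le_of_dvd hN hγ) (Gamma0_le_of_dvd hN hγ'),
      mul_zpow]

/-- Integrality of `2k` lets the power distribute over the factors of `j`, and for odd `2k` the sign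
`±1` has the same power `-2k` and `2k`. The result isolates the unimodular factor that enters the
Kloosterman sums. -/
lemma autFactor_eq {k : ℝ} {N : ℕ} (hk : IsAdmissible k N) {γ : SL(2, ℤ)} (z : ℍ) :
    autFactor k γ z = multiplier k (γ 1 0) (γ 1 1) * cocycle γ z ^ (-(k : ℂ)) := by
  rcases hk with ⟨l, hl⟩ | ⟨⟨l, hl⟩, -⟩
  · have hI : IsIntegral k := ⟨2 * l, by rw [hl]; push_cast; ring⟩
    rw [autFactor, jFactor, if_pos hI, multiplier, if_pos hI, one_mul]
    have e1 : (-2 * (k : ℂ)) = ((2 * (-2 * l) : ℤ) : ℂ) := by rw [hl]; push_cast; ring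
    have e2 : -(k : ℂ) = ((-2 * l : ℤ) : ℂ) := by rw [hl]; push_cast; ring
    rw [e1, e2, Complex.cpow_intCast, Complex.cpow_intCast, zpow_mul]
    congr 1
    norm_cast
    rw [← Complex.cpow_nat_mul]
    simp
  · have hI := not_isIntegral_half hl
    rw [autFactor, jFactor, if_neg hI, multiplier, if_neg hI]
    have e1 : (-2 * (k : ℂ)) = ((-(2 * l + 1) : ℤ) : ℂ) := by rw [hl]; push_cast; ring
    have e2 : (2 * (k : ℂ)) = ((2 * l + 1 : ℤ) : ℂ) := by rw [hl]; push_cast; ring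
    have e3 : -(k : ℂ) = ((-(2 * l + 1) : ℤ) : ℂ) * (1 / 2) := by rw [hl]; push_cast; ring
    rw [e1, e2, e3, Complex.cpow_intCast, Complex.cpow_intCast, Complex.cpow_intCast,
      Complex.cpow_int_mul, mul_zpow, mul_zpow, inv_zpow', neg_neg]
    congr 2
    rcases quadSymbol_eq (isCoprime_row γ) with h | h <;> rw [h] <;> simp
    have h1 : Odd (2 * l + 1) := ⟨l, rfl⟩
    have h2 : Odd (-1 + -(2 * l)) := ⟨-1 - l, by ring⟩
    simp [h1.neg_one_zpow, h2.neg_one_zpow]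

/-- In the half-integral case `2(2 - k) = 4 - 2k` and `ε_d⁴ = 1`, while `ε_d` is unimodular and the
symbol is a sign. This is why `ξ_k` lands in weight `2 - k` with the same type of multiplier. -/
lemma multiplier_conj {k : ℝ} {N : ℕ} (hk : IsAdmissible k N) {c d : ℤ} (h : IsCoprime c d) :
    (starRingEnd ℂ) (multiplier k c d) = multiplier (2 - k) c d := by
  rcases hk with ⟨l, hl⟩ | ⟨⟨l, hl⟩, -⟩
  · have hI : IsIntegral k := ⟨2 * l, by rw [hl]; push_cast; ring⟩
    have hI' : IsIntegral (2 - k) := ⟨2 - 2 * l, by rw [hl]; push_cast; ring⟩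
    simp [multiplier, hI, hI']
  · have hI := not_isIntegral_half hl
    have hI' := not_isIntegral_half (k := 2 - k) (l := 1 - l) (by rw [hl]; push_cast; ring)
    rw [multiplier, if_neg hI, multiplier, if_neg hI']
    have e1 : (2 * ((2 - k : ℝ) : ℂ)) = ((4 + -(2 * l + 1) : ℤ) : ℂ) := by
      rw [hl]; push_cast; ring
    have e2 : (2 * (k : ℂ)) = ((2 * l + 1 : ℤ) : ℂ) := by rw [hl]; push_cast; ring
    rw [e1, e2, Complex.cpow_intCast, Complex.cpow_intCast, Complex.cpow_intCast,
      Complex.cpow_intCast, zpow_add₀ (eps_ne_zero d) 4, map_mul, map_zpow₀, map_zpow₀]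
    have h4 : eps d ^ (4 : ℤ) = 1 := by
      unfold eps; split_ifs
      · simp
      · exact_mod_cast Complex.I_pow_four
    have hc : (starRingEnd ℂ) (eps d) = (eps d)⁻¹ := by
      unfold eps; split_ifs <;> simp
    rw [h4, hc, inv_zpow', one_mul]
    congr 1
    rcases quadSymbol_eq h with h | h <;> rw [h] <;> simp
    have h1 : Odd (2 * l + 1) := ⟨l, rfl⟩
    have h3 : Odd (4 + (-1 + -(2 * l))) := ⟨1 - l, by ring⟩
    simp [h1.neg_one_zpow, h3.neg_one_zpow]

lemma norm_multiplier {k : ℝ} {N : ℕ} (hk : IsAdmissible k N) {c d : ℤ} (h : IsCoprime c d) :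
    ‖multiplier k c d‖ = 1 := by
  rcases hk with ⟨l, hl⟩ | ⟨⟨l, hl⟩, -⟩
  · have hI : IsIntegral k := ⟨2 * l, by rw [hl]; push_cast; ring⟩
    simp [multiplier, hI]
  · have hI := not_isIntegral_half hl
    rw [multiplier, if_neg hI]
    have e2 : (2 * (k : ℂ)) = ((2 * l + 1 : ℤ) : ℂ) := by rw [hl]; push_cast; ring
    rw [e2, Complex.cpow_intCast, Complex.cpow_intCast, norm_mul, norm_zpow, norm_zpow]
    have : ‖eps d‖ = 1 := by unfold eps; split_ifs <;> simp
    rw [this]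
    rcases quadSymbol_eq h with h | h <;> rw [h] <;> simp

lemma slash_eq (k : ℝ) (f : ℍ → ℂ) (γ : SL(2, ℤ)) (z : ℍ) :
    slash k f γ z = autFactor k γ z * f (γ • z) := rfl

lemma slash_mul {k : ℝ} {N : ℕ} (hk : IsAdmissible k N) (f : ℍ → ℂ) {γ γ' : SL(2, ℤ)}
    (hγ : γ ∈ CongruenceSubgroup.Gamma0 N) (hγ' : γ' ∈ CongruenceSubgroup.Gamma0 N) (z : ℍ) :
    slash k f (γ * γ') z = autFactor k γ' z * slash k f γ (γ' • z) := by
  rw [slash_eq, slash_eq, autFactor_mul hk hγ hγ', mul_smul]; ring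

lemma autFactor_congr (k : ℝ) {γ γ' : SL(2, ℤ)} (h0 : γ 1 0 = γ' 1 0) (h1 : γ 1 1 = γ' 1 1)
    (z : ℍ) : autFactor k γ z = autFactor k γ' z := by
  simp [autFactor, jFactor, cocycle, h0, h1]

lemma autFactor_one {k : ℝ} {N : ℕ} (hk : IsAdmissible k N) (z : ℍ) : autFactor k 1 z = 1 := by
  rcases hk with ⟨l, hl⟩ | ⟨⟨l, hl⟩, -⟩
  · have hI : IsIntegral k := ⟨2 * l, by rw [hl]; push_cast; ring⟩
    rw [autFactor, jFactor, if_pos hI]; simp [cocycle]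
  · rw [autFactor, jFactor, if_neg (not_isIntegral_half hl)]
    have := thetaFactor_one z
    rw [thetaFactor] at this
    rw [this, Complex.one_cpow]

lemma autFactor_neg_one {k : ℝ} {N : ℕ} (hk : IsAdmissible k N) (z : ℍ) :
    autFactor k (-1) z = 1 := by
  rcases hk with ⟨l, hl⟩ | ⟨⟨l, hl⟩, -⟩
  · have hI : IsIntegral k := ⟨2 * l, by rw [hl]; push_cast; ring⟩
    rw [autFactor, jFactor, if_pos hI]
    have e1 : (-2 * (k : ℂ)) = ((2 * (-2 * l) : ℤ) : ℂ) := by rw [hl]; push_cast; ring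
    have e2 : cocycle (-1) z = -1 := by simp [cocycle]
    rw [e1, e2, neg_one_sqrt, Complex.cpow_intCast, zpow_mul]
    have : (Complex.I ^ (2 : ℤ)) = -1 := by exact_mod_cast Complex.I_sq
    rw [this]
    exact Even.neg_one_zpow ⟨-l, by ring⟩
  · rw [autFactor, jFactor, if_neg (not_isIntegral_half hl)]
    have := thetaFactor_neg_one z
    rw [thetaFactor] at this
    rw [this, Complex.one_cpow]

lemma autFactor_of_mem_GammaInfty {k : ℝ} {N : ℕ} (hk : IsAdmissible k N) {τ : SL(2, ℤ)}
    (hτ : τ ∈ GammaInfty) (z : ℍ) : autFactor k τ z = 1 := by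
  obtain ⟨n, rfl | rfl⟩ := hτ
  · rw [autFactor_congr k (γ' := 1) (by simp [ModularGroup.coe_T_zpow])
      (by simp [ModularGroup.coe_T_zpow]), autFactor_one hk]
  · rw [autFactor_congr k (γ' := -1) (by simp [ModularGroup.coe_T_zpow])
      (by simp [ModularGroup.coe_T_zpow]), autFactor_neg_one hk]

/-! ### Cosets -/

/-- Invariance of a function on the upper half plane under integral translations. -/
def IsPeriodic (f : ℍ → ℂ) : Prop := ∀ (n : ℤ) (z : ℍ), f (ModularGroup.T ^ n • z) = f z

lemma GammaInfty_le_Gamma0 (N : ℕ) : GammaInfty ≤ CongruenceSubgroup.Gamma0 N := fun τ hτ =>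
  mem_Gamma0_iff.mpr (by rw [mem_GammaInfty_iff.mp hτ]; exact dvd_zero _)

lemma neg_smul' (γ : SL(2, ℤ)) (z : ℍ) : (-γ) • z = γ • z := by
  ext
  rw [coe_smul, coe_smul]
  have : cocycle (-γ) z = -cocycle γ z := by simp [cocycle]; ring
  rw [this, ← neg_div_neg_eq]
  simp; ring

lemma slash_GammaInfty_mul {k : ℝ} {N : ℕ} (hk : IsAdmissible k N) {f : ℍ → ℂ}
    (hf : IsPeriodic f) {τ γ : SL(2, ℤ)} (hτ : τ ∈ GammaInfty)
    (hγ : γ ∈ CongruenceSubgroup.Gamma0 N) (z : ℍ) :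
    slash k f (τ * γ) z = slash k f γ z := by
  rw [slash_eq, slash_eq, autFactor_mul hk (GammaInfty_le_Gamma0 N hτ) hγ,
    autFactor_of_mem_GammaInfty hk hτ, one_mul, mul_smul]
  obtain ⟨n, rfl | rfl⟩ := hτ
  · rw [hf]
  · rw [neg_smul', hf]

/-- The coset of `γ`. -/
def toCoset {N : ℕ} (γ : CongruenceSubgroup.Gamma0 N) : Cosets N := Quotient.mk _ γ

lemma toCoset_eq_iff {N : ℕ} {γ γ' : CongruenceSubgroup.Gamma0 N} :
    toCoset γ = toCoset γ' ↔ γ'.1 * γ.1⁻¹ ∈ GammaInfty := by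
  rw [toCoset, toCoset, Quotient.eq]
  exact QuotientGroup.rightRel_apply

/-- The cross product of the two bottom rows is the lower left entry of `γ' γ⁻¹`, so the coset only
depends on the bottom row up to sign. -/
lemma toCoset_eq_iff_row {N : ℕ} {γ γ' : CongruenceSubgroup.Gamma0 N} :
    toCoset γ = toCoset γ' ↔
      γ'.1 1 0 * γ.1 1 1 = γ'.1 1 1 * γ.1 1 0 := by
  rw [toCoset_eq_iff, mem_GammaInfty_iff, ← sub_eq_zero (a := γ'.1 1 0 * γ.1 1 1)]
  rw [Matrix.SpecialLinearGroup.coe_mul, Matrix.SpecialLinearGroup.coe_inv,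
    Matrix.adjugate_fin_two]
  simp [Matrix.mul_apply, Fin.sum_univ_two]
  rw [← sub_eq_add_neg]

lemma slash_congr_coset {k : ℝ} {N : ℕ} (hk : IsAdmissible k N) {f : ℍ → ℂ}
    (hf : IsPeriodic f) {γ γ' : CongruenceSubgroup.Gamma0 N} (h : toCoset γ = toCoset γ') (z : ℍ) :
    slash k f γ z = slash k f γ' z := by
  have := slash_GammaInfty_mul hk hf (toCoset_eq_iff.mp h) γ.2 z
  rw [inv_mul_cancel_right] at this
  exact this.symm

open Classical in
/-- A representative of a coset whose bottom row `(c, d)` satisfies `c > 0` or `(c, d) = (0, 1)`. -/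
def rep {N : ℕ} (g : Cosets N) : CongruenceSubgroup.Gamma0 N :=
  if g.out.1 1 0 < 0 ∨ (g.out.1 1 0 = 0 ∧ g.out.1 1 1 < 0) then
    ⟨-g.out.1, mem_Gamma0_iff.mpr (by
      simpa using mem_Gamma0_iff.mp g.out.2)⟩
  else g.out

lemma toCoset_out {N : ℕ} (g : Cosets N) : toCoset g.out = g := Quotient.out_eq g

lemma toCoset_rep {N : ℕ} (g : Cosets N) : toCoset (rep g) = g := by
  refine Eq.trans ?_ (toCoset_out g)
  rw [toCoset_eq_iff_row, rep]
  split_ifs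
  · simp; ring
  · ring

lemma rep_row {N : ℕ} (g : Cosets N) :
    0 ≤ (rep g).1 1 0 ∧ ((rep g).1 1 0 = 0 → (rep g).1 1 1 = 1) := by
  have hd := sl_det g.out.1
  rw [rep]
  split_ifs with h
  · rcases h with h | ⟨h, h'⟩
    · simp; omega
    · rw [h, mul_zero, sub_zero] at hd
      rcases Int.eq_one_or_neg_one_of_mul_eq_one' hd with h2 | h2
      · omega
      · simp [h, h2.2]
  · push Not at h
    refine ⟨h.1, fun h0 => ?_⟩
    have h' := h.2 h0
    rw [h0, mul_zero, sub_zero] at hd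
    rcases Int.eq_one_or_neg_one_of_mul_eq_one' hd with h2 | h2 <;> omega

lemma slash_out {k : ℝ} {N : ℕ} (hk : IsAdmissible k N) {f : ℍ → ℂ}
    (hf : IsPeriodic f) (g : Cosets N) (z : ℍ) :
    slash k f g.out z = slash k f (rep g) z :=
  slash_congr_coset hk hf ((toCoset_out g).trans (toCoset_rep g).symm) z

lemma rep_row_mul_injective {N : ℕ} (α : SL(2, ℤ)) :
    Function.Injective fun g : Cosets N =>
      ![((rep g).1 * α) 1 0, ((rep g).1 * α) 1 1] := by
  intro g g' h
  have h0 := congrFun h 0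
  have h1 := congrFun h 1
  rw [← toCoset_rep g, ← toCoset_rep g', toCoset_eq_iff_row]
  have hd := sl_det α
  simp only [Matrix.SpecialLinearGroup.coe_mul, Matrix.mul_apply, Fin.sum_univ_two,
    Matrix.cons_val_zero, Matrix.cons_val_one] at h0 h1
  have e0 : (rep g).1 1 0 = (rep g').1 1 0 := by
    linear_combination α 1 1 * h0 - α 1 0 * h1 - ((rep g).1 1 0 - (rep g').1 1 0) * hd
  have e1 : (rep g).1 1 1 = (rep g').1 1 1 := by
    linear_combination -α 0 1 * h0 + α 0 0 * h1 - ((rep g).1 1 1 - (rep g').1 1 1) * hd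
  rw [e0, e1]; ring

/-- Right multiplication by an element of `Γ₀(N)` on the cosets. -/
def mulRightCosets {N : ℕ} (γ : CongruenceSubgroup.Gamma0 N) : Cosets N ≃ Cosets N :=
  Quotient.congr (Equiv.mulRight γ) fun a b => by
    rw [QuotientGroup.rightRel_apply, QuotientGroup.rightRel_apply]
    simp [mul_assoc]

/-- The Poincaré series of weight `k` of a periodic function. -/
def poincareSum (k : ℝ) (N : ℕ) (f : ℍ → ℂ) (z : ℍ) : ℂ :=
  ∑' g : Cosets N, slash k f (rep g) z

/-- Right multiplication by `γ` permutes the cosets. Reindexing along a bijection and extracting a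
scalar are valid for `tsum` without summability, so invariance is independent of convergence. -/
lemma isInvariant_poincareSum {k : ℝ} {N : ℕ} (hk : IsAdmissible k N) {f : ℍ → ℂ}
    (hf : IsPeriodic f) : IsInvariant k N (poincareSum k N f) := by
  intro γ hγ
  funext z
  rw [slash_eq, poincareSum, poincareSum, ← tsum_mul_left,
    ← (mulRightCosets ⟨γ, hγ⟩).tsum_eq fun g => slash k f (rep g) z]
  refine tsum_congr fun g => ?_
  rw [← slash_mul hk f (rep g).2 hγ]
  refine slash_congr_coset hk hf (γ := ⟨_, mul_mem (rep g).2 hγ⟩) ?_ z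
  rw [toCoset_rep]
  conv_rhs => rw [← toCoset_rep g]
  rfl

/-! ### Enumeration of the cosets by bottom rows -/

/-- Residue classes prime to `c`. -/
abbrev CoprimeResidues (c : ℕ) : Type := (Finset.range c).filter fun v => v.Coprime c

/-- A matrix in `SL₂(ℤ)` with bottom row `(c, v)`. -/
def rowMatrix (c : ℕ) (v : CoprimeResidues c) : SL(2, ℤ) :=
  ⟨!![(((v : ℕ) : ZMod c)⁻¹).val, ((((v : ℕ) : ZMod c)⁻¹).val * (v : ℕ) - 1) / c; c, (v : ℕ)], by
    have hv : (v : ℕ).Coprime c := (Finset.mem_filter.mp v.2).2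
    have h1 := ZMod.coe_mul_inv_eq_one _ hv
    have h : (c : ℤ) ∣ (((v : ℕ) : ZMod c)⁻¹).val * (v : ℕ) - 1 := by
      have hc : c ≠ 0 := by
        rintro rfl
        simpa using (Finset.mem_filter.mp v.2).1
      have : NeZero c := ⟨hc⟩
      rw [← ZMod.intCast_zmod_eq_zero_iff_dvd]
      push_cast
      rw [ZMod.natCast_zmod_val, mul_comm, h1, sub_self]
    rw [Matrix.det_fin_two_of, Int.ediv_mul_cancel h]; ring⟩

/-- The index set of the cosets other than that of `1`. -/
abbrev RowIndex (N : ℕ) : Type := (Σ c : ℕ+, CoprimeResidues (N * c)) × ℤ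

/-- The matrix with bottom row `(Nc, v + lNc)`. -/
def indexMatrix {N : ℕ} (i : RowIndex N) : CongruenceSubgroup.Gamma0 N :=
  ⟨rowMatrix (N * i.1.1) i.1.2 * ModularGroup.T ^ i.2, mem_Gamma0_iff.mpr (by
    rw [(mul_T_zpow _ _).1]; simp [rowMatrix])⟩

lemma indexMatrix_row {N : ℕ} (i : RowIndex N) :
    (indexMatrix i).1 1 0 = N * i.1.1 ∧
      (indexMatrix i).1 1 1 = (i.1.2 : ℕ) + i.2 * (N * i.1.1) := by
  rw [indexMatrix, (mul_T_zpow _ _).1, (mul_T_zpow _ _).2]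
  simp [rowMatrix]

/-- Cosets correspond to coprime rows `(c, d)` up to sign with `N ∣ c`. The row `(0, 1)` is `none`;
for positive lower left entry `Nc`, division with remainder `d = v + l·Nc` gives the index. -/
lemma optionIndex_bijective {N : ℕ} (hN : 0 < N) :
    Function.Bijective fun o : Option (RowIndex N) =>
      toCoset (o.elim (1 : CongruenceSubgroup.Gamma0 N) indexMatrix) := by
  have hpos : ∀ i : RowIndex N, (0 : ℤ) < N * i.1.1 := fun i =>
    mul_pos (by exact_mod_cast hN) (by exact_mod_cast i.1.1.pos)
  constructor
  · intro o o' h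
    rw [toCoset_eq_iff_row] at h
    rcases o with _ | i <;> rcases o' with _ | j
    · rfl
    · have := hpos j
      simp [indexMatrix_row] at h
      omega
    · have := hpos i
      simp [indexMatrix_row] at h
      omega
    · simp only [Option.elim_some] at h
      have hi := isCoprime_row (indexMatrix i).1
      have hj := isCoprime_row (indexMatrix j).1
      -- In `c d' = c' d` each lower left entry is coprime to its own `d`, so `c` and `c'` divide
      -- each other; both are positive.
      have hc : (indexMatrix i).1 1 0 = (indexMatrix j).1 1 0 := by
        apply Int.dvd_antisymm
        · rw [(indexMatrix_row i).1]; exact (hpos i).le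
        · rw [(indexMatrix_row j).1]; exact (hpos j).le
        · exact hi.dvd_of_dvd_mul_right ⟨(indexMatrix j).1 1 1, by rw [h]; ring⟩
        · exact hj.dvd_of_dvd_mul_left ⟨(indexMatrix i).1 1 1, by rw [← h]⟩
      have hd : (indexMatrix i).1 1 1 = (indexMatrix j).1 1 1 := by
        rw [hc] at h
        have : (indexMatrix j).1 1 0 ≠ 0 := by
          rw [(indexMatrix_row j).1]; exact (hpos j).ne'
        apply mul_left_cancel₀ this
        rw [h]; ring
      rw [(indexMatrix_row i).1, (indexMatrix_row j).1] at hc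
      rw [(indexMatrix_row i).2, (indexMatrix_row j).2] at hd
      obtain ⟨⟨c, v⟩, l⟩ := i
      obtain ⟨⟨c', v'⟩, l'⟩ := j
      have hcc : c = c' := by
        have : (N : ℤ) ≠ 0 := by exact_mod_cast hN.ne'
        have := mul_left_cancel₀ this hc
        exact_mod_cast this
      subst hcc
      have hv := Finset.mem_range.mp (Finset.mem_filter.mp v.2).1
      have hv' := Finset.mem_range.mp (Finset.mem_filter.mp v'.2).1
      have hvv : (v : ℕ) = v' := by
        have h3 := congrArg (· % ((N * c : ℕ) : ℤ)) hd
        simp only at h3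
        push_cast at h3
        rw [Int.add_mul_emod_self_right, Int.add_mul_emod_self_right] at h3
        have e1 : ((v : ℕ) : ℤ) % (N * c) = (v : ℕ) := Int.emod_eq_of_lt (by positivity) (by exact_mod_cast hv)
        have e2 : ((v' : ℕ) : ℤ) % (N * c) = (v' : ℕ) := Int.emod_eq_of_lt (by positivity) (by exact_mod_cast hv')
        rw [e1, e2] at h3
        exact_mod_cast h3
      have hvs : v = v' := Subtype.ext hvv
      subst hvs
      have hl : l = l' := by
        have := hpos ⟨⟨c, v⟩, l⟩
        simp only [add_right_inj] at hd
        exact mul_right_cancel₀ this.ne' hd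
      rw [hl]
  · intro g
    obtain ⟨h1, h2⟩ := rep_row g
    rcases h1.eq_or_lt with h0 | h0
    · refine ⟨none, ?_⟩
      conv_rhs => rw [← toCoset_rep g]
      rw [toCoset_eq_iff_row]
      simp [← h0]
    · obtain ⟨c, hc⟩ := mem_Gamma0_iff.mp (rep g).2
      have hcpos : 0 < c := by
        rw [hc] at h0
        exact (pos_iff_pos_of_mul_pos h0).mp (by exact_mod_cast hN)
      lift c to ℕ using hcpos.le
      have hcpos' : 0 < c := by exact_mod_cast hcpos
      have hNc : (0 : ℤ) < (N * c : ℕ) := by exact_mod_cast Nat.mul_pos hN hcpos'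
      set d := (rep g).1 1 1 with hd
      have hcop := isCoprime_row (rep g).1
      rw [hc, ← hd] at hcop
      have hvn : 0 ≤ d % (N * c : ℕ) := Int.emod_nonneg _ hNc.ne'
      have hvl : d % (N * c : ℕ) < (N * c : ℕ) := Int.emod_lt_of_pos _ hNc
      have hv : (d % (N * c : ℕ)).toNat ∈ (Finset.range (N * c)).filter fun v => v.Coprime (N * c) := by
        rw [Finset.mem_filter, Finset.mem_range]
        refine ⟨by omega, ?_⟩
        rw [Nat.coprime_iff_gcd_eq_one, ← Int.gcd_natCast_natCast, Int.toNat_of_nonneg hvn,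
          Int.gcd_emod, ← Int.isCoprime_iff_gcd_eq_one]
        exact_mod_cast hcop.symm
      refine ⟨some (⟨⟨⟨c, hcpos'⟩, ⟨_, hv⟩⟩, d / (N * c : ℕ)⟩ : RowIndex N), ?_⟩
      conv_rhs => rw [← toCoset_rep g]
      rw [toCoset_eq_iff_row]
      simp only [Option.elim_some, (indexMatrix_row _).1, (indexMatrix_row _).2]
      rw [hc, ← hd, Int.toNat_of_nonneg hvn]
      have := Int.emod_add_mul_ediv d (N * c : ℕ)
      push_cast at this ⊢
      simp only [PNat.mk_coe]
      linear_combination (N * c : ℤ) * this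

/-! ### Wirtinger derivatives -/

/-- The function `f` is real differentiable at `w` with `∂f/∂w = A` and `∂f/∂w̄ = B`. -/
def HasWirtingerAt (f : ℂ → ℂ) (A B w : ℂ) : Prop :=
  HasFDerivAt f (A • (1 : ℂ →L[ℝ] ℂ) + B • (Complex.conjCLE : ℂ →L[ℝ] ℂ)) w

lemma _root_.HasDerivAt.hasWirtingerAt {f : ℂ → ℂ} {A w : ℂ} (h : HasDerivAt f A w) :
    HasWirtingerAt f A 0 w := by
  have := h.complexToReal_fderiv
  unfold HasWirtingerAt
  convert this using 1
  simp

lemma HasWirtingerAt.mul {f g : ℂ → ℂ} {A B A' B' w : ℂ} (hf : HasWirtingerAt f A B w)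
    (hg : HasWirtingerAt g A' B' w) :
    HasWirtingerAt (fun z => f z * g z) (f w * A' + A * g w) (f w * B' + B * g w) w := by
  have := HasFDerivAt.mul hf hg
  unfold HasWirtingerAt
  refine this.congr_fderiv ?_
  ext
  simp
  ring

lemma HasWirtingerAt.sub {f g : ℂ → ℂ} {A B A' B' w : ℂ} (hf : HasWirtingerAt f A B w)
    (hg : HasWirtingerAt g A' B' w) :
    HasWirtingerAt (fun z => f z - g z) (A - A') (B - B') w := by
  have := HasFDerivAt.sub hf hg
  unfold HasWirtingerAt
  refine this.congr_fderiv ?_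
  ext
  simp
  ring

lemma HasWirtingerAt.conj {f : ℂ → ℂ} {A B w : ℂ} (hf : HasWirtingerAt f A B w) :
    HasWirtingerAt (fun z => (starRingEnd ℂ) (f z)) ((starRingEnd ℂ) B) ((starRingEnd ℂ) A) w := by
  have := (Complex.conjCLE : ℂ →L[ℝ] ℂ).hasFDerivAt.comp w hf
  unfold HasWirtingerAt
  refine this.congr_fderiv ?_
  ext
  simp
  ring

lemma _root_.HasDerivAt.comp_hasWirtingerAt {f g : ℂ → ℂ} {A B g' w : ℂ}
    (hg : HasDerivAt g g' (f w)) (hf : HasWirtingerAt f A B w) :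
    HasWirtingerAt (fun z => g (f z)) (g' * A) (g' * B) w := by
  have := hg.complexToReal_fderiv.comp w hf
  unfold HasWirtingerAt
  refine this.congr_fderiv ?_
  ext
  simp
  ring

lemma HasWirtingerAt.congr {f : ℂ → ℂ} {A B A' B' w : ℂ} (hf : HasWirtingerAt f A B w)
    (hA : A = A') (hB : B = B') : HasWirtingerAt f A' B' w := hA ▸ hB ▸ hf

/-! ### Exponential integrals over the unit interval -/

/-- `∫₀¹ κ(u) e^{uζ} du`. -/
def expInt (κ : ℝ → ℝ) (ζ : ℂ) : ℂ := ∫ u in (0 : ℝ)..1, (κ u : ℂ) * Complex.exp (u * ζ)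

lemma hasDerivAt_expInt {κ : ℝ → ℝ} (hκ : Continuous κ) (ζ : ℂ) :
    HasDerivAt (expInt κ) (expInt (fun u => u * κ u) ζ) ζ := by
  have hcont : ∀ z : ℂ, Continuous fun u : ℝ => (κ u : ℂ) * Complex.exp (u * z) := fun z => by
    fun_prop
  have := intervalIntegral.hasDerivAt_integral_of_dominated_loc_of_deriv_le
    (μ := MeasureTheory.volume) (a := 0) (b := 1) (x₀ := ζ) (s := Metric.ball ζ 1)
    (F := fun z u => (κ u : ℂ) * Complex.exp (u * z))
    (F' := fun z u => ((u * κ u : ℝ) : ℂ) * Complex.exp (u * z))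
    (bound := fun u => |u * κ u| * Real.exp (|u| * (‖ζ‖ + 1)))
    (Metric.ball_mem_nhds ζ one_pos)
    (Filter.Eventually.of_forall fun z => (hcont z).aestronglyMeasurable)
    ((hcont ζ).intervalIntegrable _ _)
    (by fun_prop)
    (Filter.Eventually.of_forall fun u _ z hz => by
      rw [norm_mul, Complex.norm_real, Real.norm_eq_abs]
      refine mul_le_mul_of_nonneg_left ?_ (abs_nonneg _)
      refine (Complex.norm_exp_le_exp_norm _).trans (Real.exp_le_exp.mpr ?_)
      rw [norm_mul, Complex.norm_real, Real.norm_eq_abs]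
      refine mul_le_mul_of_nonneg_left ?_ (abs_nonneg _)
      have : ‖z - ζ‖ < 1 := by simpa [dist_eq_norm] using hz
      calc ‖z‖ = ‖ζ + (z - ζ)‖ := by rw [add_sub_cancel]
        _ ≤ ‖ζ‖ + 1 := (norm_add_le _ _).trans (by linarith))
    (Continuous.intervalIntegrable (by fun_prop) _ _)
    (Filter.Eventually.of_forall fun u _ z _ => by
      have h1 : HasDerivAt (fun z : ℂ => (u : ℂ) * z) u z := by
        simpa using (hasDerivAt_id z).const_mul (u : ℂ)
      refine ((h1.cexp).const_mul (κ u : ℂ)).congr_deriv ?_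
      push_cast
      ring)
  exact this.2

/-- On `[0,1]` the real part of `a + uζ` interpolates between its values at the endpoints. For the
kernels, `a` and `a + ζ` are `2πim μ` and `2πim μ̄`, with real parts at most `2π|m| Im μ`. -/
lemma norm_exp_mul_expInt_le {κ : ℝ → ℝ} (hκ : Continuous κ) :
    ∃ C : ℝ, 0 ≤ C ∧ ∀ a ζ : ℂ, ∀ M : ℝ, a.re ≤ M → (a + ζ).re ≤ M →
      ‖Complex.exp a * expInt κ ζ‖ ≤ C * Real.exp M := by
  obtain ⟨C, hC⟩ := (isCompact_Icc (a := (0 : ℝ)) (b := 1)).exists_bound_of_continuousOn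
    hκ.continuousOn
  refine ⟨C, (norm_nonneg _).trans (hC 0 (by simp)), fun a ζ M h1 h2 => ?_⟩
  rw [expInt, ← intervalIntegral.integral_const_mul]
  have := intervalIntegral.norm_integral_le_of_norm_le_const (a := 0) (b := 1)
    (C := C * Real.exp M)
    (f := fun u : ℝ => Complex.exp a * ((κ u : ℂ) * Complex.exp (u * ζ))) fun u hu => by
      rw [Set.uIoc_of_le zero_le_one] at hu
      rw [mul_left_comm, ← Complex.exp_add, norm_mul, Complex.norm_real, Complex.norm_exp]
      refine mul_le_mul (hC u ⟨hu.1.le, hu.2⟩) (Real.exp_le_exp.mpr ?_) (Real.exp_pos _).le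
        ((norm_nonneg _).trans (hC 0 (by simp)))
      simp only [Complex.add_re, Complex.re_ofReal_mul] at h2 ⊢
      nlinarith [hu.1, hu.2]
  simpa using this

/-! ### Möbius transformations -/

/-- `cw + d`. -/
def den (γ : SL(2, ℤ)) (w : ℂ) : ℂ := (γ 1 0 : ℂ) * w + (γ 1 1 : ℂ)

/-- `(aw + b) / (cw + d)`. -/
def mob (γ : SL(2, ℤ)) (w : ℂ) : ℂ := ((γ 0 0 : ℂ) * w + (γ 0 1 : ℂ)) / den γ w

lemma den_coe (γ : SL(2, ℤ)) (z : ℍ) : den γ z = cocycle γ z := rfl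

lemma mob_coe (γ : SL(2, ℤ)) (z : ℍ) : mob γ z = (γ • z : ℍ) := by rw [coe_smul]; rfl

lemma den_ne_zero (γ : SL(2, ℤ)) {w : ℂ} (hw : 0 < w.im) : den γ w ≠ 0 :=
  cocycle_ne_zero γ ⟨w, hw⟩

lemma mob_im (γ : SL(2, ℤ)) {w : ℂ} (hw : 0 < w.im) :
    (mob γ w).im = w.im / ‖den γ w‖ ^ 2 := by
  have := im_smul γ ⟨w, hw⟩
  rw [← UpperHalfPlane.coe_im, ← mob_coe] at this
  exact this

lemma hasDerivAt_den (γ : SL(2, ℤ)) (w : ℂ) : HasDerivAt (den γ) (γ 1 0) w := by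
  change HasDerivAt (fun w : ℂ => (γ 1 0 : ℂ) * w + γ 1 1) _ _
  simpa using ((hasDerivAt_id w).const_mul (γ 1 0 : ℂ)).add_const (γ 1 1 : ℂ)

lemma hasDerivAt_mob (γ : SL(2, ℤ)) {w : ℂ} (hw : 0 < w.im) :
    HasDerivAt (mob γ) ((den γ w ^ 2)⁻¹) w := by
  have h0 := den_ne_zero γ hw
  have h1 : HasDerivAt (fun w : ℂ => (γ 0 0 : ℂ) * w + γ 0 1) (γ 0 0) w := by
    simpa using ((hasDerivAt_id w).const_mul (γ 0 0 : ℂ)).add_const (γ 0 1 : ℂ)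
  refine (h1.div (hasDerivAt_den γ w) h0).congr_deriv ?_
  have hd : (γ 0 0 : ℂ) * γ 1 1 - γ 0 1 * γ 1 0 = 1 := by exact_mod_cast sl_det γ
  field_simp
  rw [den]
  linear_combination hd

/-- The bottom row is normalised: `c > 0`, or `(c, d) = (0, 1)`. -/
def IsNormalized (γ : SL(2, ℤ)) : Prop := 0 ≤ γ 1 0 ∧ (γ 1 0 = 0 → γ 1 1 = 1)

lemma IsNormalized.den_mem_slitPlane {γ : SL(2, ℤ)} (h : IsNormalized γ) {w : ℂ}
    (hw : 0 < w.im) : den γ w ∈ Complex.slitPlane := by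
  rcases h.1.eq_or_lt with h0 | h0
  · rw [den, ← h0, h.2 h0.symm]; simp
  · refine Or.inr ?_
    have : (den γ w).im = γ 1 0 * w.im := by simp [den]
    rw [this]
    have : (0 : ℝ) < γ 1 0 := by exact_mod_cast h0
    positivity

lemma conj_mem_slitPlane {w : ℂ} (h : w ∈ Complex.slitPlane) :
    (starRingEnd ℂ) w ∈ Complex.slitPlane := by
  rcases h with h | h
  · exact Or.inl (by simpa using h)
  · exact Or.inr (by simpa using h)

lemma abs_row_mul_im_le (γ : SL(2, ℤ)) (w : ℂ) : |(γ 1 0 : ℝ) * w.im| ≤ ‖den γ w‖ := by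
  have : (den γ w).im = γ 1 0 * w.im := by simp [den]
  rw [← this]; exact Complex.abs_im_le_norm _

/-- The bottom row of `γ`. -/
def row (γ : SL(2, ℤ)) : Fin 2 → ℤ := ![γ 1 0, γ 1 1]

lemma one_le_norm_row (γ : SL(2, ℤ)) : 1 ≤ ‖row γ‖ := by
  rw [EisensteinSeries.norm_eq_max_natAbs]
  have : γ 1 0 ≠ 0 ∨ γ 1 1 ≠ 0 := by
    by_contra! h
    have := sl_det γ
    rw [h.1, h.2] at this; simp at this
  have : 1 ≤ max (row γ 0).natAbs (row γ 1).natAbs := by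
    simp only [row, Matrix.cons_val_zero, Matrix.cons_val_one]
    rcases this with h | h
    · exact le_max_of_le_left (Int.natAbs_pos.mpr h)
    · exact le_max_of_le_right (Int.natAbs_pos.mpr h)
  exact_mod_cast this

/-- The rectangle `|x| < A`, `B < y < Y`. -/
def box (A B Y : ℝ) : Set ℂ := {w | |w.re| < A ∧ B < w.im ∧ w.im < Y}

lemma isOpen_box (A B Y : ℝ) : IsOpen (box A B Y) :=
  (isOpen_lt (continuous_abs.comp Complex.continuous_re) continuous_const).inter
    ((isOpen_lt continuous_const Complex.continuous_im).inter
      (isOpen_lt Complex.continuous_im continuous_const))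

lemma convex_box (A B Y : ℝ) : Convex ℝ (box A B Y) := by
  have h1 : Convex ℝ {w : ℂ | |w.re| < A} := by
    have : {w : ℂ | |w.re| < A} = {w : ℂ | w.re < A} ∩ {w : ℂ | -A < w.re} := by
      ext w; simp [abs_lt, and_comm]
    rw [this]
    exact (convex_halfSpace_re_lt A).inter (convex_halfSpace_re_gt _)
  exact h1.inter ((convex_halfSpace_im_gt B).inter (convex_halfSpace_im_lt Y))

lemma mem_box_of_im_pos {w : ℂ} (hw : 0 < w.im) :
    w ∈ box (|w.re| + 1) (w.im / 2) (w.im + 1) := ⟨by linarith, by linarith, by linarith⟩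

lemma norm_den_rpow_le {A B a : ℝ} (hB : 0 < B) (ha : 0 ≤ a) :
    ∃ C : ℝ, 0 ≤ C ∧ ∀ (γ : SL(2, ℤ)) (w : ℂ), |w.re| ≤ A → B ≤ w.im →
      ‖den γ w‖ ^ (-a) ≤ C * ‖row γ‖ ^ (-a) := by
  refine ⟨_, Real.rpow_nonneg (EisensteinSeries.r_pos ⟨⟨A, B⟩, hB⟩).le (-a),
    fun γ w h1 h2 => ?_⟩
  have := EisensteinSeries.summand_bound_of_mem_verticalStrip (z := ⟨w, hB.trans_le h2⟩)
    ha (row γ) hB ⟨h1, h2⟩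
  simpa [row, den] using this

/-- A locally uniform bound for Poincaré type summands. -/
lemma exists_summand_bound {A B Y a M : ℝ} (hB : 0 < B) (ha : 0 ≤ a) (hM : 0 ≤ M) :
    ∃ C : ℝ, 0 ≤ C ∧ ∀ (γ : SL(2, ℤ)) (w : ℂ), w ∈ box A B Y →
      ‖den γ w‖ ^ (-a) * Real.exp (M * (mob γ w).im) ≤ C * ‖row γ‖ ^ (-a) := by
  obtain ⟨C, hC, h⟩ := norm_den_rpow_le (A := A) hB ha
  obtain ⟨D, hD, h'⟩ := norm_den_rpow_le (A := A) (a := 2) hB zero_le_two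
  refine ⟨C * Real.exp (M * (|Y| * D)), by positivity, fun γ w ⟨h1, h2, h3⟩ => ?_⟩
  have e1 := h γ w h1.le h2.le
  have e2 := h' γ w h1.le h2.le
  have hw : 0 < w.im := hB.trans h2
  have e3 : ‖row γ‖ ^ (-2 : ℝ) ≤ 1 := Real.rpow_le_one_of_one_le_of_nonpos (one_le_norm_row γ)
    (by norm_num)
  -- `Im γw = Im w / |cw+d|²`, and `|cw+d|` is bounded below uniformly in `γ` on the box. The
  -- exponential thus costs only a constant.
  have e4 : (mob γ w).im ≤ |Y| * D := by
    rw [mob_im γ hw, div_eq_mul_inv]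
    have : (‖den γ w‖ ^ 2)⁻¹ ≤ D := by
      rw [← Real.rpow_natCast, ← Real.rpow_neg (norm_nonneg _)]
      exact e2.trans (mul_le_of_le_one_right hD e3)
    have h5 : w.im ≤ |Y| := h3.le.trans (le_abs_self Y)
    gcongr
  calc _ ≤ C * ‖row γ‖ ^ (-a) * Real.exp (M * (|Y| * D)) := by gcongr
    _ = _ := by ring

lemma summable_norm_row {ι : Type*} {γ : ι → SL(2, ℤ)}
    (hinj : Function.Injective fun i => row (γ i)) {a : ℝ} (ha : 2 < a) :
    Summable fun i => ‖row (γ i)‖ ^ (-a) :=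
  (EisensteinSeries.summable_one_div_norm_rpow ha).comp_injective hinj

/-! ### A class of series closed under differentiation -/

/-- The function
`(cw+d)^{-p} (cw̄+d)^{-q} c^r ∫₀¹ κ(u) e(m((1-u) γw + u γw̄)) du` of `w`. -/
def kernelTerm (m : ℤ) (γ : SL(2, ℤ)) (r p : ℕ) (q : ℝ) (κ : ℝ → ℝ) (w : ℂ) : ℂ :=
  (γ 1 0 : ℂ) ^ r * (den γ w ^ p)⁻¹ * (starRingEnd ℂ) (den γ w) ^ (-(q : ℂ)) *
    (Complex.exp (2 * Real.pi * Complex.I * m * mob γ w) *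
      expInt κ (2 * Real.pi * Complex.I * m * ((starRingEnd ℂ) (mob γ w) - mob γ w)))

/-- The holomorphic derivative of `kernelTerm`. -/
def kernelTermDz (m : ℤ) (γ : SL(2, ℤ)) (r p : ℕ) (q : ℝ) (κ : ℝ → ℝ) (w : ℂ) : ℂ :=
  -p * kernelTerm m γ (r + 1) (p + 1) q κ w +
    2 * Real.pi * Complex.I * m * (kernelTerm m γ r (p + 2) q κ w -
      kernelTerm m γ r (p + 2) q (fun u => u * κ u) w)

/-- The antiholomorphic derivative of `kernelTerm`. -/
def kernelTermDzbar (m : ℤ) (γ : SL(2, ℤ)) (r p : ℕ) (q : ℝ) (κ : ℝ → ℝ) (w : ℂ) : ℂ :=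
  -q * kernelTerm m γ (r + 1) p (q + 1) κ w +
    2 * Real.pi * Complex.I * m * kernelTerm m γ r p (q + 2) (fun u => u * κ u) w

/-- In the exponent `(1-u) γw + u γw̄`, the holomorphic derivative brings down `(1-u)(cw+d)^{-2}`
and the antiholomorphic one `u (cw̄+d)^{-2}`; differentiating the denominators brings down a factor
`c`, which `r` counts. Normalisation keeps the real power of `cw̄+d` off the branch cut. -/
lemma hasWirtingerAt_kernelTerm (m : ℤ) {γ : SL(2, ℤ)} (hγ : IsNormalized γ) (r p : ℕ) (q : ℝ)
    {κ : ℝ → ℝ} (hκ : Continuous κ) {w : ℂ} (hw : 0 < w.im) :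
    HasWirtingerAt (kernelTerm m γ r p q κ) (kernelTermDz m γ r p q κ w)
      (kernelTermDzbar m γ r p q κ w) w := by
  have h0 := den_ne_zero γ hw
  have hs := conj_mem_slitPlane (hγ.den_mem_slitPlane hw)
  have h0' : (starRingEnd ℂ) (den γ w) ≠ 0 := by simpa using h0
  have hd := (hasDerivAt_den γ w).hasWirtingerAt
  have hμ := (hasDerivAt_mob γ hw).hasWirtingerAt
  have h1 : HasWirtingerAt (fun w => (den γ w ^ p)⁻¹) (-p * γ 1 0 * (den γ w ^ (p + 1))⁻¹) 0 w := by
    refine HasDerivAt.hasWirtingerAt ?_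
    have := ((hasDerivAt_den γ w).fun_pow p).fun_inv (pow_ne_zero p h0)
    refine this.congr_deriv ?_
    rcases p with _ | p
    · simp
    · simp only [Nat.add_sub_cancel]
      field_simp
      ring
  have h2 : HasWirtingerAt (fun w => (starRingEnd ℂ) (den γ w) ^ (-(q : ℂ))) 0
      (-q * γ 1 0 * (starRingEnd ℂ) (den γ w) ^ (-((q + 1 : ℝ) : ℂ))) w := by
    have h3 := (hasDerivAt_id ((starRingEnd ℂ) (den γ w))).cpow_const (c := -(q : ℂ)) hs
    have := HasDerivAt.comp_hasWirtingerAt (g := fun ζ => ζ ^ (-(q : ℂ)))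
      (f := fun z => (starRingEnd ℂ) (den γ z)) h3 hd.conj
    refine this.congr (by simp) ?_
    simp only [id, mul_one, Complex.ofReal_add, Complex.ofReal_one, neg_add, map_intCast]
    rw [sub_eq_add_neg]; ring
  have h3 : HasWirtingerAt (fun w => Complex.exp (2 * Real.pi * Complex.I * m * mob γ w))
      (2 * Real.pi * Complex.I * m * (den γ w ^ 2)⁻¹ *
        Complex.exp (2 * Real.pi * Complex.I * m * mob γ w)) 0 w := by
    refine HasDerivAt.hasWirtingerAt ?_
    refine ((hasDerivAt_mob γ hw).const_mul (2 * Real.pi * Complex.I * m)).cexp.congr_deriv ?_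
    ring
  have h4 : HasWirtingerAt (fun w => expInt κ
      (2 * Real.pi * Complex.I * m * ((starRingEnd ℂ) (mob γ w) - mob γ w)))
      (-(2 * Real.pi * Complex.I * m * (den γ w ^ 2)⁻¹) * expInt (fun u => u * κ u)
        (2 * Real.pi * Complex.I * m * ((starRingEnd ℂ) (mob γ w) - mob γ w)))
      (2 * Real.pi * Complex.I * m * ((starRingEnd ℂ) (den γ w) ^ 2)⁻¹ *
        expInt (fun u => u * κ u)
        (2 * Real.pi * Complex.I * m * ((starRingEnd ℂ) (mob γ w) - mob γ w))) w := by
    have h5 : HasDerivAt (fun ζ => expInt κ (2 * Real.pi * Complex.I * m * ζ)) _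
        ((starRingEnd ℂ) (mob γ w) - mob γ w) :=
      (hasDerivAt_expInt hκ _).comp _ ((hasDerivAt_id _).const_mul (2 * Real.pi * Complex.I * m))
    refine (HasDerivAt.comp_hasWirtingerAt
      (f := fun z => (starRingEnd ℂ) (mob γ z) - mob γ z) h5 (hμ.conj.sub hμ)).congr ?_ ?_
    · simp; ring
    · simp; ring
  have hc : HasWirtingerAt (fun _ => (γ 1 0 : ℂ) ^ r) 0 0 w :=
    (hasDerivAt_const w ((γ 1 0 : ℂ) ^ r)).hasWirtingerAt
  refine (((hc.mul h1).mul h2).mul (h3.mul h4)).congr ?_ ?_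
  · simp only [kernelTermDz, kernelTerm]
    have e2 : (den γ w ^ (p + 2))⁻¹ = (den γ w ^ p)⁻¹ * (den γ w ^ 2)⁻¹ := by
      rw [pow_add, mul_inv]
    rw [e2]
    ring
  · simp only [kernelTermDzbar, kernelTerm]
    have e2 : (starRingEnd ℂ) (den γ w) ^ (-((q + 2 : ℝ) : ℂ)) =
        (starRingEnd ℂ) (den γ w) ^ (-(q : ℂ)) * ((starRingEnd ℂ) (den γ w) ^ 2)⁻¹ := by
      have : -((q + 2 : ℝ) : ℂ) = -(q : ℂ) - 2 := by push_cast; ring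
      rw [this, Complex.cpow_sub _ _ h0', div_eq_mul_inv]
      congr 2
      exact_mod_cast Complex.cpow_natCast _ 2
    rw [e2]
    ring

/-- Since `|c| Im w ≤ |cw+d|`, every factor `c` costs one power of the denominator, so `p + q - r`
is the effective exponent. None of the terms produced by differentiation has a smaller one. -/
lemma exists_kernelTerm_bound (m : ℤ) (r p : ℕ) (q : ℝ) {κ : ℝ → ℝ} (hκ : Continuous κ)
    (hpq : 2 < p + q - r) {A B Y : ℝ} (hB : 0 < B) :
    ∃ C : ℝ, 0 ≤ C ∧ ∀ (γ : SL(2, ℤ)) (w : ℂ), w ∈ box A B Y →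
      ‖kernelTerm m γ r p q κ w‖ ≤ C * ‖row γ‖ ^ (-(p + q - r)) := by
  obtain ⟨C, hC, h⟩ := exists_summand_bound (A := A) (B := B) (Y := Y) (a := p + q - r)
    (M := 2 * Real.pi * |(m : ℝ)|) hB (by linarith) (by positivity)
  obtain ⟨D, hD, h'⟩ := norm_exp_mul_expInt_le hκ
  refine ⟨D * (B⁻¹) ^ r * C, by positivity, fun γ w hw => ?_⟩
  have hw0 : 0 < w.im := hB.trans hw.2.1
  have h0 := den_ne_zero γ hw0
  have hn : 0 < ‖den γ w‖ := norm_pos_iff.mpr h0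
  have hμ : 0 ≤ (mob γ w).im := by rw [mob_im γ hw0]; positivity
  have e1 : ‖(γ 1 0 : ℂ) ^ r‖ ≤ (B⁻¹) ^ r * ‖den γ w‖ ^ r := by
    rw [norm_pow, ← mul_pow]
    refine pow_le_pow_left₀ (norm_nonneg _) ?_ r
    have := abs_row_mul_im_le γ w
    rw [abs_mul, abs_of_pos hw0] at this
    have h3 : ‖(γ 1 0 : ℂ)‖ = |(γ 1 0 : ℝ)| := by
      exact Complex.norm_intCast _
    rw [h3, inv_mul_eq_div, le_div_iff₀ hB]
    exact (mul_le_mul_of_nonneg_left hw.2.1.le (abs_nonneg _)).trans this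
  have e2 : ‖(starRingEnd ℂ) (den γ w) ^ (-(q : ℂ))‖ = ‖den γ w‖ ^ (-q) := by
    have : (-(q : ℂ)) = ((-q : ℝ) : ℂ) := by push_cast; rfl
    rw [this, Complex.norm_cpow_real, Complex.norm_conj]
  have hm : -(m * (mob γ w).im) ≤ |(m : ℝ)| * (mob γ w).im ∧
      m * (mob γ w).im ≤ |(m : ℝ)| * (mob γ w).im := by
    constructor
    · rw [← neg_mul]; exact mul_le_mul_of_nonneg_right (neg_le_abs _) hμ
    · exact mul_le_mul_of_nonneg_right (le_abs_self _) hμ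
  have hpi := Real.pi_pos
  have e3 := h' (2 * Real.pi * Complex.I * m * mob γ w)
    (2 * Real.pi * Complex.I * m * ((starRingEnd ℂ) (mob γ w) - mob γ w))
    (2 * Real.pi * |(m : ℝ)| * (mob γ w).im)
    (by
      have : (2 * Real.pi * Complex.I * m * mob γ w).re = 2 * Real.pi * -(m * (mob γ w).im) := by
        simp; ring
      rw [this, mul_assoc (2 * Real.pi)]
      exact mul_le_mul_of_nonneg_left hm.1 (by positivity))
    (by
      have : (2 * Real.pi * Complex.I * m * mob γ w +
          2 * Real.pi * Complex.I * m * ((starRingEnd ℂ) (mob γ w) - mob γ w)).re =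
          2 * Real.pi * (m * (mob γ w).im) := by
        simp; ring
      rw [this, mul_assoc (2 * Real.pi)]
      exact mul_le_mul_of_nonneg_left hm.2 (by positivity))
  rw [kernelTerm, norm_mul, norm_mul, norm_mul, e2, norm_inv, norm_pow (den γ w)]
  have e4 : ‖den γ w‖ ^ r * (‖den γ w‖ ^ p)⁻¹ * ‖den γ w‖ ^ (-q) =
      ‖den γ w‖ ^ (-(p + q - r : ℝ)) := by
    rw [← Real.rpow_natCast, ← Real.rpow_natCast, ← Real.rpow_neg hn.le, ← Real.rpow_add hn,
      ← Real.rpow_add hn]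
    congr 1; ring
  calc _ ≤ (B⁻¹) ^ r * ‖den γ w‖ ^ r * (‖den γ w‖ ^ p)⁻¹ * ‖den γ w‖ ^ (-q) *
        (D * Real.exp (2 * Real.pi * |(m : ℝ)| * (mob γ w).im)) := by gcongr
    _ = D * (B⁻¹) ^ r * ((‖den γ w‖ ^ r * (‖den γ w‖ ^ p)⁻¹ * ‖den γ w‖ ^ (-q)) *
        Real.exp (2 * Real.pi * |(m : ℝ)| * (mob γ w).im)) := by ring
    _ ≤ D * (B⁻¹) ^ r * (C * ‖row γ‖ ^ (-(p + q - r : ℝ))) := by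
        rw [e4]; exact mul_le_mul_of_nonneg_left (h γ w hw) (by positivity)
    _ = _ := by ring

section Family

variable {ι : Type*} (m : ℤ) (γ : ι → SL(2, ℤ)) (χ : ι → ℂ)

/-- The series of the functions `kernelTerm`, with coefficients `χ`. -/
def kernelSum (r p : ℕ) (q : ℝ) (κ : ℝ → ℝ) (w : ℂ) : ℂ :=
  ∑' i, χ i * kernelTerm m (γ i) r p q κ w

variable {m γ χ}

lemma summable_kernelTerm (hinj : Function.Injective fun i => row (γ i)) (hχ : ∀ i, ‖χ i‖ ≤ 1)
    {r p : ℕ} {q : ℝ} {κ : ℝ → ℝ} (hκ : Continuous κ) (hpq : 2 < p + q - r) {w : ℂ}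
    (hw : 0 < w.im) : Summable fun i => χ i * kernelTerm m (γ i) r p q κ w := by
  obtain ⟨C, hC, h⟩ := exists_kernelTerm_bound m r p q hκ hpq (A := |w.re| + 1) (B := w.im / 2)
    (Y := w.im + 1) (by linarith)
  refine Summable.of_norm_bounded ((summable_norm_row hinj hpq).mul_left C) fun i => ?_
  rw [norm_mul]
  exact (mul_le_of_le_one_left (norm_nonneg _) (hχ i)).trans (h _ _ (mem_box_of_im_pos hw))

/-- Termwise differentiation on a convex box around `w`, where the four types of derivative terms
have summable majorants of the form `‖(c,d)‖^{-a}`. -/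
lemma hasWirtingerAt_kernelSum (hinj : Function.Injective fun i => row (γ i))
    (hγ : ∀ i, IsNormalized (γ i)) (hχ : ∀ i, ‖χ i‖ ≤ 1)
    {r p : ℕ} {q : ℝ} {κ : ℝ → ℝ} (hκ : Continuous κ) (hpq : 2 < p + q - r) {w : ℂ}
    (hw : 0 < w.im) :
    HasWirtingerAt (kernelSum m γ χ r p q κ)
      (-p * kernelSum m γ χ (r + 1) (p + 1) q κ w +
        2 * Real.pi * Complex.I * m * (kernelSum m γ χ r (p + 2) q κ w -
          kernelSum m γ χ r (p + 2) q (fun u => u * κ u) w))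
      (-q * kernelSum m γ χ (r + 1) p (q + 1) κ w +
        2 * Real.pi * Complex.I * m * kernelSum m γ χ r p (q + 2) (fun u => u * κ u) w) w := by
  have hκ' : Continuous fun u => u * κ u := by fun_prop
  have hpq1 : 2 < ((p + 1 : ℕ) : ℝ) + q - (r + 1 : ℕ) := by push_cast; linarith
  have hpq2 : 2 < ((p + 2 : ℕ) : ℝ) + q - r := by push_cast; linarith
  have hpq3 : 2 < (p : ℝ) + (q + 1) - (r + 1 : ℕ) := by push_cast; linarith
  have hpq4 : 2 < (p : ℝ) + (q + 2) - r := by linarith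
  have hsA : HasSum (fun i => χ i * kernelTermDz m (γ i) r p q κ w)
      (-p * kernelSum m γ χ (r + 1) (p + 1) q κ w +
        2 * Real.pi * Complex.I * m * (kernelSum m γ χ r (p + 2) q κ w -
          kernelSum m γ χ r (p + 2) q (fun u => u * κ u) w)) := by
    have h1 := (summable_kernelTerm (m := m) hinj hχ hκ hpq1 hw).hasSum
    have h2 := (summable_kernelTerm (m := m) hinj hχ hκ hpq2 hw).hasSum
    have h3 := (summable_kernelTerm (m := m) hinj hχ hκ' hpq2 hw).hasSum
    refine ((h1.mul_left (-(p : ℂ))).add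
      ((h2.sub h3).mul_left (2 * Real.pi * Complex.I * m))).congr_fun fun i => ?_
    simp only [kernelTermDz]; ring
  have hsB : HasSum (fun i => χ i * kernelTermDzbar m (γ i) r p q κ w)
      (-q * kernelSum m γ χ (r + 1) p (q + 1) κ w +
        2 * Real.pi * Complex.I * m * kernelSum m γ χ r p (q + 2) (fun u => u * κ u) w) := by
    have h1 := (summable_kernelTerm (m := m) hinj hχ hκ hpq3 hw).hasSum
    have h2 := (summable_kernelTerm (m := m) hinj hχ hκ' hpq4 hw).hasSum
    refine ((h1.mul_left (-(q : ℂ))).add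
      (h2.mul_left (2 * Real.pi * Complex.I * m))).congr_fun fun i => ?_
    simp only [kernelTermDzbar]; ring
  have hB : 0 < w.im / 2 := by linarith
  obtain ⟨C1, hC1, b1⟩ := exists_kernelTerm_bound m (r + 1) (p + 1) q hκ hpq1
    (A := |w.re| + 1) (Y := w.im + 1) hB
  obtain ⟨C2, hC2, b2⟩ := exists_kernelTerm_bound m r (p + 2) q hκ hpq2
    (A := |w.re| + 1) (Y := w.im + 1) hB
  obtain ⟨C3, hC3, b3⟩ := exists_kernelTerm_bound m r (p + 2) q hκ' hpq2
    (A := |w.re| + 1) (Y := w.im + 1) hB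
  obtain ⟨C4, hC4, b4⟩ := exists_kernelTerm_bound m (r + 1) p (q + 1) hκ hpq3
    (A := |w.re| + 1) (Y := w.im + 1) hB
  obtain ⟨C5, hC5, b5⟩ := exists_kernelTerm_bound m r p (q + 2) hκ' hpq4
    (A := |w.re| + 1) (Y := w.im + 1) hB
  set u : ι → ℝ := fun i =>
    ‖(p : ℂ)‖ * (C1 * ‖row (γ i)‖ ^ (-(((p + 1 : ℕ) : ℝ) + q - (r + 1 : ℕ)))) +
      ‖(2 * Real.pi * Complex.I * m : ℂ)‖ * (C2 * ‖row (γ i)‖ ^ (-(((p + 2 : ℕ) : ℝ) + q - r)) +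
        C3 * ‖row (γ i)‖ ^ (-(((p + 2 : ℕ) : ℝ) + q - r))) +
    (‖(q : ℂ)‖ * (C4 * ‖row (γ i)‖ ^ (-((p : ℝ) + (q + 1) - (r + 1 : ℕ)))) +
      ‖(2 * Real.pi * Complex.I * m : ℂ)‖ * (C5 * ‖row (γ i)‖ ^ (-((p : ℝ) + (q + 2) - r)))) with hu
  have hus : Summable u := by
    refine Summable.add (Summable.add ?_ ?_) (Summable.add ?_ ?_)
    · exact ((summable_norm_row hinj hpq1).mul_left _).mul_left _
    · exact (((summable_norm_row hinj hpq2).mul_left _).add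
        ((summable_norm_row hinj hpq2).mul_left _)).mul_left _
    · exact ((summable_norm_row hinj hpq3).mul_left _).mul_left _
    · exact ((summable_norm_row hinj hpq4).mul_left _).mul_left _
  have key := hasFDerivAt_tsum_of_isPreconnected (𝕜 := ℝ) (u := u)
    (f := fun i z => χ i * kernelTerm m (γ i) r p q κ z)
    (f' := fun i z => (χ i * kernelTermDz m (γ i) r p q κ z) • (1 : ℂ →L[ℝ] ℂ) +
      (χ i * kernelTermDzbar m (γ i) r p q κ z) • (Complex.conjCLE : ℂ →L[ℝ] ℂ))
    (s := box (|w.re| + 1) (w.im / 2) (w.im + 1)) (x₀ := w) (x := w) hus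
    (isOpen_box _ _ _) (convex_box _ _ _).isPreconnected
    (fun i z hz => by
      have hz0 : 0 < z.im := hB.trans hz.2.1
      have h1 := (hasDerivAt_const z (χ i)).hasWirtingerAt.mul
        (hasWirtingerAt_kernelTerm m (hγ i) r p q hκ hz0)
      exact h1.congr (by simp) (by simp))
    (fun i z hz => by
      refine (norm_add_le _ _).trans (add_le_add ?_ ?_)
      · rw [norm_smul, norm_mul, norm_one, mul_one]
        refine (mul_le_of_le_one_left (norm_nonneg _) (hχ i)).trans ?_
        refine (norm_add_le _ _).trans (add_le_add ?_ ?_)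
        · rw [norm_mul, norm_neg]
          exact mul_le_mul_of_nonneg_left (b1 _ _ hz) (norm_nonneg _)
        · rw [norm_mul]
          exact mul_le_mul_of_nonneg_left ((norm_sub_le _ _).trans
            (add_le_add (b2 _ _ hz) (b3 _ _ hz))) (norm_nonneg _)
      · rw [norm_smul, norm_mul, Complex.conjCLE_norm, mul_one]
        refine (mul_le_of_le_one_left (norm_nonneg _) (hχ i)).trans ?_
        refine (norm_add_le _ _).trans (add_le_add ?_ ?_)
        · rw [norm_mul, norm_neg]
          exact mul_le_mul_of_nonneg_left (b4 _ _ hz) (norm_nonneg _)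
        · rw [norm_mul]
          exact mul_le_mul_of_nonneg_left (b5 _ _ hz) (norm_nonneg _))
    (mem_box_of_im_pos hw) (summable_kernelTerm hinj hχ hκ hpq hw) (mem_box_of_im_pos hw)
  unfold HasWirtingerAt
  refine HasFDerivAt.congr_fderiv key ?_
  exact ((hsA.smul_const (1 : ℂ →L[ℝ] ℂ)).add
    (hsB.smul_const (Complex.conjCLE : ℂ →L[ℝ] ℂ))).tsum_eq

/-- The upper half plane as a subset of `ℂ`. -/
abbrev upperHalf : Set ℂ := {w : ℂ | 0 < w.im}

lemma isOpen_upperHalf : IsOpen upperHalf := isOpen_lt continuous_const Complex.continuous_im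

/-- The derivative is a combination of series of the same class satisfying the same exponent
condition. Hence the induction runs over all `r`, `p`, `q`, `κ` at once. -/
lemma contDiffOn_kernelSum (hinj : Function.Injective fun i => row (γ i))
    (hγ : ∀ i, IsNormalized (γ i)) (hχ : ∀ i, ‖χ i‖ ≤ 1) (n : ℕ)
    {r p : ℕ} {q : ℝ} {κ : ℝ → ℝ} (hκ : Continuous κ) (hpq : 2 < p + q - r) :
    ContDiffOn ℝ n (kernelSum m γ χ r p q κ) upperHalf := by
  have hdiff : ∀ {r p : ℕ} {q : ℝ} {κ : ℝ → ℝ}, Continuous κ → 2 < p + q - r →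
      DifferentiableOn ℝ (kernelSum m γ χ r p q κ) upperHalf := fun hκ hpq w hw =>
    HasFDerivAt.differentiableAt (hasWirtingerAt_kernelSum hinj hγ hχ hκ hpq hw)
      |>.differentiableWithinAt
  induction n generalizing r p q κ with
  | zero =>
    rw [Nat.cast_zero, contDiffOn_zero]
    exact (hdiff hκ hpq).continuousOn
  | succ n ih =>
    have hκ' : Continuous fun u => u * κ u := by fun_prop
    rw [Nat.cast_succ, contDiffOn_succ_iff_fderiv_of_isOpen isOpen_upperHalf]
    refine ⟨hdiff hκ hpq, by simp, ?_⟩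
    refine ContDiffOn.congr ?_ fun w hw =>
      HasFDerivAt.fderiv (hasWirtingerAt_kernelSum hinj hγ hχ hκ hpq hw)
    refine ContDiffOn.add (ContDiffOn.fun_smul ?_ contDiffOn_const)
      (ContDiffOn.fun_smul ?_ contDiffOn_const)
    · refine (contDiffOn_const.mul (ih hκ (by push_cast; linarith))).add
        (contDiffOn_const.mul ((ih hκ (by push_cast; linarith)).sub
          (ih hκ' (by push_cast; linarith))))
    · exact (contDiffOn_const.mul (ih hκ (by push_cast; linarith))).add
        (contDiffOn_const.mul (ih hκ' (by linarith)))

end Family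

/-! ### Whittaker and incomplete gamma functions as exponential integrals -/

/-- Dominated convergence for the exponential series. It serves both the Kummer functions and the
expansion of the kernel on horizontal lines. -/
lemma hasSum_integral_mul_exp {κ : ℝ → ℝ} {g : ℝ → ℂ} (hκ : Continuous κ) (hg : Continuous g) :
    HasSum (fun n : ℕ => (∫ u in (0 : ℝ)..1, (κ u : ℂ) * g u ^ n) / (n ! : ℂ))
      (∫ u in (0 : ℝ)..1, (κ u : ℂ) * Complex.exp (g u)) := by
  obtain ⟨D, hD⟩ := (isCompact_Icc (a := (0 : ℝ)) (b := 1)).exists_bound_of_continuousOn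
    hκ.continuousOn
  obtain ⟨E, hE⟩ := (isCompact_Icc (a := (0 : ℝ)) (b := 1)).exists_bound_of_continuousOn
    hg.continuousOn
  have := intervalIntegral.hasSum_integral_of_dominated_convergence
    (μ := MeasureTheory.volume) (a := 0) (b := 1)
    (F := fun (n : ℕ) (u : ℝ) => (κ u : ℂ) * g u ^ n / (n ! : ℂ))
    (f := fun u => (κ u : ℂ) * Complex.exp (g u))
    (fun n _ => D * (E ^ n / n !))
    (fun n => Continuous.aestronglyMeasurable (by fun_prop))
    (fun n => Filter.Eventually.of_forall fun u hu => by
      rw [Set.uIoc_of_le zero_le_one] at hu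
      have h1 := hD u ⟨hu.1.le, hu.2⟩
      have h2 := hE u ⟨hu.1.le, hu.2⟩
      rw [norm_div, norm_mul, norm_pow, Complex.norm_natCast, mul_div_assoc, Complex.norm_real]
      have : 0 ≤ D := (norm_nonneg _).trans h1
      gcongr)
    (Filter.Eventually.of_forall fun u _ => (Real.summable_pow_div_factorial E).mul_left D)
    (by simp)
    (Filter.Eventually.of_forall fun u _ => by
      have h := NormedSpace.expSeries_div_hasSum_exp (𝔸 := ℂ) (g u)
      rw [← Complex.exp_eq_exp_ℂ] at h
      simpa only [mul_div_assoc] using h.mul_left (κ u : ℂ))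
  simpa only [intervalIntegral.integral_div] using this

/-- The weight `(1-k) u^{-k}` on the unit interval. -/
def kappa (k : ℝ) (u : ℝ) : ℝ := (1 - k) * u ^ (-k)

lemma continuous_kappa {k : ℝ} (hk : k < 0) : Continuous (kappa k) :=
  continuous_const.mul (Real.continuous_rpow_const (by linarith))

lemma eval_ascPochhammer_eq_prod (n : ℕ) (a : ℂ) :
    (ascPochhammer ℂ n).eval a = ∏ j ∈ Finset.range n, (a + j) := by
  induction n with
  | zero => simp
  | succ n ih => rw [ascPochhammer_succ_eval, ih, Finset.prod_range_succ]

lemma ascPochhammer_two_sub_ne_zero {k : ℝ} (hk : k < 0) (n : ℕ) :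
    (ascPochhammer ℂ n).eval (2 - k : ℂ) ≠ 0 := by
  rw [eval_ascPochhammer_eq_prod]
  refine Finset.prod_ne_zero_iff.mpr fun j _ => ?_
  have hj : (0 : ℝ) ≤ j := j.cast_nonneg
  have : (2 - k + j : ℝ) ≠ 0 := by linarith
  exact_mod_cast this

/-- Both sides are `(1-k)/(n+1-k)`: the quotient of Pochhammer symbols telescopes. -/
lemma integral_kappa_mul_pow {k : ℝ} (hk : k < 0) (n : ℕ) :
    ∫ u in (0 : ℝ)..1, (kappa k u : ℂ) * (u : ℂ) ^ n =
      (ascPochhammer ℂ n).eval (1 - k : ℂ) / (ascPochhammer ℂ n).eval (2 - k : ℂ) := by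
  have h1 : ∫ u in (0 : ℝ)..1, (kappa k u : ℂ) * (u : ℂ) ^ n =
      (((1 - k) * ∫ u in (0 : ℝ)..1, u ^ (n - k) : ℝ) : ℂ) := by
    rw [← intervalIntegral.integral_const_mul, ← intervalIntegral.integral_ofReal]
    refine intervalIntegral.integral_congr_ae (Filter.Eventually.of_forall fun u hu => ?_)
    rw [Set.uIoc_of_le zero_le_one] at hu
    have : u ^ ((n : ℝ) - k) = u ^ (-k) * u ^ n := by
      rw [← Real.rpow_natCast, ← Real.rpow_add hu.1]; congr 1; ring
    rw [this, kappa]; push_cast; ring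
  have hn : (0 : ℝ) ≤ n := n.cast_nonneg
  rw [h1, integral_rpow (Or.inl (by linarith)), Real.one_rpow, Real.zero_rpow (by linarith)]
  have hne : ((n : ℂ) - k + 1) ≠ 0 := by
    have : (n : ℝ) - k + 1 ≠ 0 := by linarith
    exact_mod_cast this
  have hp := ascPochhammer_two_sub_ne_zero hk n
  rw [eq_div_iff hp]
  push_cast
  rw [sub_zero, mul_one_div, div_mul_eq_mul_div, div_eq_iff hne]
  have e1 := ascPochhammer_succ_right ℂ n
  have e2 := ascPochhammer_succ_left ℂ n
  have e3 := congrArg (Polynomial.eval (1 - k : ℂ)) (e1.symm.trans e2)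
  simp only [Polynomial.eval_mul, Polynomial.eval_X, Polynomial.eval_comp, Polynomial.eval_add,
    Polynomial.eval_one, Polynomial.eval_natCast] at e3
  rw [show (1 - k + 1 : ℂ) = 2 - k by ring] at e3
  rw [← e3]; ring

lemma integral_kappa_mul_one_sub_pow {k : ℝ} (hk : k < 0) (n : ℕ) :
    ∫ u in (0 : ℝ)..1, (kappa k u : ℂ) * (1 - (u : ℂ)) ^ n =
      (n ! : ℂ) / (ascPochhammer ℂ n).eval (2 - k : ℂ) := by
  have h1 : ∫ u in (0 : ℝ)..1, (kappa k u : ℂ) * (1 - (u : ℂ)) ^ n =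
      (1 - k) * Complex.betaIntegral (1 - k) (n + 1) := by
    rw [Complex.betaIntegral, ← intervalIntegral.integral_const_mul]
    refine intervalIntegral.integral_congr_ae (Filter.Eventually.of_forall fun u hu => ?_)
    rw [Set.uIoc_of_le zero_le_one] at hu
    rw [kappa]
    push_cast
    rw [Complex.ofReal_cpow hu.1.le]
    simp only [add_sub_cancel_right, Complex.cpow_natCast]
    push_cast
    rw [show (1 - k - 1 : ℂ) = -k by ring]; ring
  have hk1 : (1 - k : ℂ) ≠ 0 := by
    have : (1 - k : ℝ) ≠ 0 := by linarith
    exact_mod_cast this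
  rw [h1, Complex.betaIntegral_eval_nat_add_one_right (by simp; linarith),
    Finset.prod_range_succ', eval_ascPochhammer_eq_prod]
  have : ∏ j ∈ Finset.range n, ((1 : ℂ) - k + ((j + 1 : ℕ) : ℂ)) =
      ∏ j ∈ Finset.range n, ((2 : ℂ) - k + j) :=
    Finset.prod_congr rfl fun j _ => by push_cast; ring
  rw [this]
  have hp := ascPochhammer_two_sub_ne_zero hk n
  rw [eval_ascPochhammer_eq_prod] at hp
  simp only [Nat.cast_zero, add_zero]
  field_simp

/-- At `s = 1 - k/2` the second Kummer parameter is `2 - k` and the first is `1 - k` for `m > 0` and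
`1` for `m < 0`. This lemma and the next are Euler's integrals for the two cases, linked by Kummer's
transformation. -/
lemma kummerM_one_sub {k : ℝ} (hk : k < 0) (Y : ℝ) :
    kummerM (1 - k) (2 - k) Y = expInt (kappa k) Y := by
  have h := hasSum_integral_mul_exp (g := fun u => u * (Y : ℂ)) (continuous_kappa hk) (by fun_prop)
  rw [kummerM, expInt, ← h.tsum_eq]
  refine tsum_congr fun n => ?_
  rw [← integral_kappa_mul_pow hk n, ← intervalIntegral.integral_mul_const]
  simp only [mul_pow, mul_assoc]

lemma kummerM_one {k : ℝ} (hk : k < 0) (Y : ℝ) :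
    kummerM 1 (2 - k) Y = Complex.exp Y * expInt (kappa k) (-Y) := by
  have h := hasSum_integral_mul_exp (g := fun u => (1 - u) * (Y : ℂ)) (continuous_kappa hk)
    (by fun_prop)
  have e : Complex.exp Y * expInt (kappa k) (-Y) =
      ∫ u in (0 : ℝ)..1, (kappa k u : ℂ) * Complex.exp ((1 - u) * (Y : ℂ)) := by
    rw [expInt, ← intervalIntegral.integral_const_mul]
    refine intervalIntegral.integral_congr fun u _ => ?_
    rw [mul_left_comm, ← Complex.exp_add]; congr 2; ring
  rw [kummerM, e, ← h.tsum_eq]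
  refine tsum_congr fun n => ?_
  have h1 : ((ascPochhammer ℂ n).eval 1 : ℂ) = (n ! : ℂ) := by
    exact ascPochhammer_eval_one ℂ n
  rw [h1, ← integral_kappa_mul_one_sub_pow hk n, ← intervalIntegral.integral_mul_const]
  simp only [mul_pow, mul_assoc]

/-- The constant by which `φ_{m,k}` exceeds the normalised exponential integral. -/
def amplitude (m : ℤ) (k : ℝ) : ℝ :=
  if m = 0 then 1 else (4 * Real.pi * |(m : ℝ)|) ^ (1 - k) / Real.Gamma (2 - k)

lemma expInt_kappa_zero {k : ℝ} (hk : k < 0) : expInt (kappa k) 0 = 1 := by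
  have := integral_kappa_mul_pow hk 0
  simpa [expInt] using this

/-- `φ_{m,k}(z, 1 - k/2)` as an exponential integral. -/
lemma phi_eq {k : ℝ} (hk : k < 0) (m : ℤ) (z : ℍ) :
    phi m k (1 - k / 2) z = amplitude m k * ((z.im ^ (1 - k) : ℝ) : ℂ) *
      (Complex.exp (2 * Real.pi * Complex.I * m * z) *
        expInt (kappa k) (2 * Real.pi * Complex.I * m * ((starRingEnd ℂ) (z : ℂ) - z))) := by
  have hy := z.im_pos
  have hz : (z : ℂ) = z.re + z.im * Complex.I := (Complex.re_add_im (z : ℂ)).symm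
  have hcz : (starRingEnd ℂ) (z : ℂ) - z = -(2 * z.im * Complex.I) := by
    apply Complex.ext <;> simp; ring
  rw [hcz]
  rcases eq_or_ne m 0 with rfl | hm
  · rw [phi, curlyM, if_pos rfl, amplitude, if_pos rfl, e]
    rw [Complex.ofReal_cpow hy.le]
    simp only [Int.cast_zero, zero_mul, mul_zero, Complex.exp_zero, expInt_kappa_zero hk]
    push_cast
    rw [show (1 - k / 2 - k / 2 : ℂ) = 1 - k by ring]; simp
  · set Y : ℝ := 4 * Real.pi * |(m : ℝ)| * z.im with hY
    have hm' : 0 < |(m : ℝ)| := abs_pos.mpr (by exact_mod_cast hm)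
    have hpi := Real.pi_pos
    have hYpos : 0 < Y := by positivity
    have hYc : (Y : ℂ) ≠ 0 := by exact_mod_cast hYpos.ne'
    have hpow : (Y : ℂ) ^ (-(k : ℂ) / 2) * (Y : ℂ) ^ (1 - (k : ℂ) / 2) =
        ((4 * Real.pi * |(m : ℝ)|) ^ (1 - k) : ℝ) * ((z.im ^ (1 - k) : ℝ) : ℂ) := by
      rw [← Complex.cpow_add _ _ hYc, ← Complex.ofReal_mul,
        ← Real.mul_rpow (by positivity) hy.le, ← hY, Complex.ofReal_cpow hYpos.le]
      congr 1; push_cast; ring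
    have hG : (Complex.Gamma (2 * (1 - k / 2 : ℂ)))⁻¹ = ((Real.Gamma (2 - k))⁻¹ : ℝ) := by
      rw [show (2 * (1 - k / 2 : ℂ)) = ((2 - k : ℝ) : ℂ) by push_cast; ring,
        Complex.Gamma_ofReal]; push_cast; rfl
    -- With `Y = 4π|m|y`, `e^{-Y/2} e(mx)` is already `e(mz)` when `m > 0`. For `m < 0` the extra
    -- `e^Y` from `kummerM_one` corrects the sign of the exponent, so both signs of `m` give one
    -- formula.
    have key : Complex.exp (-(Y : ℂ) / 2) *
        kummerM (1 - (k : ℂ) / 2 - 1 / 2 - k / 2 * (m.sign : ℂ) + 1 / 2)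
          (1 + 2 * (1 - (k : ℂ) / 2 - 1 / 2)) Y * e (m * z.re) =
        Complex.exp (2 * Real.pi * Complex.I * m * z) *
          expInt (kappa k) (2 * Real.pi * Complex.I * m * (-(2 * z.im * Complex.I))) := by
      rw [show (1 + 2 * (1 - (k : ℂ) / 2 - 1 / 2)) = 2 - k by ring]
      rcases lt_or_gt_of_ne hm with h | h
      · have hYm : (Y : ℂ) = -(4 * Real.pi * m * z.im) := by
          rw [hY, abs_of_neg (by exact_mod_cast h)]; push_cast; ring
        rw [Int.sign_eq_neg_one_of_neg h,
          show (1 - (k : ℂ) / 2 - 1 / 2 - k / 2 * ((-1 : ℤ) : ℂ) + 1 / 2) = 1 by push_cast; ring,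
          kummerM_one hk, e, mul_right_comm, ← Complex.exp_add, ← mul_assoc,
          ← Complex.exp_add]
        congr 2
        · rw [hYm]
          conv_rhs => rw [hz]
          linear_combination -(2 * Real.pi * m * z.im) * Complex.I_mul_I
        · rw [hYm]; linear_combination (4 * Real.pi * m * z.im) * Complex.I_mul_I
      · have hYm : (Y : ℂ) = 4 * Real.pi * m * z.im := by
          rw [hY, abs_of_pos (by exact_mod_cast h)]; push_cast; ring
        rw [Int.sign_eq_one_of_pos h,
          show (1 - (k : ℂ) / 2 - 1 / 2 - k / 2 * ((1 : ℤ) : ℂ) + 1 / 2) = 1 - k by push_cast; ring,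
          kummerM_one_sub hk, e, mul_right_comm, ← Complex.exp_add]
        congr 2
        · rw [hYm]
          conv_rhs => rw [hz]
          linear_combination -(2 * Real.pi * m * z.im) * Complex.I_mul_I
        · rw [hYm]; linear_combination (4 * Real.pi * m * z.im) * Complex.I_mul_I
    rw [phi, curlyM, if_neg hm, amplitude, if_neg hm, ← hY, ← key, whittakerM, hG]
    rw [show (1 - (k : ℂ) / 2 - 1 / 2 + 1 / 2) = 1 - k / 2 by ring]
    push_cast
    linear_combination ((Real.Gamma (2 - k) : ℂ))⁻¹ * Complex.exp (-(Y : ℂ) / 2) *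
        kummerM (1 - (k : ℂ) / 2 - 1 / 2 - k / 2 * (m.sign : ℂ) + 1 / 2)
          (1 + 2 * (1 - (k : ℂ) / 2 - 1 / 2)) Y * e (m * z.re) * hpow

/-! ### The incomplete gamma function as an exponential integral. -/

lemma continuous_cexp_mul_cpow {k : ℝ} (hk : k < 0) :
    Continuous fun t : ℝ => Complex.exp (-(t : ℂ)) * (t : ℂ) ^ (((1 - k : ℝ) : ℂ) - 1) := by
  refine Continuous.mul (by fun_prop) (Complex.continuous_ofReal_cpow_const ?_)
  simp; linarith

lemma integrableOn_incGamma {k : ℝ} (hk : k < 0) (x : ℝ) :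
    MeasureTheory.IntegrableOn
      (fun t : ℝ => Complex.exp (-(t : ℂ)) * (t : ℂ) ^ (((1 - k : ℝ) : ℂ) - 1)) (Set.Ioi x) := by
  have h0 : MeasureTheory.IntegrableOn
      (fun t : ℝ => Complex.exp (-(t : ℂ)) * (t : ℂ) ^ (((1 - k : ℝ) : ℂ) - 1)) (Set.Ioi 0) := by
    have := Complex.GammaIntegral_convergent (s := ((1 - k : ℝ) : ℂ)) (by simp; linarith)
    refine this.congr_fun (fun t _ => ?_) measurableSet_Ioi
    simp only; push_cast; rfl
  rcases le_or_gt 0 x with h | h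
  · exact h0.mono_set (Set.Ioi_subset_Ioi h)
  · rw [← Set.Ioc_union_Ioi_eq_Ioi h.le]
    exact ((continuous_cexp_mul_cpow hk).integrableOn_Ioc).union h0

lemma incGamma_zero {k : ℝ} (hk : k < 0) : incGamma (1 - k) 0 = Complex.Gamma (1 - k) := by
  rw [Complex.Gamma_eq_integral (by simp; linarith), Complex.GammaIntegral, incGamma]
  refine MeasureTheory.setIntegral_congr_fun measurableSet_Ioi fun t _ => ?_
  push_cast; rfl

lemma Gamma_sub_incGamma {k : ℝ} (hk : k < 0) (x : ℝ) :
    Complex.Gamma (1 - k) - incGamma (1 - k) x =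
      ∫ t in (0 : ℝ)..x, Complex.exp (-(t : ℂ)) * (t : ℂ) ^ (((1 - k : ℝ) : ℂ) - 1) := by
  rw [← incGamma_zero hk, incGamma, incGamma]
  exact intervalIntegral.integral_Ioi_sub_Ioi' (integrableOn_incGamma hk 0)
    (integrableOn_incGamma hk x)

/-- Substitute `t = xu` in the integral from `0` to `x`. As `u > 0`, the principal power splits as
`x^{-k} u^{-k}` also for `x < 0`, in accordance with the convention `arg t = π`. -/
lemma Gamma_sub_incGamma_eq {k : ℝ} (hk : k < 0) (x : ℝ) :
    Complex.Gamma (1 - k) - incGamma (1 - k) x =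
      x * (x : ℂ) ^ (-(k : ℂ)) / (1 - k) * expInt (kappa k) (-x) := by
  have hk1 : (1 - k : ℂ) ≠ 0 := by
    have : (1 - k : ℝ) ≠ 0 := by linarith
    exact_mod_cast this
  have h := intervalIntegral.smul_integral_comp_mul_left (E := ℂ)
    (f := fun t : ℝ => Complex.exp (-(t : ℂ)) * (t : ℂ) ^ (((1 - k : ℝ) : ℂ) - 1))
    (a := 0) (b := 1) x
  rw [mul_zero, mul_one] at h
  rw [Gamma_sub_incGamma hk, ← h, expInt, Complex.real_smul, mul_div_assoc, mul_assoc]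
  rcases eq_or_ne x 0 with rfl | hx
  · simp
  refine congrArg (fun t => (x : ℂ) * t) ?_
  rw [← intervalIntegral.integral_const_mul]
  refine intervalIntegral.integral_congr_ae (Filter.Eventually.of_forall fun u hu => ?_)
  rw [Set.uIoc_of_le zero_le_one] at hu
  have hxc : (x : ℂ) ≠ 0 := by exact_mod_cast hx
  have huc : (u : ℂ) ≠ 0 := by exact_mod_cast hu.1.ne'
  have hp : ((x * u : ℝ) : ℂ) ^ (((1 - k : ℝ) : ℂ) - 1) =
      (x : ℂ) ^ (-(k : ℂ)) * (u : ℂ) ^ (-(k : ℂ)) := by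
    rw [show (((1 - k : ℝ) : ℂ) - 1) = -k by push_cast; ring, Complex.ofReal_mul,
      Complex.cpow_def_of_ne_zero (mul_ne_zero hxc huc), Complex.cpow_def_of_ne_zero hxc,
      Complex.cpow_def_of_ne_zero huc, Complex.log_mul_ofReal u hu.1 _ hxc, ← Complex.exp_add,
      Complex.ofReal_log hu.1.le]
    congr 1; ring
  rw [hp, kappa]
  push_cast
  rw [Complex.ofReal_cpow hu.1.le]
  push_cast
  rw [show -((x : ℂ) * u) = u * -x by ring]
  field_simp

/-- `φ_{m,k}(z, 1 - k/2) = 𝔪_{m,k}(y) q^m`. -/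
lemma frakM_mul_e {k : ℝ} (hk : k < 0) (m : ℤ) (z : ℍ) :
    frakM m k z.im * e (m * z) = phi m k (1 - k / 2) z := by
  have hy := z.im_pos
  have hpi := Real.pi_pos
  rw [phi_eq hk]
  have hcz : (starRingEnd ℂ) (z : ℂ) - z = -(2 * z.im * Complex.I) := by
    apply Complex.ext <;> simp; ring
  have hk1 : (1 - k : ℂ) ≠ 0 := by
    have : (1 - k : ℝ) ≠ 0 := by linarith
    exact_mod_cast this
  have hG : Complex.Gamma (1 - k) ≠ 0 := by
    have := Complex.Gamma_ne_zero_of_re_pos (s := 1 - k) (by simp; linarith)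
    exact this
  have hG2 : ((Real.Gamma (2 - k) : ℝ) : ℂ) = (1 - k) * Complex.Gamma (1 - k) := by
    rw [← Complex.Gamma_add_one _ hk1, ← Complex.Gamma_ofReal]; congr 1; push_cast; ring
  have hexp : Complex.exp (2 * Real.pi * Complex.I * m * z) = e (m * z) := by
    rw [e]; congr 1; ring
  rw [hcz, hexp]
  have harg : (2 * Real.pi * Complex.I * m * -(2 * z.im * Complex.I) : ℂ) =
      -((-4 * Real.pi * m * z.im : ℝ) : ℂ) := by
    push_cast; linear_combination (-4 * Real.pi * m * z.im) * Complex.I_mul_I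
  have hsub : ∀ x : ℝ, 1 - incGamma (1 - k) x / Complex.Gamma (1 - k) =
      x * (x : ℂ) ^ (-(k : ℂ)) / ((1 - k) * Complex.Gamma (1 - k)) * expInt (kappa k) (-x) := by
    intro x
    have := Gamma_sub_incGamma_eq hk x
    field_simp
    field_simp at this
    linear_combination this
  rcases lt_trichotomy m 0 with h | rfl | h
  · have hm : (m : ℝ) < 0 := by exact_mod_cast h
    have hx : 0 < -4 * Real.pi * m * z.im := by
      have : 0 < 4 * Real.pi * -(m : ℝ) * z.im := by
        have : 0 < -(m : ℝ) := by linarith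
        positivity
      linarith
    rw [frakM, if_neg h.ne, if_pos h, hsub, amplitude, if_neg h.ne, harg, abs_of_neg hm]
    have hp : ((-4 * Real.pi * m * z.im : ℝ) : ℂ) *
        ((-4 * Real.pi * m * z.im : ℝ) : ℂ) ^ (-(k : ℂ)) =
        ((4 * Real.pi * -m) ^ (1 - k) : ℝ) * ((z.im ^ (1 - k) : ℝ) : ℂ) := by
      rw [← Complex.ofReal_mul, ← Real.mul_rpow (by nlinarith) hy.le]
      rw [show 4 * Real.pi * -m * z.im = -4 * Real.pi * m * z.im by ring,
        Complex.ofReal_cpow hx.le, Complex.ofReal_sub, Complex.cpow_sub _ _ (by exact_mod_cast hx.ne'),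
        Complex.cpow_neg]
      simp [div_eq_mul_inv]
    rw [hp]
    push_cast
    rw [hG2]; ring
  · simp [frakM, amplitude, expInt_kappa_zero hk, e]
  · have hm : (0 : ℝ) < m := by exact_mod_cast h
    have hx : 0 < 4 * Real.pi * m * z.im := by positivity
    rw [frakM, if_neg h.ne', if_neg h.not_gt, hsub, amplitude, if_neg h.ne', harg, abs_of_pos hm]
    -- The argument `x = -4πmy` is negative, so `x^{-k} = |x|^{-k} e^{-πik}`. Together with
    -- `(-1)^{k-1} = e^{πi(k-1)}` this leaves `-1`, which turns the factor `x` into `|x|`.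
    have hp : (-1 : ℂ) ^ ((k : ℂ) - 1) * (((-4 * Real.pi * m * z.im : ℝ) : ℂ) *
        ((-4 * Real.pi * m * z.im : ℝ) : ℂ) ^ (-(k : ℂ))) =
        ((4 * Real.pi * m) ^ (1 - k) : ℝ) * ((z.im ^ (1 - k) : ℝ) : ℂ) := by
      have h1 : (-1 : ℂ) ^ ((k : ℂ) - 1) * Complex.exp (Real.pi * Complex.I * -k) = -1 := by
        rw [Complex.cpow_def_of_ne_zero (by simp), Complex.log_neg_one, ← Complex.exp_add]
        rw [show (Real.pi * Complex.I * (k - 1) + Real.pi * Complex.I * -k : ℂ) =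
          -(Real.pi * Complex.I) by ring, Complex.exp_neg, Complex.exp_pi_mul_I]
        norm_num
      rw [Complex.ofReal_cpow_of_nonpos (by linarith), ← Complex.ofReal_mul,
        ← Real.mul_rpow (by positivity) hy.le, Complex.ofReal_cpow hx.le,
        show ((1 - k : ℝ) : ℂ) = 1 + -(k : ℂ) by push_cast; ring,
        show ((-4 * Real.pi * m * z.im : ℝ) : ℂ) = -((4 * Real.pi * m * z.im : ℝ) : ℂ) by
        push_cast; ring, neg_neg,
        Complex.cpow_add _ _ (Complex.ofReal_ne_zero.mpr hx.ne'), Complex.cpow_one]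
      linear_combination -((4 * Real.pi * m * z.im : ℝ) : ℂ) *
        (((4 * Real.pi * m * z.im : ℝ) : ℂ) ^ (-(k : ℂ))) * h1
    push_cast at hp ⊢
    rw [hG2]
    linear_combination (((1 - k) * Complex.Gamma (1 - k))⁻¹) *
      expInt (kappa k) (-(-4 * Real.pi * m * z.im)) * e (m * z) * hp

/-! ### The Poincaré series as a kernel series -/

lemma re_T_zpow_smul (n : ℤ) (z : ℍ) : (ModularGroup.T ^ n • z).re = z.re + n :=
  ModularGroup.re_T_zpow_smul z n

lemma e_add_intCast (w : ℂ) (n : ℤ) : e (w + n) = e w := by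
  rw [e, e, mul_add, Complex.exp_add, mul_comm (2 * (Real.pi : ℂ) * Complex.I) (n : ℂ),
    Complex.exp_int_mul_two_pi_mul_I, mul_one]

lemma isPeriodic_phi (m : ℤ) (k : ℝ) (s : ℂ) : IsPeriodic (phi m k s) := fun n z => by
  rw [phi, phi, ModularGroup.im_T_zpow_smul, re_T_zpow_smul]
  congr 1
  rw [← e_add_intCast (m * z.re) (m * n)]
  congr 1; push_cast; ring

lemma isPeriodic_e (m : ℤ) : IsPeriodic fun z : ℍ => e (m * z) := fun n z => by
  simp only
  rw [ModularGroup.coe_T_zpow_smul_eq, ← e_add_intCast (m * z) (m * n)]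
  congr 1; push_cast; ring

lemma conj_cpow_ofReal {w : ℂ} (hw : w ∈ Complex.slitPlane) (s : ℝ) :
    (starRingEnd ℂ) w ^ (s : ℂ) = (starRingEnd ℂ) (w ^ (s : ℂ)) := by
  rw [Complex.conj_cpow _ _ (Complex.mem_slitPlane_iff_arg.mp hw).1, Complex.conj_ofReal]

/-- Off the branch cut `|w|^{-2(1-k)} = w^{k-1} w̄^{k-1}` with principal powers. For `w = cz+d` this
combines the slash factor with the one in `(Im γz)^{1-k}`. -/
lemma cpow_mul_norm_rpow {w : ℂ} (hw : w ∈ Complex.slitPlane) (k : ℝ) :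
    w ^ (-(k : ℂ)) * (((‖w‖ ^ 2) ^ (-(1 - k)) : ℝ) : ℂ) =
      w⁻¹ * (starRingEnd ℂ) w ^ (-((1 - k : ℝ) : ℂ)) := by
  have h0 : w ≠ 0 := Complex.slitPlane_ne_zero hw
  have h1 : (((‖w‖ ^ 2) ^ (-(1 - k)) : ℝ) : ℂ) =
      w ^ (-((1 - k : ℝ) : ℂ)) * (starRingEnd ℂ) w ^ (-((1 - k : ℝ) : ℂ)) := by
    rw [← Complex.ofReal_neg, conj_cpow_ofReal hw, Complex.mul_conj, Complex.normSq_eq_norm_sq,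
      Complex.norm_cpow_real, ← Real.rpow_natCast, ← Real.rpow_natCast, ← Real.rpow_mul (norm_nonneg _),
      ← Real.rpow_mul (norm_nonneg _), mul_comm]
  rw [h1, ← mul_assoc, ← Complex.cpow_add _ _ h0]
  congr 1
  rw [← Complex.cpow_neg_one]
  congr 1; push_cast; ring

lemma slash_phi_eq {k : ℝ} {N : ℕ} (hk : IsAdmissible k N) (hk0 : k < 0) (m : ℤ) {γ : SL(2, ℤ)}
    (hγ : IsNormalized γ) (z : ℍ) :
    slash k (phi m k (1 - k / 2)) γ z = amplitude m k * ((z.im ^ (1 - k) : ℝ) : ℂ) *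
      (multiplier k (γ 1 0) (γ 1 1) * kernelTerm m γ 0 1 (1 - k) (kappa k) z) := by
  have hs := hγ.den_mem_slitPlane z.im_pos
  have hn : (0 : ℝ) < ‖den γ z‖ ^ 2 := by
    have := den_ne_zero γ z.im_pos
    positivity
  rw [slash_eq, autFactor_eq hk, phi_eq hk0, im_smul, kernelTerm, ← den_coe, ← mob_coe,
    Real.div_rpow z.im_pos.le hn.le, pow_one, pow_zero]
  have := cpow_mul_norm_rpow hs k
  rw [Real.rpow_neg hn.le] at this
  push_cast at this ⊢
  rw [div_eq_mul_inv]
  linear_combination multiplier k (γ 1 0) (γ 1 1) * amplitude m k *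
    (((z.im ^ (1 - k) : ℝ)) : ℂ) * (Complex.exp (2 * Real.pi * Complex.I * m * mob γ z) *
      expInt (kappa k) (2 * Real.pi * Complex.I * m *
        ((starRingEnd ℂ) (mob γ z) - mob γ z))) * this

/-- The multipliers of the representatives of the cosets. -/
def chi (k : ℝ) (N : ℕ) (g : Cosets N) : ℂ := multiplier k ((rep g).1 1 0) ((rep g).1 1 1)

lemma norm_chi {k : ℝ} {N : ℕ} (hk : IsAdmissible k N) (g : Cosets N) : ‖chi k N g‖ ≤ 1 :=
  (norm_multiplier hk (isCoprime_row _)).le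

lemma isNormalized_rep {N : ℕ} (g : Cosets N) : IsNormalized (rep g).1 := rep_row g

lemma row_rep_injective (N : ℕ) : Function.Injective fun g : Cosets N => row (rep g).1 := by
  have := rep_row_mul_injective (N := N) 1
  simpa [row] using this

/-- The kernel series attached to the Poincaré series. -/
def cosetSum (m : ℤ) (k : ℝ) (N : ℕ) : ℂ → ℂ :=
  kernelSum m (fun g : Cosets N => (rep g).1) (chi k N) 0 1 (1 - k) (kappa k)

lemma weight_condition {k : ℝ} (hk0 : k < 0) : 2 < ((1 : ℕ) : ℝ) + (1 - k) - (0 : ℕ) := by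
  push_cast; linarith

lemma poincareTerm_eq {k : ℝ} {N : ℕ} (hk : IsAdmissible k N) (hk0 : k < 0) (m : ℤ) (z : ℍ)
    (g : Cosets N) :
    poincareTerm m k N z (1 - k / 2) g = amplitude m k * ((z.im ^ (1 - k) : ℝ) : ℂ) *
      (chi k N g * kernelTerm m (rep g).1 0 1 (1 - k) (kappa k) z) := by
  rw [poincareTerm, slash_out hk (isPeriodic_phi _ _ _), slash_phi_eq hk hk0 m (isNormalized_rep g)]
  rfl

lemma summable_poincareTerm {k : ℝ} {N : ℕ} (hk : IsAdmissible k N) (hk0 : k < 0) (m : ℤ)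
    (z : ℍ) : Summable (poincareTerm m k N z (1 - k / 2)) := by
  refine ((summable_kernelTerm (m := m) (row_rep_injective N) (norm_chi hk)
    (continuous_kappa hk0) (weight_condition hk0) z.im_pos).mul_left
    (amplitude m k * ((z.im ^ (1 - k) : ℝ) : ℂ))).congr fun g => ?_
  exact (poincareTerm_eq hk hk0 m z g).symm

lemma poincare_eq {k : ℝ} {N : ℕ} (hk : IsAdmissible k N) (hk0 : k < 0) (m : ℤ) (z : ℍ) :
    poincare m k N z (1 - k / 2) =
      amplitude m k * ((z.im ^ (1 - k) : ℝ) : ℂ) * cosetSum m k N z := by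
  rw [poincare, cosetSum, kernelSum, ← tsum_mul_left]
  exact tsum_congr fun g => poincareTerm_eq hk hk0 m z g

lemma poincare_eq_poincareSum {k : ℝ} {N : ℕ} (hk : IsAdmissible k N) (m : ℤ) (s : ℂ) (z : ℍ) :
    poincare m k N z s = poincareSum k N (phi m k s) z :=
  tsum_congr fun g => slash_out hk (isPeriodic_phi _ _ _) g z

/-! ### Derivatives of the Poincaré series -/

lemma hasWirtingerAt_im_rpow (a : ℝ) {w : ℂ} (hw : 0 < w.im) :
    HasWirtingerAt (fun w : ℂ => ((w.im ^ a : ℝ) : ℂ))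
      (-(Complex.I / 2 * a * ((w.im ^ (a - 1) : ℝ) : ℂ)))
      (Complex.I / 2 * a * ((w.im ^ (a - 1) : ℝ) : ℂ)) w := by
  have h1 := (Real.hasDerivAt_rpow_const (x := w.im) (p := a) (Or.inl hw.ne')).comp_hasFDerivAt w
    Complex.imCLM.hasFDerivAt
  have h2 := Complex.ofRealCLM.hasFDerivAt.comp w h1
  refine HasFDerivAt.congr_fderiv h2 ?_
  ext x
  have hx := Complex.sub_conj x
  simp
  push_cast at hx
  linear_combination (Complex.I / 2 * a * ((w.im ^ (a - 1) : ℝ) : ℂ)) * hx +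
    a * ((w.im ^ (a - 1) : ℝ) : ℂ) * x.im * Complex.I_mul_I

lemma ofComplex_comp_eqOn {f : ℍ → ℂ} {F : ℂ → ℂ} (h : ∀ z : ℍ, f z = F z) :
    Set.EqOn (f ∘ UpperHalfPlane.ofComplex) F upperHalf := fun w hw => by
  rw [Function.comp_apply, h, UpperHalfPlane.ofComplex_apply_of_im_pos hw]

lemma fderiv_ofComplex {f : ℍ → ℂ} {F : ℂ → ℂ} (h : ∀ z : ℍ, f z = F z) {w : ℂ}
    (hw : 0 < w.im) : fderiv ℝ (f ∘ UpperHalfPlane.ofComplex) w = fderiv ℝ F w :=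
  Filter.EventuallyEq.fderiv_eq
    ((ofComplex_comp_eqOn h).eventuallyEq_of_mem (isOpen_upperHalf.mem_nhds hw))

lemma dx_eq {f : ℍ → ℂ} {F : ℂ → ℂ} (h : ∀ z : ℍ, f z = F z) {A B : ℂ} {z : ℍ}
    (hF : HasWirtingerAt F A B z) : dx f z = A + B := by
  rw [dx, fderiv_ofComplex h z.im_pos, HasFDerivAt.fderiv hF]; simp

lemma dy_eq {f : ℍ → ℂ} {F : ℂ → ℂ} (h : ∀ z : ℍ, f z = F z) {A B : ℂ} {z : ℍ}
    (hF : HasWirtingerAt F A B z) : dy f z = Complex.I * (A - B) := by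
  rw [dy, fderiv_ofComplex h z.im_pos, HasFDerivAt.fderiv hF]; simp; ring

lemma dx_add_I_mul_dy {f : ℍ → ℂ} {F : ℂ → ℂ} (h : ∀ z : ℍ, f z = F z) {A B : ℂ} {z : ℍ}
    (hF : HasWirtingerAt F A B z) : dx f z + Complex.I * dy f z = 2 * B := by
  rw [dx_eq h hF, dy_eq h hF]
  linear_combination (A - B) * Complex.I_mul_I

/-- `∂_x² + ∂_y² = (∂_x - i∂_y)(∂_x + i∂_y)`, where the mixed derivatives cancel because `F` is
`C²`, and `∂_x - i∂_y = 2 ∂/∂w` acts on `U`. -/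
lemma dx_dx_add_dy_dy {f : ℍ → ℂ} {F U : ℂ → ℂ} (h : ∀ z : ℍ, f z = F z)
    (hF : ContDiffOn ℝ 2 F upperHalf)
    (hU : ∀ z : ℍ, dx f z + Complex.I * dy f z = U z) {A B : ℂ} {z : ℍ}
    (hUz : HasWirtingerAt U A B z) : dx (dx f) z + dy (dy f) z = 2 * A := by
  have hz := isOpen_upperHalf.mem_nhds (show (z : ℂ) ∈ upperHalf from z.im_pos)
  have hF2 : ContDiffAt ℝ 2 F z := hF.contDiffAt hz
  have hd : DifferentiableAt ℝ (fderiv ℝ F) z :=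
    (hF2.fderiv_right (m := 1) (by norm_num)).differentiableAt one_ne_zero
  have hev : ∀ v : ℂ, HasFDerivAt (fun w => fderiv ℝ F w v)
      ((fderiv ℝ (fderiv ℝ F) z).flip v) (z : ℂ) := fun v => by
    have := hd.hasFDerivAt.clm_apply (hasFDerivAt_const v (z : ℂ))
    refine this.congr_fderiv ?_
    ext; simp
  have hsymm := (hF2.isSymmSndFDerivAt (by simp)) 1 Complex.I
  have hdx : ∀ z : ℍ, dx f z = (fun w => fderiv ℝ F w 1) (z : ℂ) := fun z => by
    rw [dx, fderiv_ofComplex h z.im_pos]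
  have hdy : ∀ z : ℍ, dy f z = (fun w => fderiv ℝ F w Complex.I) (z : ℂ) := fun z => by
    rw [dy, fderiv_ofComplex h z.im_pos]
  have e1 : dx (dx f) z = fderiv ℝ (fderiv ℝ F) z 1 1 := by
    rw [dx, fderiv_ofComplex (F := fun w => fderiv ℝ F w 1) hdx z.im_pos, (hev 1).fderiv]; rfl
  have e2 : dy (dy f) z = fderiv ℝ (fderiv ℝ F) z Complex.I Complex.I := by
    rw [dy, fderiv_ofComplex (F := fun w => fderiv ℝ F w Complex.I) hdy z.im_pos, (hev Complex.I).fderiv]; rfl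
  have hU' : HasFDerivAt U ((fderiv ℝ (fderiv ℝ F) z).flip 1 +
      Complex.I • (fderiv ℝ (fderiv ℝ F) z).flip Complex.I) (z : ℂ) := by
    refine ((hev 1).add ((hev Complex.I).const_smul Complex.I)).congr_of_eventuallyEq ?_
    filter_upwards [hz] with w hw
    have := hU ⟨w, hw⟩
    rw [hdx, hdy] at this
    exact this.symm
  have huniq := HasFDerivAt.unique hUz hU'
  have h1 := congrArg (fun L : ℂ →L[ℝ] ℂ => L 1) huniq
  have h2 := congrArg (fun L : ℂ →L[ℝ] ℂ => L Complex.I) huniq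
  simp at h1 h2
  rw [e1, e2]
  linear_combination -h1 + Complex.I * h2 + (A - B) * (-Complex.I_mul_I) - Complex.I * hsymm +
    (fderiv ℝ (fderiv ℝ F) z Complex.I Complex.I) * Complex.I_mul_I

/-- Integration by parts for the kernel `κ`. -/
lemma mul_expInt_mul_kappa {k : ℝ} (hk : k < 0) (ζ : ℂ) :
    ζ * expInt (fun u => u * kappa k u) ζ =
      (1 - k) * (Complex.exp ζ - expInt (kappa k) ζ) := by
  have hk1 : (1 : ℝ) - k ≠ 0 := by linarith
  have hu : ∀ u ∈ Set.uIcc (0 : ℝ) 1, HasDerivAt (fun u : ℝ => ((u ^ (1 - k) : ℝ) : ℂ))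
      ((kappa k u : ℝ) : ℂ) u := fun u _ => by
    have := (Real.hasDerivAt_rpow_const (x := u) (p := 1 - k) (Or.inr (by linarith))).ofReal_comp
    convert this using 2
    rw [kappa]; congr 2; ring
  have hv : ∀ u ∈ Set.uIcc (0 : ℝ) 1, HasDerivAt (fun u : ℝ => Complex.exp (u * ζ))
      (Complex.exp (u * ζ) * ζ) u := fun u _ => by
    have := ((Complex.ofRealCLM.hasDerivAt (x := u)).mul_const ζ).cexp
    simpa using this
  have := intervalIntegral.integral_mul_deriv_eq_deriv_mul hu hv
    ((by have := continuous_kappa hk; fun_prop : Continuous fun u => ((kappa k u : ℝ) : ℂ)).intervalIntegrable _ _)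
    ((by fun_prop : Continuous fun u : ℝ => Complex.exp (u * ζ) * ζ).intervalIntegrable _ _)
  rw [expInt, expInt, ← intervalIntegral.integral_const_mul]
  have e1 : ∫ u in (0 : ℝ)..1, ζ * (((u * kappa k u : ℝ) : ℂ) * Complex.exp (u * ζ)) =
      (1 - k) * ∫ u in (0 : ℝ)..1, ((u ^ (1 - k) : ℝ) : ℂ) * (Complex.exp (u * ζ) * ζ) := by
    rw [← intervalIntegral.integral_const_mul]
    refine intervalIntegral.integral_congr fun u hu => ?_
    rw [Set.uIcc_of_le zero_le_one] at hu
    have : u ^ (1 - k) = u * u ^ (-k) := by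
      rcases hu.1.eq_or_lt with h | h
      · rw [← h, Real.zero_rpow hk1]; simp
      · rw [sub_eq_add_neg, Real.rpow_add h, Real.rpow_one]
    simp only [this, kappa]
    push_cast; ring
  rw [e1, this]
  simp [Real.zero_rpow hk1]

/-- The antiholomorphic derivative of a summand of the Poincaré series. -/
lemma kernelTerm_dzbar_identity {k : ℝ} (hk : k < 0) (m : ℤ) (γ : SL(2, ℤ))
    {w : ℂ} (hw : 0 < w.im) :
    Complex.I * (1 - k) * kernelTerm m γ 0 1 (1 - k) (kappa k) w +
        2 * w.im * kernelTermDzbar m γ 0 1 (1 - k) (kappa k) w =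
      Complex.I * (1 - k) * ((starRingEnd ℂ) (den γ w) ^ ((k : ℂ) - 2) *
        Complex.exp (2 * Real.pi * Complex.I * m * (starRingEnd ℂ) (mob γ w))) := by
  have hj := den_ne_zero γ hw
  have hJ : (starRingEnd ℂ) (den γ w) ≠ 0 := by simpa using hj
  set μ := mob γ w with hμ
  set j := den γ w with hjd
  set J := (starRingEnd ℂ) j with hJd
  set ζ : ℂ := 2 * Real.pi * Complex.I * m * ((starRingEnd ℂ) μ - μ) with hζ
  set E := expInt (kappa k) ζ with hE
  set E' := expInt (fun u => u * kappa k u) ζ with hE'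
  -- Integration by parts trades `ζE'` for the boundary term `exp ζ` and a multiple of `E`. The
  -- relations `2icy = j - j̄` and `ζ j j̄ = 4πmy` below then cancel all multiples of `E`, and only
  -- the boundary term survives.
  have h1 : ζ * E' = (1 - k) * (Complex.exp ζ - E) := mul_expInt_mul_kappa hk ζ
  have hexp : Complex.exp (2 * Real.pi * Complex.I * m * (starRingEnd ℂ) μ) =
      Complex.exp (2 * Real.pi * Complex.I * m * μ) * Complex.exp ζ := by
    rw [← Complex.exp_add]; congr 1; rw [hζ]; ring
  have him : (2 * w.im * (γ 1 0 : ℂ)) * Complex.I = j - J := by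
    rw [hJd, Complex.sub_conj]
    have : j.im = γ 1 0 * w.im := by rw [hjd]; simp [den]
    rw [this]; push_cast; ring
  have hζ' : ζ * (j * J) = 4 * Real.pi * m * w.im := by
    have h2 : (starRingEnd ℂ) μ - μ = -(2 * (w.im / (j * J) : ℂ) * Complex.I) := by
      have h3 := Complex.sub_conj μ
      have h4 : ((μ.im : ℝ) : ℂ) = w.im / (j * J) := by
        rw [hμ, mob_im γ hw, hJd, Complex.mul_conj, Complex.normSq_eq_norm_sq]
        push_cast; rfl
      push_cast at h3
      rw [← h4]; linear_combination -h3
    rw [hζ, h2]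
    field_simp
    linear_combination (-4 * m * w.im) * Complex.I_sq
  have p1 : J ^ (-((1 - k : ℝ) : ℂ)) = J ^ ((k : ℂ) - 2) * J := by
    nth_rewrite 3 [← Complex.cpow_one J]
    rw [← Complex.cpow_add _ _ hJ]
    congr 1; push_cast; ring
  have p2 : J ^ (-((1 - k + 1 : ℝ) : ℂ)) = J ^ ((k : ℂ) - 2) := by
    congr 1; push_cast; ring
  have p3 : J ^ (-((1 - k + 2 : ℝ) : ℂ)) = J ^ ((k : ℂ) - 2) * J⁻¹ := by
    rw [← Complex.cpow_neg_one, ← Complex.cpow_add _ _ hJ]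
    congr 1; push_cast; ring
  rw [kernelTermDzbar, kernelTerm, kernelTerm, kernelTerm, ← hμ, ← hjd, ← hJd, ← hζ, ← hE, ← hE',
    p1, p2, p3, hexp]
  simp only [pow_zero, zero_add, pow_one, one_mul]
  push_cast
  set X := J ^ ((k : ℂ) - 2)
  set e0 := Complex.exp (2 * Real.pi * Complex.I * m * μ)
  field_simp
  linear_combination X * e0 * (-Complex.I * E' * hζ' + Complex.I * j * J * h1 +
    Complex.I * (1 - k) * J * E * him -
    2 * w.im * (γ 1 0 : ℂ) * (1 - k) * J * E * Complex.I_mul_I)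

/-- The holomorphic function whose conjugate is the antiholomorphic derivative of the Poincaré
series, up to a power of `y`. -/
def shadowSum (m : ℤ) (k : ℝ) (N : ℕ) (w : ℂ) : ℂ :=
  ∑' g : Cosets N, (starRingEnd ℂ) (chi k N g) * (den (rep g).1 w ^ ((k : ℂ) - 2) *
    Complex.exp (-(2 * Real.pi * Complex.I * m * mob (rep g).1 w)))

lemma norm_shadowTerm_le {k : ℝ} {N : ℕ} (hk : IsAdmissible k N) (m : ℤ) (g : Cosets N) {w : ℂ}
    (hw : 0 < w.im) :
    ‖(starRingEnd ℂ) (chi k N g) * (den (rep g).1 w ^ ((k : ℂ) - 2) *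
      Complex.exp (-(2 * Real.pi * Complex.I * m * mob (rep g).1 w)))‖ ≤
    ‖den (rep g).1 w‖ ^ (-(2 - k)) *
      Real.exp (2 * Real.pi * |(m : ℝ)| * (mob (rep g).1 w).im) := by
  have hμ : 0 ≤ (mob (rep g).1 w).im := by rw [mob_im _ hw]; positivity
  rw [norm_mul, Complex.norm_conj, norm_mul,
    show (k : ℂ) - 2 = ((-(2 - k) : ℝ) : ℂ) by push_cast; ring, Complex.norm_cpow_real,
    Complex.norm_exp]
  refine (mul_le_of_le_one_left (by positivity) (norm_chi hk g)).trans ?_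
  refine mul_le_mul_of_nonneg_left (Real.exp_le_exp.mpr ?_) (by positivity)
  have : (-(2 * Real.pi * Complex.I * m * mob (rep g).1 w)).re =
      2 * Real.pi * (m * (mob (rep g).1 w).im) := by simp; ring
  rw [this, mul_assoc (2 * Real.pi)]
  exact mul_le_mul_of_nonneg_left (mul_le_mul_of_nonneg_right (le_abs_self _) hμ)
    (by positivity)

lemma differentiableOn_shadowSum {k : ℝ} {N : ℕ} (hk : IsAdmissible k N) (hk0 : k < 0) (m : ℤ) :
    DifferentiableOn ℂ (shadowSum m k N) upperHalf := by
  intro w hw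
  have hw0 : 0 < w.im := hw
  have hB : 0 < w.im / 2 := by linarith
  obtain ⟨C, hC, h⟩ := exists_summand_bound (A := |w.re| + 1) (Y := w.im + 1) (a := 2 - k)
    (M := 2 * Real.pi * |(m : ℝ)|) hB (by linarith) (by positivity)
  have hmem := mem_box_of_im_pos hw0
  refine (DifferentiableOn.differentiableAt (s := box (|w.re| + 1) (w.im / 2) (w.im + 1)) ?_
    ((isOpen_box _ _ _).mem_nhds hmem)).differentiableWithinAt
  refine Complex.differentiableOn_tsum_of_summable_norm
    (u := fun g : Cosets N => C * ‖row (rep g).1‖ ^ (-(2 - k)))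
    ((summable_norm_row (row_rep_injective N) (by linarith)).mul_left C)
    (fun g z hz => ?_) (isOpen_box _ _ _) fun g z hz => ?_
  · have hz0 : 0 < z.im := hB.trans hz.2.1
    have h1 := (hasDerivAt_den (rep g).1 z).differentiableAt.cpow_const (c := (k : ℂ) - 2)
      ((isNormalized_rep g).den_mem_slitPlane hz0)
    have h2 := (((hasDerivAt_mob (rep g).1 hz0).differentiableAt.const_mul
      (2 * Real.pi * Complex.I * m)).neg).cexp
    exact ((h1.mul h2).const_mul _).differentiableWithinAt
  · exact (norm_shadowTerm_le hk m g (hB.trans hz.2.1)).trans (h _ _ hz)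

/-- The Poincaré series as a function on the complex plane. -/
def poincareFun (m : ℤ) (k : ℝ) (N : ℕ) (w : ℂ) : ℂ :=
  amplitude m k * (((w.im ^ (1 - k) : ℝ) : ℂ) * cosetSum m k N w)

lemma poincare_eq_poincareFun {k : ℝ} {N : ℕ} (hk : IsAdmissible k N) (hk0 : k < 0) (m : ℤ)
    (z : ℍ) : poincare m k N z (1 - k / 2) = poincareFun m k N z := by
  rw [poincare_eq hk hk0, poincareFun, mul_assoc]; rfl

lemma contDiffOn_poincareFun {k : ℝ} {N : ℕ} (hk : IsAdmissible k N) (hk0 : k < 0) (m : ℤ)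
    (n : ℕ) : ContDiffOn ℝ n (poincareFun m k N) upperHalf := by
  refine contDiffOn_const.mul (ContDiffOn.mul ?_ ?_)
  · refine Complex.ofRealCLM.contDiff.comp_contDiffOn ?_
    exact ContDiffOn.rpow_const_of_ne Complex.imCLM.contDiff.contDiffOn fun w hw => ne_of_gt hw
  · exact contDiffOn_kernelSum (row_rep_injective N) isNormalized_rep (norm_chi hk) n
      (continuous_kappa hk0) (weight_condition hk0)

/-- The identity `kernelTerm_dzbar_identity` summed over the cosets. The holomorphic derivative is
left unspecified, since `ξ_k` and `Δ_k` only need `∂/∂z̄` and its derivatives. -/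
lemma hasWirtingerAt_poincareFun {k : ℝ} {N : ℕ} (hk : IsAdmissible k N) (hk0 : k < 0) (m : ℤ)
    {w : ℂ} (hw : 0 < w.im) : ∃ A, HasWirtingerAt (poincareFun m k N) A
      (amplitude m k * (Complex.I / 2 * (1 - k) * ((w.im ^ (-k) : ℝ) : ℂ) *
        (starRingEnd ℂ) (shadowSum m k N w))) w := by
  have hinj := row_rep_injective N
  have hχ := norm_chi (k := k) (N := N) hk
  have hκ := continuous_kappa hk0
  have hκ' : Continuous fun u => u * kappa k u := by fun_prop
  have h1 := hasWirtingerAt_kernelSum (m := m) hinj isNormalized_rep hχ hκ (weight_condition hk0) hw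
  have h2 := ((hasDerivAt_const w (amplitude m k : ℂ)).hasWirtingerAt).mul
    ((hasWirtingerAt_im_rpow (1 - k) hw).mul h1)
  refine ⟨_, h2.congr rfl ?_⟩
  have hy : w.im ^ (1 - k) = w.im * w.im ^ (-k) := by
    rw [sub_eq_add_neg, Real.rpow_add hw, Real.rpow_one]
  have hy' : w.im ^ (1 - k - 1) = w.im ^ (-k) := by congr 1; ring
  have s0 := (summable_kernelTerm (m := m) hinj hχ hκ (weight_condition hk0) hw).hasSum
  have s1 := (summable_kernelTerm (m := m) hinj hχ hκ (r := 0 + 1) (p := 1) (q := 1 - k + 1)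
    (by push_cast; linarith) hw).hasSum
  have s2 := (summable_kernelTerm (m := m) hinj hχ hκ' (r := 0) (p := 1) (q := 1 - k + 2)
    (by push_cast; linarith) hw).hasSum
  have s3 := ((s0.mul_left (Complex.I * (1 - k))).add
    (((s1.mul_left (-((1 - k : ℝ) : ℂ))).add
      (s2.mul_left (2 * Real.pi * Complex.I * m))).mul_left (2 * (w.im : ℂ)))).tsum_eq
  have s4 : Complex.I * (1 - k) * (starRingEnd ℂ) (shadowSum m k N w) =
      ∑' g : Cosets N, (Complex.I * (1 - k) *
        (chi k N g * kernelTerm m (rep g).1 0 1 (1 - k) (kappa k) w) + 2 * w.im *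
        (-((1 - k : ℝ) : ℂ) * (chi k N g * kernelTerm m (rep g).1 (0 + 1) 1 (1 - k + 1) (kappa k) w) +
        2 * Real.pi * Complex.I * m *
        (chi k N g * kernelTerm m (rep g).1 0 1 (1 - k + 2) (fun u => u * kappa k u) w))) := by
    rw [shadowSum, Complex.conj_tsum, ← tsum_mul_left]
    refine tsum_congr fun g => ?_
    have hd := (isNormalized_rep g).den_mem_slitPlane hw
    have e1 : (starRingEnd ℂ) (den (rep g).1 w ^ ((k : ℂ) - 2)) =
        (starRingEnd ℂ) (den (rep g).1 w) ^ ((k : ℂ) - 2) := by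
      rw [show (k : ℂ) - 2 = ((k - 2 : ℝ) : ℂ) by push_cast; ring, conj_cpow_ofReal hd]
    have e2 : (starRingEnd ℂ) (Complex.exp (-(2 * Real.pi * Complex.I * m * mob (rep g).1 w))) =
        Complex.exp (2 * Real.pi * Complex.I * m * (starRingEnd ℂ) (mob (rep g).1 w)) := by
      rw [← Complex.exp_conj]; congr 1
      simp only [map_neg, map_mul, Complex.conj_ofReal, Complex.conj_I, map_ofNat, map_intCast]
      ring
    rw [map_mul, map_mul, Complex.conj_conj, e1, e2]
    have := kernelTerm_dzbar_identity hk0 m (rep g).1 hw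
    rw [kernelTermDzbar] at this
    linear_combination -chi k N g * this
  rw [s3] at s4
  rw [hy, hy', kernelSum, kernelSum, kernelSum]
  push_cast at s4 ⊢
  linear_combination -(amplitude m k : ℂ) * ((w.im ^ (-k) : ℝ) : ℂ) / 2 * s4

lemma xi_poincare {k : ℝ} {N : ℕ} (hk : IsAdmissible k N) (hk0 : k < 0) (m : ℤ) (z : ℍ) :
    xi k (fun z : ℍ => poincare m k N z (1 - k / 2)) z =
      amplitude m k * (1 - k) * shadowSum m k N z := by
  obtain ⟨A, hA⟩ := hasWirtingerAt_poincareFun hk hk0 m z.im_pos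
  have hy : z.im ^ k * z.im ^ (-k) = 1 := by
    rw [← Real.rpow_add z.im_pos, add_neg_cancel, Real.rpow_zero]
  have hyc : ((z.im ^ k : ℝ) : ℂ) * ((z.im ^ (-k) : ℝ) : ℂ) = 1 := by exact_mod_cast hy
  rw [xi, dx_add_I_mul_dy (poincare_eq_poincareFun hk hk0 m) hA]
  simp only [map_mul, map_div₀, Complex.conj_ofReal, Complex.conj_I, map_sub, map_one,
    Complex.conj_conj, map_ofNat, UpperHalfPlane.coe_im]
  linear_combination (amplitude m k : ℂ) * (1 - k) * shadowSum m k N z *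
    (-Complex.I_mul_I * ((z.im ^ k : ℝ) : ℂ) * ((z.im ^ (-k) : ℝ) : ℂ) + hyc)

/-- `(∂_x + i∂_y)F` is a multiple of `y^{-k} Ḡ` with `G` holomorphic. Hence `∂/∂z` only
differentiates `y^{-k}`, and what it yields is cancelled by the first order part of `Δ_k`. -/
lemma laplacian_poincare {k : ℝ} {N : ℕ} (hk : IsAdmissible k N) (hk0 : k < 0) (m : ℤ) (z : ℍ) :
    laplacian k (fun z : ℍ => poincare m k N z (1 - k / 2)) z = 0 := by
  set c : ℂ := amplitude m k * (Complex.I * (1 - k)) with hc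
  have hU : ∀ z : ℍ, dx (fun z : ℍ => poincare m k N z (1 - k / 2)) z +
      Complex.I * dy (fun z : ℍ => poincare m k N z (1 - k / 2)) z =
      (fun w : ℂ => c * (((w.im ^ (-k) : ℝ) : ℂ) * (starRingEnd ℂ) (shadowSum m k N w))) z := by
    intro z
    obtain ⟨A, hA⟩ := hasWirtingerAt_poincareFun hk hk0 m z.im_pos
    rw [dx_add_I_mul_dy (poincare_eq_poincareFun hk hk0 m) hA, hc]
    ring
  have hG := ((differentiableOn_shadowSum hk hk0 m).differentiableAt
    (isOpen_upperHalf.mem_nhds (show (z : ℂ) ∈ upperHalf from z.im_pos))).hasDerivAt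
  have hUz := ((hasDerivAt_const (z : ℂ) c).hasWirtingerAt).mul
    ((hasWirtingerAt_im_rpow (-k) (w := (z : ℂ)) z.im_pos).mul hG.hasWirtingerAt.conj)
  have h2 := dx_dx_add_dy_dy (poincare_eq_poincareFun hk hk0 m)
    (by exact_mod_cast contDiffOn_poincareFun hk hk0 m 2) hU hUz
  rw [laplacian, h2, hU]
  have hy : z.im ^ (-k) = z.im * z.im ^ (-k - 1) := by
    rw [Real.rpow_sub_one z.im_pos.ne', mul_div_cancel₀ _ z.im_pos.ne']
  simp only [map_zero, mul_zero, zero_mul, add_zero, UpperHalfPlane.coe_im]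
  rw [hy]
  push_cast
  ring

lemma isSmooth_poincare {k : ℝ} {N : ℕ} (hk : IsAdmissible k N) (hk0 : k < 0) (m : ℤ) :
    IsSmooth (fun z : ℍ => poincare m k N z (1 - k / 2)) := by
  refine ContDiffOn.congr ?_ (ofComplex_comp_eqOn (poincare_eq_poincareFun hk hk0 m))
  exact contDiffOn_infty.mpr (contDiffOn_poincareFun hk hk0 m)

lemma isInvariant_poincare {k : ℝ} {N : ℕ} (hk : IsAdmissible k N) (m : ℤ) (s : ℂ) :
    IsInvariant k N (fun z : ℍ => poincare m k N z s) := by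
  have : (fun z : ℍ => poincare m k N z s) = poincareSum k N (phi m k s) :=
    funext fun z => poincare_eq_poincareSum hk m s z
  rw [this]
  exact isInvariant_poincareSum hk (isPeriodic_phi _ _ _)

lemma shadowSum_eq_poincareSum {k : ℝ} {N : ℕ} (hk : IsAdmissible k N) (m : ℤ) (z : ℍ) :
    shadowSum m k N z = poincareSum (2 - k) N (fun z : ℍ => e ((-m : ℤ) * z)) z := by
  refine tsum_congr fun g => ?_
  rw [slash_eq, autFactor_eq hk.two_sub, chi, multiplier_conj hk (isCoprime_row _), e,
    ← mob_coe, ← den_coe]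
  have h1 : -((2 - k : ℝ) : ℂ) = k - 2 := by push_cast; ring
  have h2 : 2 * Real.pi * Complex.I * (((-m : ℤ) : ℂ) * mob (rep g).1 z) =
      -(2 * Real.pi * Complex.I * m * mob (rep g).1 z) := by push_cast; ring
  rw [h1, h2, mul_assoc (multiplier _ _ _)]

/-! ### Growth at the cusps -/

/-- A translation `T^n` moves `z` to the strip `|x| ≤ 1` and is absorbed into `α`. The rows of `rep
g · α T^n` are distinct, so the full lattice sum is a bound independent of `α` and `z`. -/
lemma exists_sum_cocycle_le (N : ℕ) {a : ℝ} (ha : 2 < a) :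
    ∃ C : ℝ, ∀ (α : SL(2, ℤ)) (z : ℍ), 1 ≤ z.im →
      Summable (fun g : Cosets N => ‖cocycle ((rep g).1 * α) z‖ ^ (-a)) ∧
      ∑' g : Cosets N, ‖cocycle ((rep g).1 * α) z‖ ^ (-a) ≤ C := by
  obtain ⟨C, hC, h⟩ := norm_den_rpow_le (A := 1) (B := 1) (a := a) one_pos (by linarith)
  have hs := EisensteinSeries.summable_one_div_norm_rpow ha
  refine ⟨C * ∑' v : Fin 2 → ℤ, ‖v‖ ^ (-a), fun α z hz => ?_⟩
  set n := ⌊z.re⌋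
  have hinj : Function.Injective fun g : Cosets N =>
      row ((rep g).1 * (α * ModularGroup.T ^ n)) := rep_row_mul_injective _
  have hw : ∀ g : Cosets N, ‖cocycle ((rep g).1 * α) z‖ ^ (-a) ≤
      C * ‖row ((rep g).1 * (α * ModularGroup.T ^ n))‖ ^ (-a) := fun g => by
    have h1 : cocycle ((rep g).1 * α) z =
        den ((rep g).1 * (α * ModularGroup.T ^ n)) ((z : ℂ) - n) := by
      rw [← mul_assoc, den, (mul_T_zpow _ n).1, (mul_T_zpow _ n).2, cocycle]
      push_cast; ring
    rw [h1]
    refine h _ _ ?_ ?_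
    · simp only [Complex.sub_re, UpperHalfPlane.coe_re, Complex.intCast_re]
      rw [abs_of_nonneg (by linarith [Int.floor_le z.re])]
      linarith [Int.lt_floor_add_one z.re]
    · simpa using hz
  have hsum := (hs.comp_injective hinj).mul_left C
  have hsum' : Summable (fun g : Cosets N => ‖cocycle ((rep g).1 * α) z‖ ^ (-a)) :=
    Summable.of_nonneg_of_le (fun g => by positivity) hw hsum
  refine ⟨hsum', (hsum'.tsum_le_tsum hw hsum).trans ?_⟩
  rw [tsum_mul_left]
  refine mul_le_mul_of_nonneg_left ?_ hC
  exact tsum_comp_le_tsum_of_inj hs (fun v => by positivity) hinj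

lemma norm_slash {k : ℝ} {N : ℕ} (hk : IsAdmissible k N) (f : ℍ → ℂ) (γ : SL(2, ℤ)) (z : ℍ) :
    ‖slash k f γ z‖ = ‖cocycle γ z‖ ^ (-k) * ‖f (γ • z)‖ := by
  rw [slash_eq, autFactor_eq hk, norm_mul, norm_mul, norm_multiplier hk (isCoprime_row _), one_mul,
    show -(k : ℂ) = ((-k : ℝ) : ℂ) by push_cast; rfl, Complex.norm_cpow_real]

/-- Termwise bounds for a Poincaré series carry over to its growth at the cusps. -/
lemma absAtCusp_poincareSum_le {k : ℝ} {N : ℕ} (hk : IsAdmissible k N) {f : ℍ → ℂ} {a M : ℝ}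
    (α : SL(2, ℤ)) (z : ℍ)
    (hs : Summable (fun g : Cosets N => ‖cocycle ((rep g).1 * α) z‖ ^ (-a)))
    (hf : ∀ γ : SL(2, ℤ), ‖cocycle γ z‖ ^ (-k) * ‖f (γ • z)‖ ≤ M * ‖cocycle γ z‖ ^ (-a)) :
    absAtCusp k (poincareSum k N f) α z ≤
      M * ∑' g : Cosets N, ‖cocycle ((rep g).1 * α) z‖ ^ (-a) := by
  have hpos : 0 < ‖cocycle α z‖ ^ (-k) :=
    Real.rpow_pos_of_pos (norm_pos_iff.mpr (cocycle_ne_zero α z)) _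
  have h1 : ∀ g : Cosets N, ‖cocycle α z‖ ^ (-k) * ‖slash k f (rep g) (α • z)‖ ≤
      M * ‖cocycle ((rep g).1 * α) z‖ ^ (-a) := fun g => by
    refine le_trans (le_of_eq ?_) (hf ((rep g).1 * α))
    rw [norm_slash hk, cocycle_mul, norm_mul, Real.mul_rpow (norm_nonneg _) (norm_nonneg _),
      mul_smul]
    ring
  have h2 : Summable fun g : Cosets N => ‖cocycle α z‖ ^ (-k) * ‖slash k f (rep g) (α • z)‖ :=
    Summable.of_nonneg_of_le (fun g => by positivity) h1 (hs.mul_left M)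
  have h3 : Summable fun g : Cosets N => ‖slash k f (rep g) (α • z)‖ :=
    (summable_mul_left_iff hpos.ne').mp h2
  rw [absAtCusp, poincareSum]
  calc _ ≤ ‖cocycle α z‖ ^ (-k) * ∑' g : Cosets N, ‖slash k f (rep g) (α • z)‖ :=
        mul_le_mul_of_nonneg_left (norm_tsum_le_tsum_norm h3) hpos.le
    _ = ∑' g : Cosets N, ‖cocycle α z‖ ^ (-k) * ‖slash k f (rep g) (α • z)‖ := tsum_mul_left.symm
    _ ≤ _ := by
        rw [← tsum_mul_left]
        exact h2.tsum_le_tsum h1 (hs.mul_left M)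

lemma one_le_norm_cocycle (γ : SL(2, ℤ)) {z : ℍ} (hz : 1 ≤ z.im) : 1 ≤ ‖cocycle γ z‖ := by
  rcases eq_or_ne (γ 1 0) 0 with h | h
  · have hd := sl_det γ
    rw [h, mul_zero, sub_zero] at hd
    rcases Int.eq_one_or_neg_one_of_mul_eq_one' hd with ⟨_, h2⟩ | ⟨_, h2⟩ <;>
      simp [cocycle, h, h2]
  · have h1 := abs_row_mul_im_le γ z
    have h2 : (1 : ℝ) ≤ |(γ 1 0 : ℝ)| := by exact_mod_cast Int.one_le_abs h
    rw [abs_mul] at h1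
    have h3 : (1 : ℝ) ≤ |(z : ℂ).im| := hz.trans (le_abs_self _)
    calc (1 : ℝ) ≤ |(γ 1 0 : ℝ)| * |(z : ℂ).im| := one_le_mul_of_one_le_of_one_le h2 h3
      _ ≤ _ := h1

/-! ### Membership in the spaces of automorphic forms -/

lemma exists_norm_phi_le {k : ℝ} (hk0 : k < 0) (m : ℤ) : ∃ D : ℝ, 0 ≤ D ∧ ∀ z : ℍ,
    ‖phi m k (1 - k / 2) z‖ ≤
      D * (z.im ^ (1 - k) * Real.exp (2 * Real.pi * |(m : ℝ)| * z.im)) := by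
  obtain ⟨C, hC, h⟩ := norm_exp_mul_expInt_le (continuous_kappa hk0)
  refine ⟨‖(amplitude m k : ℂ)‖ * C, by positivity, fun z => ?_⟩
  have hy := z.im_pos
  have hm1 := le_abs_self (m : ℝ)
  have hm2 := neg_abs_le (m : ℝ)
  have hpy : 0 < 2 * Real.pi * z.im := by positivity
  have h1 := h (2 * Real.pi * Complex.I * m * z)
    (2 * Real.pi * Complex.I * m * ((starRingEnd ℂ) (z : ℂ) - z))
    (2 * Real.pi * |(m : ℝ)| * z.im) (by simp; nlinarith) (by simp; nlinarith)
  rw [phi_eq hk0, norm_mul, norm_mul, Complex.norm_of_nonneg (r := z.im ^ (1 - k)) (by positivity)]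
  calc _ ≤ ‖(amplitude m k : ℂ)‖ * z.im ^ (1 - k) *
        (C * Real.exp (2 * Real.pi * |(m : ℝ)| * z.im)) := by gcongr
    _ = _ := by ring

/-- For `y ≥ 1` all `|cz+d|` are at least 1, so `Im γz ≤ y` and the exponential in each term is at
most `e^{2π|m|y}`. The power `y^{1-k}` is absorbed by `e^{(1-k)y}`, and `|cz+d|^{-(2-k)}` remains
for summation. -/
lemma isBigO_absAtCusp_poincare {k : ℝ} {N : ℕ} (hk : IsAdmissible k N) (hk0 : k < 0) (m : ℤ)
    (α : SL(2, ℤ)) :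
    absAtCusp k (fun z : ℍ => poincare m k N z (1 - k / 2)) α =O[UpperHalfPlane.atImInfty]
      fun z : ℍ => Real.exp ((1 - k + 2 * Real.pi * |(m : ℝ)|) * z.im) := by
  have hF : (fun z : ℍ => poincare m k N z (1 - k / 2)) = poincareSum k N (phi m k (1 - k / 2)) :=
    funext fun z => poincare_eq_poincareSum hk m _ z
  obtain ⟨D, hD, hphi⟩ := exists_norm_phi_le hk0 m
  obtain ⟨S, hS⟩ := exists_sum_cocycle_le N (a := 2 - k) (by linarith)
  rw [hF]
  refine Asymptotics.IsBigO.of_bound (D * S) ?_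
  filter_upwards [(UpperHalfPlane.atImInfty_mem {z : ℍ | 1 ≤ z.im}).mpr ⟨1, fun z hz => hz⟩]
    with z hz
  replace hz : 1 ≤ z.im := hz
  have hy := z.im_pos
  obtain ⟨hs, hle⟩ := hS α z hz
  set M := D * Real.exp ((1 - k + 2 * Real.pi * |(m : ℝ)|) * z.im) with hM
  have key : ∀ γ : SL(2, ℤ), ‖cocycle γ z‖ ^ (-k) * ‖phi m k (1 - k / 2) (γ • z)‖ ≤
      M * ‖cocycle γ z‖ ^ (-(2 - k)) := fun γ => by
    have hj := one_le_norm_cocycle γ hz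
    have hj0 : 0 < ‖cocycle γ z‖ := by linarith
    set J := ‖cocycle γ z‖
    have e1 : (γ • z).im ^ (1 - k) = z.im ^ (1 - k) * J ^ (-(2 - 2 * k)) := by
      rw [im_smul, Real.div_rpow hy.le (by positivity), ← Real.rpow_natCast_mul hj0.le,
        Real.rpow_neg hj0.le, div_eq_mul_inv]
      congr 3; push_cast; ring
    have e2 : z.im ^ (1 - k) ≤ Real.exp ((1 - k) * z.im) := by
      rw [Real.rpow_def_of_pos hy]
      refine Real.exp_le_exp.mpr ?_
      have := Real.log_le_sub_one_of_pos hy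
      nlinarith
    have e3 : (γ • z).im ≤ z.im := by
      rw [im_smul]; exact div_le_self hy.le (one_le_pow₀ hj)
    have e4 : J ^ (-k) * J ^ (-(2 - 2 * k)) = J ^ (-(2 - k)) := by
      rw [← Real.rpow_add hj0]; congr 1; ring
    calc _ ≤ J ^ (-k) * (D * ((γ • z).im ^ (1 - k) *
          Real.exp (2 * Real.pi * |(m : ℝ)| * (γ • z).im))) := by
          gcongr; exact hphi _
      _ ≤ J ^ (-k) * (D * ((Real.exp ((1 - k) * z.im) * J ^ (-(2 - 2 * k))) *
          Real.exp (2 * Real.pi * |(m : ℝ)| * z.im))) := by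
          rw [e1]; gcongr
      _ = M * J ^ (-(2 - k)) := by
          rw [hM, add_mul, Real.exp_add, ← e4]; ring
  refine (Real.norm_of_nonneg (by rw [absAtCusp]; positivity)).le.trans
    ((absAtCusp_poincareSum_le hk α z hs key).trans ?_)
  rw [Real.norm_of_nonneg (Real.exp_nonneg _)]
  calc _ ≤ M * S := mul_le_mul_of_nonneg_left hle (by positivity)
    _ = _ := by rw [hM]; ring

lemma poincare_mem_harmonicWeakMaassForms {k : ℝ} {N : ℕ} (hk : IsAdmissible k N) (hk0 : k < 0)
    (m : ℤ) :
    (fun z : ℍ => poincare m k N z (1 - k / 2)) ∈ harmonicWeakMaassForms k N :=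
  ⟨isSmooth_poincare hk hk0 m, isInvariant_poincare hk m _, laplacian_poincare hk hk0 m,
    fun α => ⟨_, isBigO_absAtCusp_poincare hk hk0 m α⟩⟩

lemma xi_poincare_eq {k : ℝ} {N : ℕ} (hk : IsAdmissible k N) (hk0 : k < 0) (m : ℤ) :
    xi k (fun z : ℍ => poincare m k N z (1 - k / 2)) = fun z =>
      (amplitude m k * (1 - k) : ℂ) *
        poincareSum (2 - k) N (fun z : ℍ => e ((-m : ℤ) * z)) z := by
  funext z
  rw [xi_poincare hk hk0, shadowSum_eq_poincareSum hk]

lemma isHolomorphic_xi_poincare {k : ℝ} {N : ℕ} (hk : IsAdmissible k N) (hk0 : k < 0) (m : ℤ) :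
    IsHolomorphic (xi k (fun z : ℍ => poincare m k N z (1 - k / 2))) :=
  ((differentiableOn_shadowSum hk hk0 m).const_mul (amplitude m k * (1 - k) : ℂ)).congr
    (ofComplex_comp_eqOn (xi_poincare hk hk0 m))

lemma isInvariant_xi_poincare {k : ℝ} {N : ℕ} (hk : IsAdmissible k N) (hk0 : k < 0) (m : ℤ) :
    IsInvariant (2 - k) N (xi k (fun z : ℍ => poincare m k N z (1 - k / 2))) := by
  intro γ hγ
  rw [xi_poincare_eq hk hk0]
  have h := isInvariant_poincareSum hk.two_sub (isPeriodic_e (-m)) γ hγ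
  funext z
  have hz := congrFun h z
  rw [slash_eq] at hz ⊢
  rw [mul_left_comm, hz]

lemma norm_e (m : ℤ) (z : ℍ) : ‖e (m * z)‖ = Real.exp (-(2 * Real.pi * m * z.im)) := by
  rw [e, Complex.norm_exp]
  congr 1; simp; ring

lemma absAtCusp_const_mul (k : ℝ) (c : ℂ) (f : ℍ → ℂ) (α : SL(2, ℤ)) (z : ℍ) :
    absAtCusp k (fun z => c * f z) α z = ‖c‖ * absAtCusp k f α z := by
  rw [absAtCusp, absAtCusp, norm_mul]; ring

lemma isBoundedAtImInfty_xi_poincare {k : ℝ} {N : ℕ} (hk : IsAdmissible k N) (hk0 : k < 0)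
    {m : ℤ} (hm : m ≤ 0) (α : SL(2, ℤ)) :
    UpperHalfPlane.IsBoundedAtImInfty
      (absAtCusp (2 - k) (xi k (fun z : ℍ => poincare m k N z (1 - k / 2))) α) := by
  obtain ⟨S, hS⟩ := exists_sum_cocycle_le N (a := 2 - k) (by linarith)
  rw [xi_poincare_eq hk hk0, UpperHalfPlane.isBoundedAtImInfty_iff]
  set A : ℂ := amplitude m k * (1 - k)
  refine ⟨‖A‖ * S, 1, fun z hz => ?_⟩
  obtain ⟨hs, hle⟩ := hS α z hz
  rw [Real.norm_of_nonneg (by rw [absAtCusp]; positivity), absAtCusp_const_mul]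
  refine mul_le_mul_of_nonneg_left ?_ (norm_nonneg _)
  refine (absAtCusp_poincareSum_le (M := 1) hk.two_sub α z hs fun γ => ?_).trans
    (by rwa [one_mul])
  rw [norm_e, mul_comm]
  refine mul_le_mul_of_nonneg_right ?_ (by positivity)
  rw [Real.exp_le_one_iff, neg_nonpos]
  have := (γ • z).im_pos
  have : (0 : ℝ) ≤ ((-m : ℤ) : ℝ) := by exact_mod_cast neg_nonneg.mpr hm
  positivity

lemma rpow_le_mul_exp {δ t : ℝ} (hδ : 0 < δ) (ht : 0 < t) : t ^ δ ≤ δ ^ δ * Real.exp t := by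
  rw [Real.rpow_def_of_pos ht, Real.rpow_def_of_pos hδ, ← Real.exp_add]
  refine Real.exp_le_exp.mpr ?_
  have h := Real.log_le_sub_one_of_pos (div_pos ht hδ)
  rw [Real.log_div ht.ne' hδ.ne'] at h
  have h2 : δ * (t / δ) = t := by field_simp
  nlinarith

/-- Since `-m ≥ 1`, the terms contain `e^{-t}` with `t = Im γz = y/|cz+d|²`, and `e^{-t} ≤ δ^δ
t^{-δ}` yields `y^{-δ}` at the cost of `|cz+d|^{2δ}`. The lattice sum still converges if `2δ < -k`.
-/
lemma isZeroAtImInfty_xi_poincare {k : ℝ} {N : ℕ} (hk : IsAdmissible k N) (hk0 : k < 0)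
    {m : ℤ} (hm : m < 0) (α : SL(2, ℤ)) :
    UpperHalfPlane.IsZeroAtImInfty
      (absAtCusp (2 - k) (xi k (fun z : ℍ => poincare m k N z (1 - k / 2))) α) := by
  obtain ⟨S, hS⟩ := exists_sum_cocycle_le N (a := 2 - k / 2) (by linarith)
  rw [xi_poincare_eq hk hk0]
  set A : ℂ := amplitude m k * (1 - k)
  -- With this choice `-(2-k) + 2δ = -(2 - k/2)`, so the remaining exponent is still above 2.
  set δ : ℝ := -k / 4 with hδ
  have hδ0 : 0 < δ := by rw [hδ]; linarith
  have hlim : Filter.Tendsto (fun z : ℍ => ‖A‖ * (δ ^ δ * z.im ^ (-δ) * S))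
      UpperHalfPlane.atImInfty (nhds 0) := by
    have h0 : Filter.Tendsto (fun z : ℍ => z.im ^ (-δ)) UpperHalfPlane.atImInfty (nhds 0) :=
      (tendsto_rpow_neg_atTop hδ0).comp Filter.tendsto_comap
    simpa using ((h0.const_mul (δ ^ δ)).mul_const S).const_mul ‖A‖
  refine squeeze_zero' (Filter.Eventually.of_forall fun z => by rw [absAtCusp]; positivity) ?_ hlim
  filter_upwards [(UpperHalfPlane.atImInfty_mem {z : ℍ | 1 ≤ z.im}).mpr ⟨1, fun z hz => hz⟩]
    with z hz
  replace hz : 1 ≤ z.im := hz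
  have hy := z.im_pos
  obtain ⟨hs, hle⟩ := hS α z hz
  rw [absAtCusp_const_mul]
  refine mul_le_mul_of_nonneg_left ?_ (norm_nonneg _)
  refine (absAtCusp_poincareSum_le (M := δ ^ δ * z.im ^ (-δ)) hk.two_sub α z hs fun γ => ?_).trans
    (mul_le_mul_of_nonneg_left hle (by positivity))
  have hj0 : 0 < ‖cocycle γ z‖ := norm_pos_iff.mpr (cocycle_ne_zero γ z)
  set J := ‖cocycle γ z‖
  set t := (γ • z).im with ht
  have ht0 : 0 < t := (γ • z).im_pos
  have e1 : ‖e (((-m : ℤ) : ℂ) * ((γ • z : ℍ) : ℂ))‖ ≤ Real.exp (-t) := by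
    rw [norm_e]
    refine Real.exp_le_exp.mpr (neg_le_neg ?_)
    have h1 : (1 : ℝ) ≤ ((-m : ℤ) : ℝ) := by exact_mod_cast (by omega : 1 ≤ -m)
    have h2 := Real.pi_gt_three
    refine le_mul_of_one_le_left ht0.le ?_
    nlinarith
  have e2 : Real.exp (-t) ≤ δ ^ δ * t ^ (-δ) := by
    rw [Real.exp_neg, Real.rpow_neg ht0.le, inv_le_comm₀ (Real.exp_pos _) (by positivity), mul_inv,
      inv_inv, inv_mul_le_iff₀ (by positivity)]
    exact rpow_le_mul_exp hδ0 ht0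
  have e3 : t ^ (-δ) = z.im ^ (-δ) * J ^ (2 * δ) := by
    rw [ht, im_smul, Real.div_rpow hy.le (by positivity), ← Real.rpow_natCast_mul hj0.le,
      div_eq_mul_inv, ← Real.rpow_neg hj0.le]
    congr 2; push_cast; ring
  have e4 : J ^ (-(2 - k)) * J ^ (2 * δ) = J ^ (-(2 - k / 2)) := by
    rw [← Real.rpow_add hj0]; congr 1; rw [hδ]; ring
  calc _ ≤ J ^ (-(2 - k)) * (δ ^ δ * t ^ (-δ)) := by
        gcongr; exact e1.trans e2
    _ = _ := by rw [e3, ← e4]; ring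

/-! ### Integrals of Gamma type -/

lemma norm_cpow_mul_cexp (a : ℝ) (r : ℂ) {t : ℝ} (ht : 0 < t) :
    ‖(t : ℂ) ^ (a : ℂ) * Complex.exp (-(r * t))‖ = t ^ a * Real.exp (-r.re * t) := by
  rw [norm_mul, Complex.norm_cpow_eq_rpow_re_of_pos ht, Complex.norm_exp]
  simp

lemma aestronglyMeasurable_cpow_mul_cexp (a : ℝ) (r : ℂ) :
    MeasureTheory.AEStronglyMeasurable (fun t : ℝ => (t : ℂ) ^ (a : ℂ) * Complex.exp (-(r * t)))
      (MeasureTheory.volume.restrict (Set.Ioi 0)) := by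
  refine ContinuousOn.aestronglyMeasurable (fun t ht => ?_) measurableSet_Ioi
  refine ((Complex.continuousAt_ofReal_cpow_const _ _ (Or.inr (ne_of_gt ht))).mul
    (by fun_prop)).continuousWithinAt

lemma integrableOn_cpow_mul_cexp {a : ℝ} (ha : -1 < a) {r : ℂ} (hr : 0 < r.re) :
    MeasureTheory.IntegrableOn (fun t : ℝ => (t : ℂ) ^ (a : ℂ) * Complex.exp (-(r * t)))
      (Set.Ioi 0) := by
  have h := integrableOn_rpow_mul_exp_neg_mul_rpow ha one_pos hr
  refine MeasureTheory.Integrable.mono' h (aestronglyMeasurable_cpow_mul_cexp a r) ?_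
  filter_upwards [MeasureTheory.ae_restrict_mem measurableSet_Ioi] with t ht
  rw [norm_cpow_mul_cexp a r ht, Real.rpow_one]

lemma hasDerivAt_integral_cpow_mul_cexp {a : ℝ} (ha : -1 < a) {r : ℂ} (hr : 0 < r.re) :
    HasDerivAt (fun r : ℂ => ∫ t in Set.Ioi (0 : ℝ), (t : ℂ) ^ (a : ℂ) * Complex.exp (-(r * t)))
      (∫ t in Set.Ioi (0 : ℝ), (-t : ℂ) * ((t : ℂ) ^ (a : ℂ) * Complex.exp (-(r * t)))) r := by
  have hs : {w : ℂ | r.re / 2 < w.re} ∈ nhds r :=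
    (isOpen_lt continuous_const Complex.continuous_re).mem_nhds (by simp; linarith)
  refine (hasDerivAt_integral_of_dominated_loc_of_deriv_le
    (F' := fun r t => (-t : ℂ) * ((t : ℂ) ^ (a : ℂ) * Complex.exp (-(r * t))))
    (bound := fun t => t ^ (a + 1) * Real.exp (-(r.re / 2) * t ^ (1 : ℝ))) hs
    (Filter.Eventually.of_forall fun w => aestronglyMeasurable_cpow_mul_cexp a w)
    (integrableOn_cpow_mul_cexp ha hr)
    (MeasureTheory.AEStronglyMeasurable.mul
      (show Continuous fun t : ℝ => (-t : ℂ) by fun_prop).aestronglyMeasurable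
      (aestronglyMeasurable_cpow_mul_cexp a r)) ?_
    (integrableOn_rpow_mul_exp_neg_mul_rpow (by linarith) one_pos (by linarith)) ?_).2
  · filter_upwards [MeasureTheory.ae_restrict_mem measurableSet_Ioi] with t ht w hw
    have ht' : 0 < t := ht
    have hw' : r.re / 2 < w.re := hw
    rw [norm_mul, norm_cpow_mul_cexp a w ht, norm_neg, Complex.norm_of_nonneg ht'.le, ← mul_assoc,
      mul_comm t, ← Real.rpow_add_one ht'.ne', Real.rpow_one]
    gcongr
  · filter_upwards with t w _
    have h1 : HasDerivAt (fun w : ℂ => -(w * t)) (-(1 * t)) w :=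
      ((hasDerivAt_id w).mul_const (t : ℂ)).neg
    exact (h1.cexp.const_mul ((t : ℂ) ^ (a : ℂ))).congr_deriv (by ring)

/-- The Gamma integral with a complex rate. -/
lemma integral_cpow_mul_cexp {a : ℝ} (ha : 0 < a) {r : ℂ} (hr : 0 < r.re) :
    ∫ t in Set.Ioi (0 : ℝ), (t : ℂ) ^ ((a - 1 : ℝ) : ℂ) * Complex.exp (-(r * t)) =
      r ^ (-(a : ℂ)) * Complex.Gamma a := by
  set U : Set ℂ := {w : ℂ | 0 < w.re}
  have hU : IsOpen U := isOpen_lt continuous_const Complex.continuous_re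
  have hf : AnalyticOnNhd ℂ (fun r : ℂ => ∫ t in Set.Ioi (0 : ℝ),
      (t : ℂ) ^ ((a - 1 : ℝ) : ℂ) * Complex.exp (-(r * t))) U :=
    DifferentiableOn.analyticOnNhd (fun w hw =>
      (hasDerivAt_integral_cpow_mul_cexp (by linarith) hw).differentiableAt.differentiableWithinAt)
      hU
  have hg : AnalyticOnNhd ℂ (fun r : ℂ => r ^ (-(a : ℂ)) * Complex.Gamma a) U :=
    DifferentiableOn.analyticOnNhd (fun w hw => ((differentiableAt_id.cpow_const
      (Or.inl hw)).mul_const _).differentiableWithinAt) hU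
  -- Identity theorem on the right half plane: both sides agree for real rates, which accumulate at
  -- 1.
  refine hf.eqOn_of_preconnected_of_frequently_eq hg
    (convex_halfSpace_re_gt 0).isPreconnected (z₀ := 1) (by simp [U]) ?_ hr
  have hreal : ∀ s : ℝ, 0 < s → ∫ t in Set.Ioi (0 : ℝ),
      (t : ℂ) ^ ((a - 1 : ℝ) : ℂ) * Complex.exp (-((s : ℂ) * t)) =
      (s : ℂ) ^ (-(a : ℂ)) * Complex.Gamma a := fun s hs => by
    have h := Complex.integral_cpow_mul_exp_neg_mul_Ioi (a := a) (by simpa using ha) hs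
    rw [one_div, Complex.inv_cpow _ _ (by rw [Complex.arg_ofReal_of_nonneg hs.le]; exact
      Real.pi_pos.ne), ← Complex.cpow_neg] at h
    rw [← h]; push_cast; rfl
  have ht : Filter.Tendsto (fun n : ℕ => ((1 + 1 / ((n : ℝ) + 1) : ℝ) : ℂ)) Filter.atTop
      (nhdsWithin 1 {1}ᶜ) := by
    refine tendsto_nhdsWithin_iff.mpr ⟨?_, Filter.Eventually.of_forall fun n => ?_⟩
    · have h0 : Filter.Tendsto (fun n : ℕ => (1 + 1 / ((n : ℝ) + 1) : ℝ)) Filter.atTop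
          (nhds (1 + 0)) := tendsto_one_div_add_atTop_nhds_zero_nat.const_add 1
      have := (Complex.continuous_ofReal.tendsto _).comp h0
      simpa [Function.comp_def] using this
    · have : (0 : ℝ) < 1 / ((n : ℝ) + 1) := by positivity
      simp only [Set.mem_compl_iff, Set.mem_singleton_iff]
      intro h
      have h' : (1 + 1 / ((n : ℝ) + 1) : ℝ) = 1 := by exact_mod_cast h
      linarith
  exact ht.frequently (Filter.Eventually.of_forall fun n => hreal _ (by positivity)).frequently

lemma hasDerivAt_incGamma {k : ℝ} (hk : k < 0) (x : ℝ) :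
    HasDerivAt (incGamma (1 - k)) (-(Complex.exp (-(x : ℂ)) * (x : ℂ) ^ (-(k : ℂ)))) x := by
  have h : incGamma (1 - k) = fun x => Complex.Gamma (1 - k) -
      ∫ t in (0 : ℝ)..x, Complex.exp (-(t : ℂ)) * (t : ℂ) ^ (((1 - k : ℝ) : ℂ) - 1) := by
    funext x; rw [← Gamma_sub_incGamma hk]; ring
  have hc := continuous_cexp_mul_cpow hk
  rw [h]
  have := (intervalIntegral.integral_hasDerivAt_right (hc.intervalIntegrable 0 x)
    (hc.stronglyMeasurableAtFilter _ _) hc.continuousAt).const_sub (Complex.Gamma (1 - k))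
  rwa [show ((1 - k : ℝ) : ℂ) - 1 = -(k : ℂ) by push_cast; ring] at this ⊢

/-- For `t > Y`, `e^{-t} ≤ e^{-3Y/4} e^{-t/4}`. Any rate above `1/2` would do, because for `ν < 0`
the function `profile` multiplies by `e^{Y/2}`, where `Y = -4πνy`. -/
lemma exists_norm_incGamma_le {k : ℝ} (hk : k < 0) : ∃ C : ℝ, 0 ≤ C ∧ ∀ Y : ℝ, 0 ≤ Y →
    ‖incGamma (1 - k) Y‖ ≤ C * Real.exp (-(3 / 4 * Y)) := by
  have h := integrableOn_rpow_mul_exp_neg_mul_rpow (s := -k) (by linarith) one_pos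
    (b := 1 / 4) (by norm_num)
  refine ⟨∫ t in Set.Ioi (0 : ℝ), t ^ (-k) * Real.exp (-(1 / 4) * t ^ (1 : ℝ)),
    MeasureTheory.setIntegral_nonneg measurableSet_Ioi fun t ht => ?_, fun Y hY => ?_⟩
  · have : 0 < t := ht
    positivity
  · have hsub : Set.Ioi Y ⊆ Set.Ioi 0 := Set.Ioi_subset_Ioi hY
    have h1 := (h.mono_set hsub).mul_const (Real.exp (-(3 / 4 * Y)))
    calc ‖incGamma (1 - k) Y‖ ≤ ∫ t in Set.Ioi Y,
          t ^ (-k) * Real.exp (-(1 / 4) * t ^ (1 : ℝ)) * Real.exp (-(3 / 4 * Y)) := by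
          refine MeasureTheory.norm_integral_le_of_norm_le h1 ?_
          filter_upwards [MeasureTheory.ae_restrict_mem measurableSet_Ioi] with t ht
          have ht' : Y < t := ht
          have ht0 : 0 < t := hY.trans_lt ht'
          have e1 := norm_cpow_mul_cexp (-k) 1 ht0
          have e2 : (((1 - k : ℝ) : ℂ) - 1) = ((-k : ℝ) : ℂ) := by push_cast; ring
          rw [mul_comm, e2, show -(t : ℂ) = -(1 * t) by ring, e1, mul_assoc, ← Real.exp_add,
            Real.rpow_one, Complex.one_re]
          refine mul_le_mul_of_nonneg_left (Real.exp_le_exp.mpr ?_) (by positivity)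
          linarith
      _ = (∫ t in Set.Ioi Y, t ^ (-k) * Real.exp (-(1 / 4) * t ^ (1 : ℝ))) *
          Real.exp (-(3 / 4 * Y)) := MeasureTheory.integral_mul_const _ _
      _ ≤ _ := by
          refine mul_le_mul_of_nonneg_right ?_ (Real.exp_nonneg _)
          refine MeasureTheory.setIntegral_mono_set h ?_ hsub.eventuallyLE
          filter_upwards [MeasureTheory.ae_restrict_mem measurableSet_Ioi] with t ht
          have : 0 < t := ht
          simp only [Pi.zero_apply]
          positivity

/-! ### The Fourier transform of the basic kernel -/

/-- The Fourier transform of `w⁻¹ w̄^(k-1)` on horizontal lines, up to a constant. -/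
def profile (k y ν : ℝ) : ℂ :=
  Complex.exp (-(2 * Real.pi * ν * y)) *
    (incGamma (1 - k) (max 0 (-(4 * Real.pi * ν * y))) / Complex.Gamma (1 - k))

lemma Gamma_one_sub_ne_zero {k : ℝ} (hk : k < 0) : Complex.Gamma (1 - k) ≠ 0 :=
  Complex.Gamma_ne_zero_of_re_pos (by simp; linarith)

lemma profile_of_nonneg {k : ℝ} (hk : k < 0) {y ν : ℝ} (hy : 0 < y) (hν : 0 ≤ ν) :
    profile k y ν = Complex.exp (-(2 * Real.pi * ν * y)) := by
  have : -(4 * Real.pi * ν * y) ≤ 0 := by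
    have := Real.pi_pos
    rw [neg_nonpos]; positivity
  rw [profile, max_eq_left this, incGamma_zero hk, div_self (Gamma_one_sub_ne_zero hk), mul_one]

lemma profile_of_nonpos {k y ν : ℝ} (hy : 0 < y) (hν : ν ≤ 0) :
    profile k y ν = Complex.exp (-(2 * Real.pi * ν * y)) *
      (incGamma (1 - k) (-(4 * Real.pi * ν * y)) / Complex.Gamma (1 - k)) := by
  have : 0 ≤ -(4 * Real.pi * ν * y) := by
    have := Real.pi_pos
    have : 0 ≤ 4 * Real.pi * y := by positivity
    nlinarith
  rw [profile, max_eq_right this]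

lemma continuous_incGamma {k : ℝ} (hk : k < 0) : Continuous (incGamma (1 - k)) :=
  continuous_iff_continuousAt.mpr fun x => (hasDerivAt_incGamma hk x).continuousAt

lemma continuous_profile {k : ℝ} (hk : k < 0) (y : ℝ) : Continuous (profile k y) := by
  unfold profile
  have := continuous_incGamma hk
  fun_prop

lemma exists_norm_profile_le {k : ℝ} (hk : k < 0) : ∃ C : ℝ, 0 ≤ C ∧ ∀ y ν : ℝ, 0 < y →
    ‖profile k y ν‖ ≤ C * Real.exp (-(Real.pi * y) * |ν|) := by
  obtain ⟨C, hC, h⟩ := exists_norm_incGamma_le hk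
  have hG : 0 < ‖Complex.Gamma (1 - k)‖ := norm_pos_iff.mpr (Gamma_one_sub_ne_zero hk)
  have hp := Real.pi_pos
  refine ⟨C / ‖Complex.Gamma (1 - k)‖, by positivity, fun y ν hy => ?_⟩
  rw [profile, norm_mul, norm_div, Complex.norm_exp]
  have e1 : (-(2 * Real.pi * ν * y) : ℂ).re = -(2 * Real.pi * ν * y) := by
    have : (-(2 * Real.pi * ν * y) : ℂ) = ((-(2 * Real.pi * ν * y) : ℝ) : ℂ) := by push_cast; rfl
    rw [this, Complex.ofReal_re]
  rw [e1, ← mul_div_assoc, div_mul_eq_mul_div]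
  refine div_le_div_of_nonneg_right ?_ hG.le
  refine (mul_le_mul_of_nonneg_left (h _ (le_max_left _ _)) (Real.exp_nonneg _)).trans ?_
  rw [mul_left_comm, ← Real.exp_add]
  refine mul_le_mul_of_nonneg_left (Real.exp_le_exp.mpr ?_) hC
  have hpy : 0 < Real.pi * y := by positivity
  rcases le_total 0 ν with hν | hν
  · rw [abs_of_nonneg hν]
    have := le_max_left 0 (-(4 * Real.pi * ν * y))
    nlinarith
  · rw [abs_of_nonpos hν]
    have := le_max_right 0 (-(4 * Real.pi * ν * y))
    nlinarith

lemma integrable_exp_neg_mul_abs {b : ℝ} (hb : 0 < b) :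
    MeasureTheory.Integrable fun ν : ℝ => Real.exp (-b * |ν|) := by
  have h1 : MeasureTheory.IntegrableOn (fun ν : ℝ => Real.exp (-b * |ν|)) (Set.Iic 0) :=
    (integrableOn_exp_mul_Iic hb 0).congr_fun (fun ν hν => by
      simp only; rw [abs_of_nonpos hν]; congr 1; ring) measurableSet_Iic
  have h2 : MeasureTheory.IntegrableOn (fun ν : ℝ => Real.exp (-b * |ν|)) (Set.Ioi 0) :=
    (exp_neg_integrableOn_Ioi 0 hb).congr_fun (fun ν hν => by
      simp only; rw [abs_of_pos hν]) measurableSet_Ioi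
  have := h1.union h2
  rwa [Set.Iic_union_Ioi, MeasureTheory.integrableOn_univ] at this

lemma integrable_profile {k : ℝ} (hk : k < 0) {y : ℝ} (hy : 0 < y) :
    MeasureTheory.Integrable (profile k y) := by
  obtain ⟨C, hC, h⟩ := exists_norm_profile_le hk
  exact ((integrable_exp_neg_mul_abs (by have := Real.pi_pos; positivity)).const_mul C).mono'
    (continuous_profile hk y).aestronglyMeasurable (Filter.Eventually.of_forall fun ν => h y ν hy)

lemma ofReal_mul_cpow {r : ℝ} (hr : 0 < r) {w : ℂ} (hw : w ≠ 0) (s : ℂ) :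
    ((r : ℂ) * w) ^ s = (r : ℂ) ^ s * w ^ s := by
  have hr' : (r : ℂ) ≠ 0 := by exact_mod_cast hr.ne'
  rw [Complex.cpow_def_of_ne_zero (mul_ne_zero hr' hw), Complex.cpow_def_of_ne_zero hr',
    Complex.cpow_def_of_ne_zero hw, Complex.log_ofReal_mul hr hw, Complex.ofReal_log hr.le,
    add_mul, Complex.exp_add]

/-- The point `x + iy`. -/
def linePoint (y x : ℝ) : ℂ := x + y * Complex.I

@[simp] lemma linePoint_im (y x : ℝ) : (linePoint y x).im = y := by simp [linePoint]

@[simp] lemma linePoint_re (y x : ℝ) : (linePoint y x).re = x := by simp [linePoint]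

lemma linePoint_ne_zero {y : ℝ} (hy : 0 < y) (x : ℝ) : linePoint y x ≠ 0 := fun h => by
  have := linePoint_im y x
  rw [h, Complex.zero_im] at this
  linarith

lemma conj_linePoint_mem_slitPlane {y : ℝ} (hy : 0 < y) (x : ℝ) :
    (starRingEnd ℂ) (linePoint y x) ∈ Complex.slitPlane := by
  rw [Complex.mem_slitPlane_iff]; right; simp; exact hy.ne'

lemma conj_linePoint_ne_zero {y : ℝ} (hy : 0 < y) (x : ℝ) :
    (starRingEnd ℂ) (linePoint y x) ≠ 0 :=
  Complex.slitPlane_ne_zero (conj_linePoint_mem_slitPlane hy x)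

/-- The function `w⁻¹ w̄^(k-1)` on the horizontal line of height `y`. -/
def lineBase (k y x : ℝ) : ℂ :=
  (linePoint y x)⁻¹ * (starRingEnd ℂ) (linePoint y x) ^ (-((1 - k : ℝ) : ℂ))

lemma hasDerivAt_linePoint (y x : ℝ) : HasDerivAt (linePoint y) 1 x :=
  (Complex.ofRealCLM.hasDerivAt (x := x)).add_const (y * Complex.I)

lemma hasDerivAt_conj_linePoint (y x : ℝ) :
    HasDerivAt (fun x => (starRingEnd ℂ) (linePoint y x)) 1 x := by
  have h : (fun x => (starRingEnd ℂ) (linePoint y x)) = fun x : ℝ => (x : ℂ) - y * Complex.I := by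
    funext x; simp [linePoint, sub_eq_add_neg]
  rw [h]
  exact (Complex.ofRealCLM.hasDerivAt (x := x)).sub_const (y * Complex.I)

lemma I_mul_cpow_conj_linePoint {y : ℝ} (hy : 0 < y) (x : ℝ) (s : ℂ) :
    (Complex.I * (starRingEnd ℂ) (linePoint y x)) ^ s =
      Complex.I ^ s * (starRingEnd ℂ) (linePoint y x) ^ s := by
  have h0 := conj_linePoint_ne_zero hy x
  have hneg : (starRingEnd ℂ (linePoint y x)).arg < 0 := by
    rw [Complex.arg_neg_iff]; simp; exact hy
  have h1 := Complex.neg_pi_lt_arg (starRingEnd ℂ (linePoint y x))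
  have hp := Real.pi_pos
  rw [Complex.cpow_def_of_ne_zero (mul_ne_zero Complex.I_ne_zero h0),
    Complex.cpow_def_of_ne_zero Complex.I_ne_zero, Complex.cpow_def_of_ne_zero h0,
    Complex.log_mul Complex.I_ne_zero h0 (by rw [Complex.arg_I]; constructor <;> linarith),
    add_mul, Complex.exp_add]

/-- Integration by parts: the derivative of the incomplete gamma function is elementary and leaves a
Gamma integral with rate `4πy - b`, of real part `2πy`. The boundary term at 0 is `-b⁻¹`. -/
lemma integral_profile_neg {k : ℝ} (hk : k < 0) {y : ℝ} (hy : 0 < y) {b : ℂ}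
    (hb : b.re = 2 * Real.pi * y) :
    ∫ t in Set.Ioi (0 : ℝ), incGamma (1 - k) (4 * Real.pi * y * t) / Complex.Gamma (1 - k) *
      Complex.exp (b * t) =
      -b⁻¹ + (((4 * Real.pi * y) ^ (1 - k) : ℝ) : ℂ) *
        (4 * Real.pi * y - b) ^ (-((1 - k : ℝ) : ℂ)) / b := by
  have hp := Real.pi_pos
  have hΓ := Gamma_one_sub_ne_zero hk
  set Γ := Complex.Gamma (1 - k)
  set Y : ℝ := 4 * Real.pi * y with hY
  have hY0 : 0 < Y := by positivity
  set r : ℂ := Y - b with hr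
  have hYc : (4 * Real.pi * y : ℂ) = (Y : ℂ) := by rw [hY]; push_cast; rfl
  have hr0 : 0 < r.re := by
    rw [hr, Complex.sub_re, Complex.ofReal_re, hb, hY]
    have : 0 < Real.pi * y := by positivity
    linarith
  have hb0 : b ≠ 0 := fun h => by
    rw [h, Complex.zero_re] at hb
    have : 0 < Real.pi * y := by positivity
    linarith
  have hu : ∀ t : ℝ, HasDerivAt (fun t : ℝ => incGamma (1 - k) (Y * t) / Γ)
      (-(Complex.exp (-((Y * t : ℝ) : ℂ)) * ((Y * t : ℝ) : ℂ) ^ (-(k : ℂ))) * Y / Γ) t := fun t => by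
    have h1 := (hasDerivAt_id t).const_mul Y
    have h2 := (hasDerivAt_incGamma hk (Y * t)).scomp t h1
    exact (h2.div_const Γ).congr_deriv (by rw [mul_one, Complex.real_smul]; ring)
  have hv : ∀ t : ℝ, HasDerivAt (fun t : ℝ => Complex.exp (b * t) / b) (Complex.exp (b * t)) t :=
    fun t => by
    have h0 : HasDerivAt (fun t : ℝ => (t : ℂ)) 1 t := Complex.ofRealCLM.hasDerivAt
    exact ((h0.const_mul b).cexp.div_const b).congr_deriv (by field_simp)
  have hprod : ∀ t ∈ Set.Ioi (0 : ℝ),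
      (-(Complex.exp (-((Y * t : ℝ) : ℂ)) * ((Y * t : ℝ) : ℂ) ^ (-(k : ℂ))) * Y / Γ) *
        (Complex.exp (b * t) / b) =
      -((Y ^ (1 - k) : ℝ) : ℂ) / (Γ * b) *
        ((t : ℂ) ^ ((1 - k - 1 : ℝ) : ℂ) * Complex.exp (-(r * t))) := fun t ht => by
    have ht0 : 0 < t := ht
    have e1 : ((Y * t : ℝ) : ℂ) ^ (-(k : ℂ)) = ((Y ^ (-k) : ℝ) : ℂ) * ((t ^ (-k) : ℝ) : ℂ) := by
      rw [← Complex.ofReal_mul, ← Real.mul_rpow hY0.le ht0.le, Complex.ofReal_cpow (by positivity)]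
      push_cast; rfl
    have e2 : (t : ℂ) ^ ((1 - k - 1 : ℝ) : ℂ) = ((t ^ (-k) : ℝ) : ℂ) := by
      rw [Complex.ofReal_cpow ht0.le]; congr 2; ring
    have e3 : Y ^ (1 - k) = Y * Y ^ (-k) := by
      rw [sub_eq_add_neg, Real.rpow_add hY0, Real.rpow_one]
    have e4 : Complex.exp (-(r * t)) =
        Complex.exp (-((Y * t : ℝ) : ℂ)) * Complex.exp (b * t) := by
      rw [← Complex.exp_add]; congr 1; rw [hr]; push_cast; ring
    rw [e1, e2, e3, e4]
    push_cast
    field_simp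
  obtain ⟨C, hC, hbound⟩ := exists_norm_incGamma_le hk
  have hdecay : ∀ t : ℝ, 0 ≤ t → ‖incGamma (1 - k) (Y * t) / Γ * Complex.exp (b * t)‖ ≤
      C / ‖Γ‖ * Real.exp (-(Real.pi * y) * t) := fun t ht => by
    rw [norm_mul, norm_div, Complex.norm_exp]
    calc _ ≤ C * Real.exp (-(3 / 4 * (Y * t))) / ‖Γ‖ * Real.exp (b * t).re := by
          gcongr; exact hbound _ (by positivity)
      _ = C / ‖Γ‖ * (Real.exp (-(3 / 4 * (Y * t))) * Real.exp (b * t).re) := by ring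
      _ = _ := by
          rw [← Real.exp_add]; congr 2
          simp only [Complex.mul_re, Complex.ofReal_re, Complex.ofReal_im, hb, hY]; ring
  have hcont : Continuous fun t : ℝ => incGamma (1 - k) (Y * t) / Γ * Complex.exp (b * t) := by
    have := continuous_incGamma hk
    fun_prop
  have hint1 : MeasureTheory.IntegrableOn
      ((fun t : ℝ => incGamma (1 - k) (Y * t) / Γ) * fun t : ℝ => Complex.exp (b * t))
      (Set.Ioi 0) := by
    refine ((exp_neg_integrableOn_Ioi 0 (b := Real.pi * y) (by positivity)).const_mul
      (C / ‖Γ‖)).mono' hcont.aestronglyMeasurable.restrict ?_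
    filter_upwards [MeasureTheory.ae_restrict_mem measurableSet_Ioi] with t ht
    exact hdecay t (le_of_lt ht)
  have hint2 : MeasureTheory.IntegrableOn
      ((fun t : ℝ => -(Complex.exp (-((Y * t : ℝ) : ℂ)) * ((Y * t : ℝ) : ℂ) ^ (-(k : ℂ))) * Y / Γ) *
        fun t : ℝ => Complex.exp (b * t) / b) (Set.Ioi 0) :=
    MeasureTheory.IntegrableOn.congr_fun
      ((integrableOn_cpow_mul_cexp (a := 1 - k - 1) (by linarith) hr0).const_mul _)
      (fun t ht => (hprod t ht).symm) measurableSet_Ioi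
  have hzero : Filter.Tendsto ((fun t : ℝ => incGamma (1 - k) (Y * t) / Γ) *
      fun t : ℝ => Complex.exp (b * t) / b) (nhdsWithin 0 (Set.Ioi 0)) (nhds b⁻¹) := by
    have h1 := ((hu 0).continuousAt.mul (hv 0).continuousAt).tendsto
    have h2 : incGamma (1 - k) (Y * 0) / Γ * (Complex.exp (b * (0 : ℝ)) / b) = b⁻¹ := by
      rw [mul_zero, incGamma_zero hk, div_self hΓ]; simp
    simp only [Pi.mul_apply, h2] at h1
    exact h1.mono_left nhdsWithin_le_nhds
  have hinfty : Filter.Tendsto ((fun t : ℝ => incGamma (1 - k) (Y * t) / Γ) *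
      fun t : ℝ => Complex.exp (b * t) / b) Filter.atTop (nhds 0) := by
    have h1 : Filter.Tendsto (fun t : ℝ => C / ‖Γ‖ * Real.exp (-(Real.pi * y) * t)) Filter.atTop
        (nhds 0) := by
      have h2 : Filter.Tendsto (fun t : ℝ => -(Real.pi * y) * t) Filter.atTop Filter.atBot :=
        Filter.tendsto_id.const_mul_atTop_of_neg (by
          have : 0 < Real.pi * y := by positivity
          linarith)
      simpa using (Real.tendsto_exp_atBot.comp h2).const_mul (C / ‖Γ‖)
    have h3 := (squeeze_zero_norm' (Filter.eventually_atTop.mpr ⟨0, fun t ht => hdecay t ht⟩)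
      h1).div_const b
    rw [zero_div] at h3
    refine h3.congr fun t => ?_
    simp [mul_div_assoc]
  have key := MeasureTheory.integral_Ioi_mul_deriv_eq_deriv_mul (fun t _ => hu t) (fun t _ => hv t)
    hint1 hint2 hzero hinfty
  rw [key, MeasureTheory.setIntegral_congr_fun measurableSet_Ioi hprod,
    MeasureTheory.integral_const_mul, integral_cpow_mul_cexp (by linarith) hr0, hYc, ← hr,
    show ((1 - k : ℝ) : ℂ) = 1 - k by push_cast; rfl]
  change 0 - b⁻¹ - -_ / (Γ * b) * (_ * Γ) = _
  field_simp
  ring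

/-- With `b = -2πiw`, the half line `ν > 0` contributes `b⁻¹`, which the boundary term from `ν < 0`
cancels. What is left is a power of `4πy - b = 2πi w̄` over `b`, that is, a multiple of `w⁻¹
w̄^{k-1}`. -/
lemma fourierInv_profile {k : ℝ} (hk : k < 0) {y : ℝ} (hy : 0 < y) (x : ℝ) :
    𝓕⁻ (profile k y) x = (((2 * y) ^ (1 - k) : ℝ) : ℂ) / (2 * Real.pi) * Complex.I ^ (k : ℂ) *
      lineBase k y x := by
  have hp := Real.pi_pos
  have hw := linePoint_ne_zero hy x
  set w := linePoint y x with hwd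
  set b : ℂ := -(2 * Real.pi * Complex.I * w) with hb
  have hbre : b.re = 2 * Real.pi * y := by
    rw [hb, hwd]; simp [linePoint]
  have hb0 : b ≠ 0 := by
    rw [hb]; simp [hw, hp.ne', Complex.I_ne_zero]
  set f : ℝ → ℂ := fun ν => Complex.exp ((2 * Real.pi * (ν * x) : ℝ) * Complex.I) * profile k y ν
    with hf
  have hfint : MeasureTheory.Integrable f := by
    refine (integrable_profile hk hy).bdd_mul (c := 1) (by fun_prop) ?_
    exact Filter.Eventually.of_forall fun ν => by rw [Complex.norm_exp_ofReal_mul_I]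
  have h1 : 𝓕⁻ (profile k y) x = ∫ ν, f ν := by
    rw [Real.fourierInv_eq']
    refine MeasureTheory.integral_congr_ae (Filter.Eventually.of_forall fun ν => ?_)
    simp [hf, mul_comm x]
  have h2 : ∫ ν in Set.Ioi (0 : ℝ), f ν = b⁻¹ := by
    have e : ∀ ν ∈ Set.Ioi (0 : ℝ), f ν = Complex.exp (-b * ν) := fun ν hν => by
      simp only [hf]
      rw [profile_of_nonneg hk hy (le_of_lt hν), ← Complex.exp_add]
      congr 1
      rw [hb, hwd, linePoint]; push_cast
      linear_combination (-2 * Real.pi * ν * y) * Complex.I_mul_I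
    rw [MeasureTheory.setIntegral_congr_fun measurableSet_Ioi e, integral_exp_mul_complex_Ioi]
    · simp
    · rw [Complex.neg_re, hbre]
      have : 0 < Real.pi * y := by positivity
      linarith
  have h3 : ∫ ν in Set.Iic (0 : ℝ), f ν =
      -b⁻¹ + (((4 * Real.pi * y) ^ (1 - k) : ℝ) : ℂ) *
        (4 * Real.pi * y - b) ^ (-((1 - k : ℝ) : ℂ)) / b := by
    rw [← integral_profile_neg hk hy hbre]
    have := integral_comp_neg_Ioi 0 f
    rw [neg_zero] at this
    rw [← this]
    refine MeasureTheory.setIntegral_congr_fun measurableSet_Ioi fun t ht => ?_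
    have ht0 : 0 < t := ht
    simp only [hf]
    rw [profile_of_nonpos hy (by linarith),
      show -(4 * Real.pi * -t * y) = 4 * Real.pi * y * t by ring, ← mul_assoc, ← Complex.exp_add,
      mul_comm]
    congr 2
    rw [hb, hwd, linePoint]; push_cast
    linear_combination (2 * Real.pi * t * y) * Complex.I_mul_I
  rw [h1, ← intervalIntegral.integral_Iic_add_Ioi hfint.integrableOn hfint.integrableOn, h2, h3]
  have e1 : (4 * Real.pi * y - b : ℂ) =
      ((2 * Real.pi : ℝ) : ℂ) * (Complex.I * (starRingEnd ℂ) w) := by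
    rw [hb, hwd, linePoint]; simp
    linear_combination (4 * Real.pi * y) * Complex.I_mul_I
  have e2 : (4 * Real.pi * y) ^ (1 - k) =
      (2 * y) ^ (1 - k) * (2 * Real.pi) ^ (1 - k) := by
    rw [← Real.mul_rpow (by positivity) (by positivity)]; congr 1; ring
  have e3 : ((2 * Real.pi : ℝ) : ℂ) ^ (-((1 - k : ℝ) : ℂ)) =
      (((2 * Real.pi) ^ (1 - k) : ℝ) : ℂ)⁻¹ := by
    rw [Complex.cpow_neg, Complex.ofReal_cpow (by positivity)]
  have e4 : Complex.I ^ (-((1 - k : ℝ) : ℂ)) = Complex.I ^ (k : ℂ) / Complex.I := by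
    rw [show -((1 - k : ℝ) : ℂ) = (k : ℂ) - 1 by push_cast; ring,
      Complex.cpow_sub _ _ Complex.I_ne_zero, Complex.cpow_one]
  have e5 : (((2 * Real.pi) ^ (1 - k) : ℝ) : ℂ) ≠ 0 := by
    have : (0 : ℝ) < (2 * Real.pi) ^ (1 - k) := by positivity
    exact_mod_cast this.ne'
  have hpc : (Real.pi : ℂ) ≠ 0 := by exact_mod_cast hp.ne'
  rw [e1, ofReal_mul_cpow (by positivity) (mul_ne_zero Complex.I_ne_zero
    (conj_linePoint_ne_zero hy x)), I_mul_cpow_conj_linePoint hy, e2, e3, e4, lineBase, ← hwd, hb]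
  push_cast at e5 ⊢
  field_simp
  linear_combination -((((2 * y) ^ (1 - k) : ℝ) : ℂ) * Complex.I ^ (k : ℂ) *
    (starRingEnd ℂ) w ^ (-(1 - (k : ℂ)))) * Complex.I_sq

lemma le_norm_linePoint {y : ℝ} (hy : 0 < y) (x : ℝ) : y ≤ ‖linePoint y x‖ := by
  have := Complex.abs_im_le_norm (linePoint y x)
  rwa [linePoint_im, abs_of_pos hy] at this

lemma norm_conj_linePoint_cpow {y : ℝ} (s x : ℝ) :
    ‖(starRingEnd ℂ) (linePoint y x) ^ (s : ℂ)‖ = ‖linePoint y x‖ ^ s := by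
  rw [Complex.norm_cpow_real, Complex.norm_conj]

lemma exists_norm_linePoint_rpow_le {y : ℝ} (hy : 0 < y) {a : ℝ} (ha : 0 ≤ a) :
    ∃ C : ℝ, 0 ≤ C ∧ ∀ x : ℝ, ‖linePoint y x‖ ^ (-a) ≤ C * (1 + ‖x‖) ^ (-a) := by
  set c := min y 1 / 2 with hc
  have hc0 : 0 < c := by rw [hc]; positivity
  refine ⟨c ^ (-a), by positivity, fun x => ?_⟩
  rw [← Real.mul_rpow hc0.le (by positivity)]
  refine Real.rpow_le_rpow_of_nonpos (by positivity) ?_ (by linarith)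
  have h1 := Complex.abs_re_le_norm (linePoint y x)
  have h2 := le_norm_linePoint hy x
  rw [linePoint_re] at h1
  rw [Real.norm_eq_abs]
  have h3 := min_le_left y 1
  have h4 := min_le_right y 1
  have h5 := abs_nonneg x
  nlinarith

/-- Monomials in `w⁻¹` and `w̄⁻¹` times `w⁻¹ w̄^(k-1)`, on a horizontal line. -/
def lineTerm (k y : ℝ) (a b : ℕ) (x : ℝ) : ℂ :=
  (linePoint y x)⁻¹ ^ a * ((starRingEnd ℂ) (linePoint y x))⁻¹ ^ b * lineBase k y x

lemma hasDerivAt_lineTerm (k : ℝ) {y : ℝ} (hy : 0 < y) (a b : ℕ) (x : ℝ) :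
    HasDerivAt (lineTerm k y a b) (-((a + 1) * lineTerm k y (a + 1) b x) -
      (1 - k + b) * lineTerm k y a (b + 1) x) x := by
  have hw := linePoint_ne_zero hy x
  have hv := conj_linePoint_ne_zero hy x
  have h1 := (hasDerivAt_linePoint y x).fun_inv hw
  have h2 := (hasDerivAt_conj_linePoint y x).fun_inv hv
  have h3 := HasDerivAt.scomp x ((hasDerivAt_id ((starRingEnd ℂ) (linePoint y x))).cpow_const
    (c := -((1 - k : ℝ) : ℂ)) (conj_linePoint_mem_slitPlane hy x)) (hasDerivAt_conj_linePoint y x)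
  have h := ((h1.fun_pow a).fun_mul (h2.fun_pow b)).fun_mul (h1.fun_mul h3)
  refine HasDerivAt.congr_deriv h ?_
  simp only [lineTerm, lineBase, Function.comp_apply, id, smul_eq_mul]
  rw [Complex.cpow_sub _ _ hv, Complex.cpow_one]
  set w := linePoint y x
  set v := (starRingEnd ℂ) w
  have ha : (a : ℂ) * w⁻¹ ^ (a - 1) * w⁻¹ = a * w⁻¹ ^ a := by
    rcases a with _ | a
    · simp
    · rw [Nat.add_sub_cancel, pow_succ]; ring
  have hb : (b : ℂ) * v⁻¹ ^ (b - 1) * v⁻¹ = b * v⁻¹ ^ b := by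
    rcases b with _ | b
    · simp
    · rw [Nat.add_sub_cancel, pow_succ]; ring
  have e1 : (-1 : ℂ) / w ^ 2 = -(w⁻¹ * w⁻¹) := by field_simp
  have e2 : (-1 : ℂ) / v ^ 2 = -(v⁻¹ * v⁻¹) := by field_simp
  rw [e1, e2, div_eq_mul_inv, pow_succ, pow_succ]
  push_cast
  set X := v ^ (-((1 : ℂ) - k))
  linear_combination (-(w⁻¹ * v⁻¹ ^ b * w⁻¹ * X)) * ha - (v⁻¹ * w⁻¹ ^ a * w⁻¹ * X) * hb

lemma norm_lineTerm (k : ℝ) {y : ℝ} (hy : 0 < y) (a b : ℕ) (x : ℝ) :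
    ‖lineTerm k y a b x‖ = ‖linePoint y x‖⁻¹ ^ (a + b) * ‖linePoint y x‖ ^ (-(2 - k)) := by
  have h0 : 0 < ‖linePoint y x‖ := hy.trans_le (le_norm_linePoint hy x)
  rw [lineTerm, lineBase, norm_mul, norm_mul, norm_mul, norm_pow, norm_pow, norm_inv, norm_inv,
    Complex.norm_conj, ← Complex.ofReal_neg, norm_conj_linePoint_cpow, ← pow_add,
    ← Real.rpow_neg_one, ← Real.rpow_add h0]
  congr 2
  ring

lemma exists_norm_lineTerm_le {k : ℝ} (hk : k < 0) {y : ℝ} (hy : 0 < y) :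
    ∃ C : ℝ, 0 ≤ C ∧ ∀ (a b : ℕ) (x : ℝ),
      ‖lineTerm k y a b x‖ ≤ y⁻¹ ^ (a + b) * (C * (1 + ‖x‖) ^ (-(2 - k))) := by
  obtain ⟨C, hC, h⟩ := exists_norm_linePoint_rpow_le hy (a := 2 - k) (by linarith)
  refine ⟨C, hC, fun a b x => ?_⟩
  have h0 : 0 < ‖linePoint y x‖ := hy.trans_le (le_norm_linePoint hy x)
  rw [norm_lineTerm k hy]
  gcongr
  · exact le_norm_linePoint hy x
  · exact h x

lemma integrable_one_add_norm_rpow {k : ℝ} (hk : k < 0) :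
    MeasureTheory.Integrable fun x : ℝ => (1 + ‖x‖) ^ (-(2 - k)) :=
  integrable_one_add_norm (by simp; linarith)

lemma integrable_lineTerm {k : ℝ} (hk : k < 0) {y : ℝ} (hy : 0 < y) (a b : ℕ) :
    MeasureTheory.Integrable (lineTerm k y a b) := by
  obtain ⟨C, hC, h⟩ := exists_norm_lineTerm_le hk hy
  refine (((integrable_one_add_norm_rpow hk).const_mul C).const_mul (y⁻¹ ^ (a + b))).mono'
    ?_ (Filter.Eventually.of_forall (h a b))
  exact (continuous_iff_continuousAt.mpr fun x =>
    (hasDerivAt_lineTerm k hy a b x).continuousAt).aestronglyMeasurable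

/-- The iterated derivatives of `w⁻¹ w̄^(k-1)` along a horizontal line, up to a constant. -/
def lineSum (k y : ℝ) (j : ℕ) (x : ℝ) : ℂ :=
  ∑ p ∈ Finset.HasAntidiagonal.antidiagonal j,
    (ascPochhammer ℂ p.2).eval (1 - k : ℂ) / (p.2 ! : ℂ) * lineTerm k y p.1 p.2 x

lemma lineSum_zero (k y : ℝ) : lineSum k y 0 = lineBase k y := by
  funext x; simp [lineSum, lineTerm]

/-- Leibniz' rule: the coefficients `c_b = (1-k)_b / b!` satisfy `(b+1) c_{b+1} = (1-k+b) c_b`, so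
the derivatives of the monomials regroup. Consequently `lineSum` is `(-1)^j / j!` times the `j`-th
derivative of `lineBase`. -/
lemma hasDerivAt_lineSum (k : ℝ) {y : ℝ} (hy : 0 < y) (j : ℕ) (x : ℝ) :
    HasDerivAt (lineSum k y j) (-((j + 1) * lineSum k y (j + 1) x)) x := by
  have h : HasDerivAt (lineSum k y j) _ x :=
    HasDerivAt.fun_sum fun (p : ℕ × ℕ) (_ : p ∈ Finset.HasAntidiagonal.antidiagonal j) =>
      (hasDerivAt_lineTerm k hy p.1 p.2 x).const_mul
        ((ascPochhammer ℂ p.2).eval (1 - k : ℂ) / (p.2 ! : ℂ))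
  refine h.congr_deriv ?_
  set c : ℕ → ℂ := fun b => (ascPochhammer ℂ b).eval (1 - k : ℂ) / (b ! : ℂ) with hc
  have hrec : ∀ b : ℕ, ((b + 1 : ℕ) : ℂ) * c (b + 1) = (1 - k + b) * c b := fun b => by
    have h1 : ((b ! : ℕ) : ℂ) ≠ 0 := by exact_mod_cast b.factorial_ne_zero
    have h2 : ((b : ℂ) + 1) ≠ 0 := by exact_mod_cast b.succ_ne_zero
    simp only [hc]
    rw [ascPochhammer_succ_eval, Nat.factorial_succ]
    push_cast
    field_simp
  have hsplit : ((j : ℂ) + 1) * lineSum k y (j + 1) x =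
      ∑ p ∈ Finset.HasAntidiagonal.antidiagonal (j + 1), (p.1 : ℂ) * (c p.2 * lineTerm k y p.1 p.2 x) +
      ∑ p ∈ Finset.HasAntidiagonal.antidiagonal (j + 1), (p.2 : ℂ) * (c p.2 * lineTerm k y p.1 p.2 x) := by
    rw [lineSum, Finset.mul_sum, ← Finset.sum_add_distrib]
    refine Finset.sum_congr rfl fun p hp => ?_
    have : (p.1 : ℂ) + p.2 = j + 1 := by exact_mod_cast Finset.HasAntidiagonal.mem_antidiagonal.mp hp
    rw [← add_mul, this]
  rw [hsplit, Finset.Nat.sum_antidiagonal_succ, Finset.Nat.sum_antidiagonal_succ']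
  simp only [Nat.cast_zero, zero_mul, zero_add]
  rw [← Finset.sum_add_distrib, ← Finset.sum_neg_distrib]
  refine Finset.sum_congr rfl fun p _ => ?_
  have := hrec p.2
  push_cast at this ⊢
  linear_combination lineTerm k y p.1 (p.2 + 1) x * this

lemma integrable_lineSum {k : ℝ} (hk : k < 0) {y : ℝ} (hy : 0 < y) (j : ℕ) :
    MeasureTheory.Integrable (lineSum k y j) :=
  MeasureTheory.integrable_finsetSum _ fun p _ => (integrable_lineTerm hk hy p.1 p.2).const_mul _

lemma fourier_const_mul (c : ℂ) (f : ℝ → ℂ) (ν : ℝ) :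
    𝓕 (fun x => c * f x) ν = c * 𝓕 f ν := by
  rw [Real.fourier_eq', Real.fourier_eq', ← MeasureTheory.integral_const_mul]
  refine MeasureTheory.integral_congr_ae (Filter.Eventually.of_forall fun x => ?_)
  simp only [smul_eq_mul]; ring

lemma fourier_lineSum {k : ℝ} (hk : k < 0) {y : ℝ} (hy : 0 < y) (j : ℕ) (ν : ℝ) :
    𝓕 (lineSum k y j) ν =
      (-(2 * Real.pi * Complex.I * ν)) ^ j / (j ! : ℂ) * 𝓕 (lineBase k y) ν := by
  induction j with
  | zero => simp [lineSum_zero]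
  | succ j ih =>
    have hd : deriv (lineSum k y j) = fun x => -((j : ℂ) + 1) * lineSum k y (j + 1) x := by
      funext x; rw [(hasDerivAt_lineSum k hy j x).deriv]; ring
    have h := congrFun (Real.fourier_deriv (integrable_lineSum hk hy j)
      (fun x => (hasDerivAt_lineSum k hy j x).differentiableAt)
      (by rw [hd]; exact (integrable_lineSum hk hy (j + 1)).const_mul _)) ν
    rw [hd, fourier_const_mul, ih, smul_eq_mul] at h
    have h2 : ((j : ℂ) + 1) ≠ 0 := by exact_mod_cast j.succ_ne_zero
    have h1 : ((j ! : ℕ) : ℂ) ≠ 0 := by exact_mod_cast j.factorial_ne_zero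
    rw [← mul_right_inj' h2, Nat.factorial_succ]
    push_cast
    field_simp at h ⊢
    linear_combination -h

/-- The Fourier transform of `w⁻¹ w̄^(k-1)` along a horizontal line. -/
lemma fourier_lineBase {k : ℝ} (hk : k < 0) {y : ℝ} (hy : 0 < y) (ν : ℝ) :
    (((2 * y) ^ (1 - k) : ℝ) : ℂ) / (2 * Real.pi) * Complex.I ^ (k : ℂ) * 𝓕 (lineBase k y) ν =
      profile k y ν := by
  have hbase : MeasureTheory.Integrable (lineBase k y) := by
    rw [← lineSum_zero]; exact integrable_lineSum hk hy 0
  set c : ℂ := (((2 * y) ^ (1 - k) : ℝ) : ℂ) / (2 * Real.pi) * Complex.I ^ (k : ℂ) with hc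
  have h1 : 𝓕⁻ (profile k y) = fun x => c * lineBase k y x :=
    funext fun x => fourierInv_profile hk hy x
  have h2 : MeasureTheory.Integrable (𝓕 (profile k y)) := by
    have : 𝓕 (profile k y) = fun x => c * lineBase k y (-x) := by
      funext x
      rw [← fourierInv_profile hk hy, Real.fourierInv_eq_fourier_neg, neg_neg]
    rw [this]
    exact hbase.comp_neg.const_mul c
  -- The transform of `lineBase` is read off by Fourier inversion from the explicit inverse
  -- transform of `profile`, which is continuous and integrable with integrable transform.
  have h3 := congrFun ((continuous_profile hk y).fourier_fourierInv_eq
    (integrable_profile hk hy) h2) ν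
  rw [h1, fourier_const_mul] at h3
  exact h3

/-! ### The Fourier transform of the kernel -/

lemma integral_kappa_mul_pow_mul_one_sub_pow {k : ℝ} (hk : k < 0) (a b : ℕ) :
    ∫ u in (0 : ℝ)..1, (kappa k u : ℂ) * ((1 - (u : ℂ)) ^ a * (u : ℂ) ^ b) =
      (a ! : ℂ) * (ascPochhammer ℂ b).eval (1 - k : ℂ) /
        (ascPochhammer ℂ (a + b)).eval (2 - k : ℂ) := by
  have hre : 0 < (1 - k + b : ℂ).re := by
    have : (0 : ℝ) ≤ b := b.cast_nonneg
    simp; linarith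
  have h1 : ∫ u in (0 : ℝ)..1, (kappa k u : ℂ) * ((1 - (u : ℂ)) ^ a * (u : ℂ) ^ b) =
      (1 - k) * Complex.betaIntegral (1 - k + b) (a + 1) := by
    rw [Complex.betaIntegral, ← intervalIntegral.integral_const_mul]
    refine intervalIntegral.integral_congr_ae (Filter.Eventually.of_forall fun u hu => ?_)
    rw [Set.uIoc_of_le zero_le_one] at hu
    have hu0 : (u : ℂ) ≠ 0 := by exact_mod_cast hu.1.ne'
    rw [kappa, add_sub_cancel_right, Complex.cpow_natCast,
      show (1 - k + b : ℂ) - 1 = -(k : ℂ) + b by ring, Complex.cpow_add _ _ hu0,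
      Complex.cpow_natCast, Complex.ofReal_mul, Complex.ofReal_cpow hu.1.le]
    push_cast; ring
  rw [h1, Complex.betaIntegral_eval_nat_add_one_right hre]
  have hA : (ascPochhammer ℂ (a + b)).eval (2 - k : ℂ) ≠ 0 := ascPochhammer_two_sub_ne_zero hk _
  have hP : (ascPochhammer ℂ b).eval (1 - k : ℂ) * ∏ j ∈ Finset.range (a + 1), (1 - k + b + j : ℂ) =
      (1 - k) * (ascPochhammer ℂ (a + b)).eval (2 - k : ℂ) := by
    rw [eval_ascPochhammer_eq_prod, eval_ascPochhammer_eq_prod]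
    have e1 := Finset.prod_range_add (fun j : ℕ => (1 - k + j : ℂ)) b (a + 1)
    have e2 := Finset.prod_range_succ' (fun j : ℕ => (1 - k + j : ℂ)) (a + b)
    rw [show b + (a + 1) = a + b + 1 by ring, e2] at e1
    calc _ = (∏ x ∈ Finset.range b, (1 - k + x : ℂ)) *
          ∏ x ∈ Finset.range (a + 1), (1 - k + ((b + x : ℕ) : ℂ)) := by
          congr 1; refine Finset.prod_congr rfl fun j _ => ?_; push_cast; ring
      _ = _ := by
          rw [← e1, mul_comm]
          congr 1
          · simp
          · refine Finset.prod_congr rfl fun j _ => ?_; push_cast; ring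
  have hk1 : (1 - k : ℂ) ≠ 0 := by
    have : (1 - k : ℝ) ≠ 0 := by linarith
    exact_mod_cast this
  have hQ : ∏ j ∈ Finset.range (a + 1), (1 - k + b + j : ℂ) ≠ 0 := fun h => by
    rw [h, mul_zero] at hP
    exact mul_ne_zero hk1 hA hP.symm
  field_simp
  linear_combination -(a ! : ℂ) * hP

/-- Binomial expansion and Beta integrals: the weight `j!/(a! b!) · a! (1-k)_b / (2-k)_j` of the
monomial `w^{-a} w̄^{-b}` is `j!/(2-k)_j` times its coefficient in `lineSum`. Averages against `κ`
thus become derivatives, which the Fourier transform diagonalises. -/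
lemma lineSum_eq {k : ℝ} (hk : k < 0) (y : ℝ) (j : ℕ) (x : ℝ) :
    lineBase k y x * ∫ u in (0 : ℝ)..1, (kappa k u : ℂ) *
      ((1 - u) * (linePoint y x)⁻¹ + u * ((starRingEnd ℂ) (linePoint y x))⁻¹) ^ j =
    (j ! : ℂ) / (ascPochhammer ℂ j).eval (2 - k : ℂ) * lineSum k y j x := by
  set A := (linePoint y x)⁻¹ with hA
  set B := ((starRingEnd ℂ) (linePoint y x))⁻¹ with hB
  have hκ := continuous_kappa hk
  have h1 : ∀ u : ℝ, (kappa k u : ℂ) * ((1 - u) * A + u * B) ^ j =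
      ∑ p ∈ Finset.HasAntidiagonal.antidiagonal j, (j.choose p.1 : ℂ) * (A ^ p.1 * B ^ p.2) *
        ((kappa k u : ℂ) * ((1 - (u : ℂ)) ^ p.1 * (u : ℂ) ^ p.2)) := fun u => by
    rw [(Commute.all _ _).add_pow', Finset.mul_sum]
    refine Finset.sum_congr rfl fun p _ => ?_
    rw [nsmul_eq_mul, mul_pow, mul_pow]; ring
  simp only [h1]
  rw [intervalIntegral.integral_finsetSum fun p _ =>
    Continuous.intervalIntegrable (by fun_prop) _ _, lineSum, Finset.mul_sum, Finset.mul_sum]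
  refine Finset.sum_congr rfl fun p hp => ?_
  have hj : p.1 + p.2 = j := Finset.HasAntidiagonal.mem_antidiagonal.mp hp
  have hfac : (j.choose p.1 : ℂ) * (p.1 ! : ℂ) * (p.2 ! : ℂ) = (j ! : ℂ) := by
    rw [← hj, Nat.choose_symm_add]
    exact_mod_cast Nat.add_choose_mul_factorial_mul_factorial p.1 p.2
  have h2 : ((p.2 ! : ℕ) : ℂ) ≠ 0 := by exact_mod_cast p.2.factorial_ne_zero
  have h3 := ascPochhammer_two_sub_ne_zero hk j
  rw [intervalIntegral.integral_const_mul, integral_kappa_mul_pow_mul_one_sub_pow hk, hj,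
    lineTerm, ← hA, ← hB, ← hfac]
  field_simp

/-- The series `₀F₁(; 2 - k; X)`. -/
def zeroFOne (k : ℝ) (X : ℂ) : ℂ :=
  ∑' j : ℕ, X ^ j / ((j ! : ℂ) * (ascPochhammer ℂ j).eval (2 - k : ℂ))

/-- The kernel `w⁻¹ w̄^(k-1) ∫ κ(u) exp(-2πiλ((1-u)/w + u/w̄)) du` on a horizontal line. -/
def lineKernel (k y lam x : ℝ) : ℂ :=
  lineBase k y x * ∫ u in (0 : ℝ)..1, (kappa k u : ℂ) *
    Complex.exp (-(2 * Real.pi * Complex.I * lam) *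
      ((1 - u) * (linePoint y x)⁻¹ + u * ((starRingEnd ℂ) (linePoint y x))⁻¹))

lemma factorial_le_norm_ascPochhammer {k : ℝ} (hk : k < 0) (j : ℕ) :
    (j ! : ℝ) ≤ ‖(ascPochhammer ℂ j).eval (2 - k : ℂ)‖ := by
  rw [eval_ascPochhammer_eq_prod, norm_prod, ← Finset.prod_range_add_one_eq_factorial]
  push_cast
  refine Finset.prod_le_prod (fun i _ => by positivity) fun i _ => ?_
  have h := Complex.abs_re_le_norm (2 - k + i : ℂ)
  refine le_trans ?_ h
  simp only [Complex.add_re, Complex.sub_re, Complex.re_ofNat, Complex.ofReal_re,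
    Complex.natCast_re]
  exact le_trans (by linarith) (le_abs_self _)

/-- As `|(2-k)_j| ≥ j!`, the term is at most `(s^j/j!)(t^j/j!)`. The free splitting `st` allows `s`
to be a small multiple of `|n|`, so that the growth in `n` stays below the decay of `profile`. -/
lemma norm_zeroFOne_term_le {k : ℝ} (hk : k < 0) {X : ℂ} {s t : ℝ} (hs : 0 ≤ s) (ht : 0 ≤ t)
    (hX : ‖X‖ ≤ s * t) (j : ℕ) :
    ‖X ^ j / ((j ! : ℂ) * (ascPochhammer ℂ j).eval (2 - k : ℂ))‖ ≤
      s ^ j / j ! * Real.exp t := by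
  have hj : (0 : ℝ) < j ! := by exact_mod_cast j.factorial_pos
  have h := factorial_le_norm_ascPochhammer hk j
  rw [norm_div, norm_mul, norm_pow, Complex.norm_natCast]
  calc ‖X‖ ^ j / ((j ! : ℝ) * ‖(ascPochhammer ℂ j).eval (2 - k : ℂ)‖) ≤
        (s * t) ^ j / ((j ! : ℝ) * (j ! : ℝ)) := by gcongr
    _ = s ^ j / j ! * (t ^ j / j !) := by rw [mul_pow]; field_simp
    _ ≤ _ := by
        refine mul_le_mul_of_nonneg_left (Real.pow_div_factorial_le_exp t ht j) (by positivity)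

lemma norm_zeroFOne_le {k : ℝ} (hk : k < 0) {X : ℂ} {s t : ℝ} (hs : 0 ≤ s) (ht : 0 ≤ t)
    (hX : ‖X‖ ≤ s * t) : ‖zeroFOne k X‖ ≤ Real.exp s * Real.exp t := by
  have h1 : HasSum (fun j : ℕ => s ^ j / j ! * Real.exp t) (Real.exp s * Real.exp t) := by
    have := NormedSpace.expSeries_div_hasSum_exp (𝔸 := ℝ) s
    rw [← Real.exp_eq_exp_ℝ] at this
    exact this.mul_right _
  exact tsum_of_norm_bounded h1 (norm_zeroFOne_term_le hk hs ht hX)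

lemma norm_kappa_le {k : ℝ} (hk : k < 0) {u : ℝ} (h0 : 0 ≤ u) (h1 : u ≤ 1) :
    ‖(kappa k u : ℂ)‖ ≤ 1 - k := by
  have hk1 : 0 ≤ 1 - k := by linarith
  rw [Complex.norm_real, kappa, Real.norm_of_nonneg (by positivity)]
  exact mul_le_of_le_one_right hk1 (Real.rpow_le_one h0 h1 (by linarith))

lemma norm_segment_le {y : ℝ} (hy : 0 < y) (x : ℝ) {u : ℝ} (h0 : 0 ≤ u) (h1 : u ≤ 1) :
    ‖(1 - u) * (linePoint y x)⁻¹ + u * ((starRingEnd ℂ) (linePoint y x))⁻¹‖ ≤ y⁻¹ := by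
  have hn : ‖linePoint y x‖⁻¹ ≤ y⁻¹ := inv_anti₀ hy (le_norm_linePoint hy x)
  refine (norm_add_le _ _).trans ?_
  rw [norm_mul, norm_mul, norm_inv, norm_inv, Complex.norm_conj, ← add_mul]
  have e1 : ‖(1 - u : ℂ)‖ = 1 - u := by
    rw [← Complex.ofReal_one, ← Complex.ofReal_sub, Complex.norm_of_nonneg (by linarith)]
  rw [e1, Complex.norm_of_nonneg h0, sub_add_cancel, one_mul]
  exact hn

lemma exists_norm_lineBase_le {k : ℝ} (hk : k < 0) {y : ℝ} (hy : 0 < y) :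
    ∃ C : ℝ, 0 ≤ C ∧ ∀ x : ℝ, ‖lineBase k y x‖ ≤ C * (1 + ‖x‖) ^ (-(2 - k)) := by
  obtain ⟨C, hC, h⟩ := exists_norm_lineTerm_le hk hy
  exact ⟨C, hC, fun x => by simpa [lineTerm] using h 0 0 x⟩

lemma norm_lineSum_le {k : ℝ} (hk : k < 0) {y : ℝ} (hy : 0 < y) (j : ℕ) (x : ℝ) :
    ‖(j ! : ℂ) / (ascPochhammer ℂ j).eval (2 - k : ℂ) * lineSum k y j x‖ ≤
      (1 - k) * y⁻¹ ^ j * ‖lineBase k y x‖ := by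
  rw [← lineSum_eq hk, norm_mul, mul_comm]
  refine mul_le_mul_of_nonneg_right ?_ (norm_nonneg _)
  have := intervalIntegral.norm_integral_le_of_norm_le_const (a := 0) (b := 1)
    (C := (1 - k) * y⁻¹ ^ j) (f := fun u : ℝ => (kappa k u : ℂ) *
      ((1 - u) * (linePoint y x)⁻¹ + u * ((starRingEnd ℂ) (linePoint y x))⁻¹) ^ j) fun u hu => by
    rw [Set.uIoc_of_le zero_le_one] at hu
    rw [norm_mul, norm_pow]
    have h1 := norm_kappa_le hk hu.1.le hu.2
    have h2 := norm_segment_le hy x hu.1.le hu.2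
    have hk1 : 0 ≤ 1 - k := by linarith
    gcongr
  simpa using this

lemma hasSum_lineKernel {k : ℝ} (hk : k < 0) (y lam x : ℝ) :
    HasSum (fun j : ℕ => (-(2 * Real.pi * Complex.I * lam)) ^ j / (j ! : ℂ) *
      ((j ! : ℂ) / (ascPochhammer ℂ j).eval (2 - k : ℂ) * lineSum k y j x))
      (lineKernel k y lam x) := by
  have h := (hasSum_integral_mul_exp (continuous_kappa hk)
    (g := fun u : ℝ => -(2 * Real.pi * Complex.I * lam) *
      ((1 - u) * (linePoint y x)⁻¹ + u * ((starRingEnd ℂ) (linePoint y x))⁻¹))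
    (by fun_prop)).mul_left (lineBase k y x)
  refine h.congr_fun fun j => ?_
  rw [← lineSum_eq hk]
  simp only [mul_pow, mul_left_comm _ ((-(2 * Real.pi * Complex.I * lam)) ^ j)]
  rw [intervalIntegral.integral_const_mul]
  ring

/-- The exponential series may be integrated termwise by the majorant of `norm_lineSum_le`. The
`j`-th derivative contributes `(-2πiν)^j / j!`, and with `(-2πiλ)^j / (2-k)_j` this is the general
term of `₀F₁` at `-4π²λν`. -/
lemma fourier_lineKernel {k : ℝ} (hk : k < 0) {y : ℝ} (hy : 0 < y) (lam ν : ℝ) :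
    𝓕 (lineKernel k y lam) ν =
      zeroFOne k (-(4 * Real.pi ^ 2 * lam * ν)) * 𝓕 (lineBase k y) ν := by
  set c : ℂ := -(2 * Real.pi * Complex.I * lam) with hc
  set F : ℕ → ℝ → ℂ := fun j x => c ^ j / (j ! : ℂ) *
    ((j ! : ℂ) / (ascPochhammer ℂ j).eval (2 - k : ℂ) * lineSum k y j x) with hF
  set ψ : ℝ → ℂ := fun x => Complex.exp ((-2 * Real.pi * (x * ν) : ℝ) * Complex.I) with hψ
  have hfour : ∀ f : ℝ → ℂ, 𝓕 f ν = ∫ x, ψ x * f x := fun f => by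
    rw [Real.fourier_eq']
    refine MeasureTheory.integral_congr_ae (Filter.Eventually.of_forall fun x => ?_)
    simp [hψ, mul_comm ν]
  have hψn : ∀ x, ‖ψ x‖ = 1 := fun x => Complex.norm_exp_ofReal_mul_I _
  have hFint : ∀ j, MeasureTheory.Integrable fun x => ψ x * F j x := fun j =>
    (((integrable_lineSum hk hy j).const_mul _).const_mul _).bdd_mul (c := 1)
      (by simp only [hψ]; fun_prop) (Filter.Eventually.of_forall fun x => (hψn x).le)
  obtain ⟨C, hC, hbase⟩ := exists_norm_lineBase_le hk hy
  have hk1 : 0 ≤ 1 - k := by linarith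
  have hI := integrable_one_add_norm_rpow hk
  have hFn : ∀ j x, ‖ψ x * F j x‖ ≤
      (‖c‖ * y⁻¹) ^ j / j ! * ((1 - k) * (C * (1 + ‖x‖) ^ (-(2 - k)))) := fun j x => by
    simp only [hF]
    rw [norm_mul, hψn, one_mul, norm_mul, norm_div, norm_pow, Complex.norm_natCast]
    calc _ ≤ ‖c‖ ^ j / j ! * ((1 - k) * y⁻¹ ^ j * (C * (1 + ‖x‖) ^ (-(2 - k)))) := by
          refine mul_le_mul_of_nonneg_left ((norm_lineSum_le hk hy j x).trans ?_) (by positivity)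
          exact mul_le_mul_of_nonneg_left (hbase x) (by positivity)
      _ = _ := by rw [mul_pow]; ring
  have hsum : Summable fun j => ∫ x, ‖ψ x * F j x‖ := by
    refine Summable.of_nonneg_of_le (fun j => MeasureTheory.integral_nonneg fun x => norm_nonneg _)
      (fun j => ?_) ((Real.summable_pow_div_factorial (‖c‖ * y⁻¹)).mul_right
        (∫ x : ℝ, (1 - k) * (C * (1 + ‖x‖) ^ (-(2 - k)))))
    rw [← MeasureTheory.integral_const_mul]
    exact MeasureTheory.integral_mono (hFint j).norm
      (((hI.const_mul _).const_mul _).const_mul _) (hFn j)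
  have key := MeasureTheory.hasSum_integral_of_summable_integral_norm hFint hsum
  have e1 : (fun x => ∑' j, ψ x * F j x) = fun x => ψ x * lineKernel k y lam x := by
    funext x
    rw [tsum_mul_left, (hasSum_lineKernel hk y lam x).tsum_eq]
  rw [e1, ← hfour] at key
  rw [← key.tsum_eq, zeroFOne, ← tsum_mul_right]
  refine tsum_congr fun j => ?_
  rw [← hfour]
  simp only [hF]
  rw [fourier_const_mul, fourier_const_mul, fourier_lineSum hk hy]
  have h1 : ((j ! : ℕ) : ℂ) ≠ 0 := by exact_mod_cast j.factorial_ne_zero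
  have h2 := ascPochhammer_two_sub_ne_zero hk j
  have h3 : (-(4 * Real.pi ^ 2 * lam * ν) : ℂ) = c * (-(2 * Real.pi * Complex.I * ν)) := by
    rw [hc]; linear_combination (-4 * Real.pi ^ 2 * lam * ν) * Complex.I_sq
  rw [h3, mul_pow]
  field_simp

lemma continuous_lineBase (k : ℝ) {y : ℝ} (hy : 0 < y) : Continuous (lineBase k y) := by
  rw [← lineSum_zero]
  exact continuous_iff_continuousAt.mpr fun x => (hasDerivAt_lineSum k hy 0 x).continuousAt

lemma continuous_lineKernel {k : ℝ} (hk : k < 0) {y : ℝ} (hy : 0 < y) (lam : ℝ) :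
    Continuous (lineKernel k y lam) := by
  refine (continuous_lineBase k hy).mul ?_
  refine intervalIntegral.continuous_parametric_intervalIntegral_of_continuous' ?_ 0 1
  have hκ := continuous_kappa hk
  have h1 : Continuous fun p : ℝ × ℝ => (linePoint y p.1)⁻¹ :=
    Continuous.inv₀ (by unfold linePoint; fun_prop) fun p => linePoint_ne_zero hy _
  have h2 : Continuous fun p : ℝ × ℝ => ((starRingEnd ℂ) (linePoint y p.1))⁻¹ :=
    Continuous.inv₀ (Complex.continuous_conj.comp (by unfold linePoint; fun_prop))
      fun p => conj_linePoint_ne_zero hy _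
  simp only [Function.uncurry_def]
  fun_prop

lemma norm_lineKernel_le {k : ℝ} (hk : k < 0) {y : ℝ} (hy : 0 < y) (lam x : ℝ) :
    ‖lineKernel k y lam x‖ ≤
      ‖lineBase k y x‖ * ((1 - k) * Real.exp (2 * Real.pi * |lam| * y⁻¹)) := by
  rw [lineKernel, norm_mul]
  refine mul_le_mul_of_nonneg_left ?_ (norm_nonneg _)
  have hp := Real.pi_pos
  have := intervalIntegral.norm_integral_le_of_norm_le_const (a := 0) (b := 1)
    (C := (1 - k) * Real.exp (2 * Real.pi * |lam| * y⁻¹))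
    (f := fun u : ℝ => (kappa k u : ℂ) * Complex.exp (-(2 * Real.pi * Complex.I * lam) *
      ((1 - u) * (linePoint y x)⁻¹ + u * ((starRingEnd ℂ) (linePoint y x))⁻¹))) fun u hu => by
    rw [Set.uIoc_of_le zero_le_one] at hu
    rw [norm_mul]
    have h1 := norm_kappa_le hk hu.1.le hu.2
    have h2 := norm_segment_le hy x hu.1.le hu.2
    refine mul_le_mul h1 ((Complex.norm_exp_le_exp_norm _).trans (Real.exp_le_exp.mpr ?_))
      (norm_nonneg _) (by linarith)
    rw [norm_mul, norm_neg, norm_mul, norm_mul, norm_mul, Complex.norm_I, Complex.norm_real,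
      Complex.norm_real, Complex.norm_ofNat, Real.norm_of_nonneg hp.le, Real.norm_eq_abs, mul_one]
    gcongr
  simpa using this

lemma isBigO_lineKernel {k : ℝ} (hk : k < 0) {y : ℝ} (hy : 0 < y) (lam : ℝ) :
    lineKernel k y lam =O[Filter.cocompact ℝ] fun x : ℝ => |x| ^ (-(2 - k)) := by
  obtain ⟨C, hC, h⟩ := exists_norm_lineBase_le hk hy
  set E := (1 - k) * Real.exp (2 * Real.pi * |lam| * y⁻¹) with hE
  have hE0 : 0 ≤ E := mul_nonneg (by linarith) (Real.exp_nonneg _)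
  refine Asymptotics.IsBigO.of_bound (C * E) ?_
  have hne : ∀ᶠ x : ℝ in Filter.cocompact ℝ, x ∈ ({0} : Set ℝ)ᶜ :=
    isCompact_singleton.compl_mem_cocompact
  filter_upwards [hne] with x hx
  have hx0 : 0 < |x| := abs_pos.mpr hx
  rw [Real.norm_of_nonneg (by positivity)]
  calc _ ≤ ‖lineBase k y x‖ * E := norm_lineKernel_le hk hy lam x
    _ ≤ C * (1 + ‖x‖) ^ (-(2 - k)) * E := mul_le_mul_of_nonneg_right (h x) hE0
    _ ≤ C * |x| ^ (-(2 - k)) * E := by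
        have : (1 + ‖x‖) ^ (-(2 - k)) ≤ |x| ^ (-(2 - k)) :=
          Real.rpow_le_rpow_of_nonpos hx0 (by rw [Real.norm_eq_abs]; linarith) (by linarith)
        gcongr
    _ = _ := by ring

/-- The constant in the Fourier transform of `w⁻¹ w̄^(k-1)`. -/
def lineConst (k y : ℝ) : ℂ := (((2 * y) ^ (1 - k) : ℝ) : ℂ) / (2 * Real.pi) * Complex.I ^ (k : ℂ)

lemma lineConst_ne_zero (k : ℝ) {y : ℝ} (hy : 0 < y) : lineConst k y ≠ 0 := by
  have h1 : ((2 * y) ^ (1 - k) : ℝ) ≠ 0 := by positivity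
  have h2 : (2 * Real.pi : ℂ) ≠ 0 := by exact_mod_cast (by positivity : (2 * Real.pi : ℝ) ≠ 0)
  have h3 : Complex.I ^ (k : ℂ) ≠ 0 := by simp [Complex.cpow_eq_zero_iff, Complex.I_ne_zero]
  exact mul_ne_zero (div_ne_zero (by exact_mod_cast h1) h2) h3

lemma lineConst_mul_fourier_lineKernel {k : ℝ} (hk : k < 0) {y : ℝ} (hy : 0 < y) (lam ν : ℝ) :
    lineConst k y * 𝓕 (lineKernel k y lam) ν =
      zeroFOne k (-(4 * Real.pi ^ 2 * lam * ν)) * profile k y ν := by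
  rw [fourier_lineKernel hk hy, ← fourier_lineBase hk hy, lineConst]; ring

/-- Uniform bound for the Fourier coefficients. -/
lemma exists_norm_coefficient_le {k : ℝ} (hk : k < 0) {y : ℝ} (hy : 0 < y) (L : ℝ) :
    ∃ b : ℤ → ℝ, Summable b ∧ ∀ (lam : ℝ) (n : ℤ), |lam| ≤ L →
      ‖zeroFOne k (-(4 * Real.pi ^ 2 * lam * n)) * profile k y n‖ ≤ b n := by
  obtain ⟨C, hC, h⟩ := exists_norm_profile_le hk
  have hp := Real.pi_pos
  -- Half of the decay rate `πy` of `profile`: `e^{s|n|}` from `norm_zeroFOne_le` against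
  -- `e^{-2s|n|}` leaves `e^{-s|n|}`.
  set s := Real.pi * y / 2 with hs
  have hs0 : 0 < s := by positivity
  refine ⟨fun n => Real.exp (4 * Real.pi ^ 2 * L / s) * C * Real.exp (-s * |(n : ℝ)|),
    Summable.mul_left _ ?_, fun lam n hlam => ?_⟩
  · have hg : Summable fun n : ℕ => Real.exp (-s * n) := by
      have := Real.summable_exp_nat_mul_iff.mpr (neg_lt_zero.mpr hs0)
      refine this.congr fun n => by rw [mul_comm]
    refine Summable.of_nat_of_neg ?_ ?_ <;> simpa using hg
  · have hL : 0 ≤ L := (abs_nonneg _).trans hlam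
    have h1 : ‖(-(4 * Real.pi ^ 2 * lam * n) : ℂ)‖ ≤ s * |(n : ℝ)| * (4 * Real.pi ^ 2 * L / s) := by
      have : (-(4 * Real.pi ^ 2 * lam * n) : ℂ) = ((-(4 * Real.pi ^ 2 * lam * n) : ℝ) : ℂ) := by
        push_cast; rfl
      rw [this, Complex.norm_real, Real.norm_eq_abs, abs_neg, abs_mul, abs_mul, abs_of_nonneg
        (by positivity : (0 : ℝ) ≤ 4 * Real.pi ^ 2)]
      have e : s * |(n : ℝ)| * (4 * Real.pi ^ 2 * L / s) = 4 * Real.pi ^ 2 * L * |(n : ℝ)| := by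
        field_simp
      rw [e]
      gcongr
    have h2 := norm_zeroFOne_le hk (by positivity) (by positivity) h1
    rw [norm_mul]
    calc _ ≤ Real.exp (s * |(n : ℝ)|) * Real.exp (4 * Real.pi ^ 2 * L / s) *
          (C * Real.exp (-(Real.pi * y) * |(n : ℝ)|)) := by
          gcongr; exact h y n hy
      _ = Real.exp (4 * Real.pi ^ 2 * L / s) * C *
          (Real.exp (s * |(n : ℝ)|) * Real.exp (-(Real.pi * y) * |(n : ℝ)|)) := by ring
      _ = _ := by rw [← Real.exp_add, hs]; congr 2; ring

/-- Poisson summation for the kernel. -/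
lemma tsum_lineKernel {k : ℝ} (hk : k < 0) {y : ℝ} (hy : 0 < y) (lam x : ℝ) :
    lineConst k y * ∑' l : ℤ, lineKernel k y lam (x + l) =
      ∑' n : ℤ, zeroFOne k (-(4 * Real.pi ^ 2 * lam * n)) * profile k y n * e (n * x) := by
  obtain ⟨b, hb, h⟩ := exists_norm_coefficient_le hk hy |lam|
  have hL := lineConst_ne_zero k hy
  have hsum : Summable fun n : ℤ => 𝓕 (lineKernel k y lam) n := by
    have h1 : Summable fun n : ℤ => lineConst k y * 𝓕 (lineKernel k y lam) n :=
      Summable.of_norm_bounded hb fun n => by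
        rw [lineConst_mul_fourier_lineKernel hk hy]
        exact_mod_cast h lam n le_rfl
    exact (summable_mul_left_iff hL).mp h1
  rw [Real.tsum_eq_tsum_fourier_of_rpow_decay_of_summable (continuous_lineKernel hk hy lam)
    (b := 2 - k) (by linarith) (isBigO_lineKernel hk hy lam) hsum x, ← tsum_mul_left]
  refine tsum_congr fun n => ?_
  rw [← mul_assoc, lineConst_mul_fourier_lineKernel hk hy, fourier_coe_apply, e]
  push_cast
  congr 2
  ring

/-! ### Matching of coefficients -/

lemma Gamma_two_sub_add_natCast {k : ℝ} (hk : k < 0) (j : ℕ) :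
    Complex.Gamma (2 - k + j) =
      (ascPochhammer ℂ j).eval (2 - k : ℂ) * Complex.Gamma (2 - k) := by
  induction j with
  | zero => simp
  | succ j ih =>
    have hne : (2 - k + j : ℂ) ≠ 0 := fun h => by
      have h2 := congrArg Complex.re h
      have : (0 : ℝ) ≤ j := j.cast_nonneg
      simp at h2
      linarith
    rw [Nat.cast_succ, ← add_assoc, Complex.Gamma_add_one _ hne, ih, ascPochhammer_succ_eval]
    ring

lemma tsum_bessel {k : ℝ} (hk : k < 0) (X : ℂ) :
    ∑' j : ℕ, X ^ j / ((j ! : ℂ) * Complex.Gamma (1 - k + j + 1)) =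
      zeroFOne k X / Complex.Gamma (2 - k) := by
  rw [zeroFOne, ← tsum_div_const]
  refine tsum_congr fun j => ?_
  rw [show (1 - k + j + 1 : ℂ) = 2 - k + j by ring, Gamma_two_sub_add_natCast hk, ← mul_assoc,
    div_div]

lemma besselJ_eq {k : ℝ} (hk : k < 0) (x : ℝ) :
    besselJ (1 - k) x = ((x : ℂ) / 2) ^ (1 - k : ℂ) *
      (zeroFOne k (-((x : ℂ) ^ 2 / 4)) / Complex.Gamma (2 - k)) := by
  rw [besselJ, tsum_bessel hk]

lemma besselI_eq {k : ℝ} (hk : k < 0) (x : ℝ) :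
    besselI (1 - k) x = ((x : ℂ) / 2) ^ (1 - k : ℂ) *
      (zeroFOne k ((x : ℂ) ^ 2 / 4) / Complex.Gamma (2 - k)) := by
  rw [besselI, tsum_bessel hk]

lemma zeroFOne_zero (k : ℝ) : zeroFOne k 0 = 1 := by
  rw [zeroFOne, tsum_eq_single 0]
  · simp
  · intro j hj; simp [hj]

/-- The factor relating the coefficients `c_{m,k}(n, s)` to the Fourier expansion. -/
def coeffScale (k : ℝ) (n : ℤ) : ℝ :=
  if n = 0 then (4 * Real.pi) ^ (1 - k) / Real.Gamma (2 - k) else |(n : ℝ)| ^ (k - 1)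

lemma Gamma_two_sub_pos {k : ℝ} (hk : k < 0) : 0 < Real.Gamma (2 - k) :=
  Real.Gamma_pos_of_pos (by linarith)

lemma coeffScale_pos {k : ℝ} (hk : k < 0) (n : ℤ) : 0 < coeffScale k n := by
  have h1 := Gamma_two_sub_pos hk
  have h2 := Real.pi_pos
  rw [coeffScale]
  split_ifs with h
  · positivity
  · have : 0 < |(n : ℝ)| := abs_pos.mpr (by exact_mod_cast h)
    positivity

/-- The prefactor and the leading power of the Bessel function each contribute `|mn|^{(1-k)/2}`.
Their product is `|m|^{1-k} |n|^{1-k}`, and `coeffScale` removes the power of `n`. -/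
lemma amplitude_bessel {k : ℝ} {m n : ℤ} (hm : m ≠ 0) (hn : n ≠ 0) {c : ℝ} (hc : 0 < c) :
    amplitude m k * 2 ^ (k - 1) * c ^ (k - 1) =
      |(m * n : ℝ)| ^ ((1 - k) / 2) * ((4 * Real.pi * √|(m * n : ℝ)| / c / 2) ^ (1 - k) /
        Real.Gamma (2 - k)) * coeffScale k n := by
  have hp := Real.pi_pos
  have hm' : 0 < |(m : ℝ)| := abs_pos.mpr (by exact_mod_cast hm)
  have hn' : 0 < |(n : ℝ)| := abs_pos.mpr (by exact_mod_cast hn)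
  have hmn : 0 < |(m * n : ℝ)| := by rw [abs_mul]; positivity
  rw [amplitude, if_neg hm, coeffScale, if_neg hn]
  have e1 : 4 * Real.pi * √|(m * n : ℝ)| / c / 2 = 2 * Real.pi * √|(m * n : ℝ)| / c := by ring
  have e2 : (√|(m * n : ℝ)|) ^ (1 - k) = |(m * n : ℝ)| ^ ((1 - k) / 2) := by
    rw [Real.sqrt_eq_rpow, ← Real.rpow_mul hmn.le]; congr 1; ring
  have e3 : |(m * n : ℝ)| ^ ((1 - k) / 2) * |(m * n : ℝ)| ^ ((1 - k) / 2) =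
      |(m : ℝ)| ^ (1 - k) * |(n : ℝ)| ^ (1 - k) := by
    rw [← Real.rpow_add hmn, abs_mul, ← Real.mul_rpow hm'.le hn'.le]; congr 1; ring
  have e4 : ∀ t : ℝ, 0 < t → t ^ (k - 1) = (t ^ (1 - k))⁻¹ := fun t ht => by
    rw [← Real.rpow_neg ht.le]; congr 1; ring
  have e5 : (4 : ℝ) ^ (1 - k) = 2 ^ (1 - k) * 2 ^ (1 - k) := by
    rw [← Real.mul_rpow (by norm_num) (by norm_num)]; norm_num
  have e6 : (2 * Real.pi * √|(m * n : ℝ)|) ^ (1 - k) =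
      2 ^ (1 - k) * Real.pi ^ (1 - k) * |(m * n : ℝ)| ^ ((1 - k) / 2) := by
    rw [Real.mul_rpow (by positivity) (Real.sqrt_nonneg _), e2, Real.mul_rpow two_pos.le hp.le]
  rw [e1, Real.div_rpow (by positivity) hc.le, e6, Real.mul_rpow (by positivity) hm'.le,
    Real.mul_rpow (by positivity) hp.le, e4 2 two_pos, e4 c hc, e4 _ hn', e5]
  have h2 : (2 : ℝ) ^ (1 - k) ≠ 0 := by positivity
  have h3 : |(n : ℝ)| ^ (1 - k) ≠ 0 := by positivity
  have h4 : c ^ (1 - k) ≠ 0 := by positivity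
  field_simp
  rw [sq, e3]

/-- The argument `-4π² mn/c²` is `∓x²/4` with `x` the Bessel argument, so the sign of `mn` selects
`J` or `I`. For `mn = 0` the series is 1 and the cases of `coeffWeight` only record constants. -/
lemma amplitude_eq_coeffWeight {k : ℝ} (hk : k < 0) (m n : ℤ) {c : ℕ} (hc : 0 < c) :
    (amplitude m k : ℂ) * ((2 ^ (k - 1) : ℝ) : ℂ) * (((c : ℝ) ^ (k - 1) : ℝ) : ℂ) *
      zeroFOne k (-(4 * Real.pi ^ 2 * ((m / (c : ℝ) ^ 2 : ℝ) : ℂ) * n)) =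
      coeffWeight m k n (1 - k / 2) c * (coeffScale k n : ℂ) := by
  have hp := Real.pi_pos
  have hc' : (0 : ℝ) < c := by exact_mod_cast hc
  have hcc : (c : ℂ) ≠ 0 := by exact_mod_cast hc.ne'
  have hs1 : 2 * (1 - (k : ℂ) / 2) - 1 = 1 - k := by ring
  have hs2 : 1 - (k : ℂ) / 2 + k / 2 - 1 = 0 := by ring
  have hs3 : 1 - (k : ℂ) / 2 - k / 2 = ((1 - k : ℝ) : ℂ) := by push_cast; ring
  have hs4 : 1 - 2 * (1 - (k : ℂ) / 2) = ((k - 1 : ℝ) : ℂ) := by push_cast; ring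
  have hs5 : 2 * (1 - (k : ℂ) / 2) = ((2 - k : ℝ) : ℂ) := by push_cast; ring
  have hΓ : Complex.Gamma (2 - k) = (Real.Gamma (2 - k) : ℂ) := by
    rw [← Complex.Gamma_ofReal]; push_cast; rfl
  have hcast : ∀ x : ℝ, 0 ≤ x → ((x : ℂ) / 2) ^ (1 - k : ℂ) = (((x / 2) ^ (1 - k) : ℝ) : ℂ) :=
    fun x hx => by rw [Complex.ofReal_cpow (by positivity)]; push_cast; rfl
  have hx2 : ∀ x : ℝ, x = 4 * Real.pi * √|(m * n : ℝ)| / c →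
      x ^ 2 / 4 = 4 * Real.pi ^ 2 * (|(m * n : ℝ)| / (c : ℝ) ^ 2) := fun x hx => by
    rw [hx, div_pow, mul_pow, Real.sq_sqrt (abs_nonneg _)]; ring
  set x : ℝ := 4 * Real.pi * √|(m * n : ℝ)| / c with hx
  have hx0 : 0 ≤ x := by rw [hx]; positivity
  have hxe := hx2 x hx
  rcases lt_trichotomy (m * n) 0 with h | h | h
  · have hm : m ≠ 0 := fun h0 => by simp [h0] at h
    have hn : n ≠ 0 := fun h0 => by simp [h0] at h
    have hneg : (m * n : ℝ) < 0 := by exact_mod_cast h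
    rw [coeffWeight, if_neg (by omega), if_pos h, ← hx, hs1, besselI_eq hk, hcast x hx0, hΓ]
    have hX : (-(4 * Real.pi ^ 2 * ((m / (c : ℝ) ^ 2 : ℝ) : ℂ) * n) : ℂ) = (x : ℂ) ^ 2 / 4 := by
      rw [abs_of_neg hneg] at hxe
      have : (x : ℂ) ^ 2 / 4 = ((x ^ 2 / 4 : ℝ) : ℂ) := by push_cast; rfl
      rw [this, hxe]; push_cast; ring
    rw [hX]
    have h1 := congrArg (fun r : ℝ => (r : ℂ)) (amplitude_bessel (k := k) hm hn hc')
    simp only [← hx] at h1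
    push_cast at h1 ⊢
    linear_combination zeroFOne k ((x : ℂ) ^ 2 / 4) * h1
  · have hz : zeroFOne k (-(4 * Real.pi ^ 2 * ((m / (c : ℝ) ^ 2 : ℝ) : ℂ) * n)) = 1 := by
      have h0 : (m : ℂ) * n = 0 := by exact_mod_cast h
      rw [show (-(4 * Real.pi ^ 2 * ((m / (c : ℝ) ^ 2 : ℝ) : ℂ) * n) : ℂ) = 0 by
        push_cast; linear_combination (-4 * Real.pi ^ 2 / (c : ℂ) ^ 2) * h0, zeroFOne_zero]
    have hG := Gamma_two_sub_pos hk
    have h2c : (2 : ℂ) ^ ((k : ℂ) - 1) = ((2 ^ (k - 1) : ℝ) : ℂ) := by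
      rw [Complex.ofReal_cpow (by norm_num)]; push_cast; rfl
    have hcc2 : (c : ℂ) ^ ((k - 1 : ℝ) : ℂ) = (((c : ℝ) ^ (k - 1) : ℝ) : ℂ) := by
      rw [Complex.ofReal_cpow hc'.le]; push_cast; rfl
    have e5 : (4 : ℝ) ^ (1 - k) = 2 ^ (1 - k) * 2 ^ (1 - k) := by
      rw [← Real.mul_rpow (by norm_num) (by norm_num)]; norm_num
    have e4 : ∀ t : ℝ, 0 < t → t ^ (k - 1) = (t ^ (1 - k))⁻¹ := fun t ht => by
      rw [← Real.rpow_neg ht.le]; congr 1; ring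
    rw [hz, mul_one, coeffWeight, if_neg (by omega), if_neg (by omega)]
    split_ifs with hmn
    · rw [hs2, hs3, hs4, Complex.cpow_zero, mul_one, h2c, hcc2,
        ← Complex.ofReal_cpow (abs_nonneg _)]
      rcases mul_eq_zero.mp h with h0 | h0
      · have hn : n ≠ 0 := fun h1 => hmn (by omega)
        have hn' : 0 < |(n : ℝ)| := abs_pos.mpr (by exact_mod_cast hn)
        have h3 : |(n : ℝ)| ^ (1 - k) ≠ 0 := by positivity
        rw [amplitude, if_pos h0, coeffScale, if_neg hn, h0, Int.cast_zero, zero_add, e4 _ hn']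
        norm_cast
        field_simp
      · have hm : m ≠ 0 := fun h1 => hmn (by omega)
        rw [amplitude, if_neg hm, coeffScale, if_pos h0, h0, Int.cast_zero, add_zero,
          Real.mul_rpow (by positivity) (abs_nonneg _)]
        norm_cast
        field_simp
    · have hm : m = 0 := by
        rcases mul_eq_zero.mp h with h0 | h0 <;> omega
      have hn : n = 0 := by omega
      have h22 : (2 : ℂ) ^ (2 * (k : ℂ) - 2) = ((2 ^ (k - 1) * 2 ^ (k - 1) : ℝ) : ℂ) := by
        rw [← Real.rpow_add two_pos, Complex.ofReal_cpow (by norm_num)]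
        push_cast; congr 1; ring
      have hpi : (Real.pi : ℂ) ^ ((k : ℂ) - 1) = ((Real.pi ^ (k - 1) : ℝ) : ℂ) := by
        rw [Complex.ofReal_cpow hp.le]; push_cast; rfl
      have h2cc : (2 * (c : ℂ)) ^ ((k - 1 : ℝ) : ℂ) =
          ((2 ^ (k - 1) * (c : ℝ) ^ (k - 1) : ℝ) : ℂ) := by
        rw [← Real.mul_rpow (by norm_num) hc'.le, Complex.ofReal_cpow (by positivity)]
        push_cast; rfl
      rw [hs4, hs5, Complex.Gamma_ofReal, h22, hpi, h2cc, amplitude, if_pos hm, coeffScale,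
        if_pos hn, Real.mul_rpow (by norm_num) hp.le, e5, e4 2 two_pos, e4 _ hp]
      have h2 : (2 : ℝ) ^ (1 - k) ≠ 0 := by positivity
      have h3 : Real.pi ^ (1 - k) ≠ 0 := by positivity
      norm_cast
      field_simp
  · have hm : m ≠ 0 := fun h0 => by simp [h0] at h
    have hn : n ≠ 0 := fun h0 => by simp [h0] at h
    have hpos : (0 : ℝ) < m * n := by exact_mod_cast h
    rw [coeffWeight, if_pos h, ← hx, hs1, besselJ_eq hk, hcast x hx0, hΓ]
    have hX : (-(4 * Real.pi ^ 2 * ((m / (c : ℝ) ^ 2 : ℝ) : ℂ) * n) : ℂ) = -((x : ℂ) ^ 2 / 4) := by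
      rw [abs_of_pos hpos] at hxe
      have : (x : ℂ) ^ 2 / 4 = ((x ^ 2 / 4 : ℝ) : ℂ) := by push_cast; rfl
      rw [this, hxe]; push_cast; ring
    rw [hX]
    have h1 := congrArg (fun r : ℝ => (r : ℂ)) (amplitude_bessel (k := k) hm hn hc')
    simp only [← hx] at h1
    push_cast at h1 ⊢
    linear_combination zeroFOne k (-((x : ℂ) ^ 2 / 4)) * h1

/-! ### The terms of the Poincaré series -/

/-- With `w = z + v/c` one has `cz + v = cw` and `γz = a/c - 1/(c²w)`, likewise for the conjugates.
The constant `e(ma/c)` splits off, leaving the kernel with parameter `m/c²`. -/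
lemma kernelTerm_rowMatrix {k : ℝ} (m : ℤ) {c : ℕ} (hc : 0 < c) (v : CoprimeResidues c) (z : ℍ) :
    kernelTerm m (rowMatrix c v) 0 1 (1 - k) (kappa k) z =
      (((c : ℝ) ^ (k - 2) : ℝ) : ℂ) * e (m * (((v : ℕ) : ZMod c)⁻¹).val / c) *
        lineKernel k z.im (m / (c : ℝ) ^ 2) (z.re + (v : ℕ) / c) := by
  have hc' : (0 : ℝ) < c := by exact_mod_cast hc
  have hcc : (c : ℂ) ≠ 0 := by exact_mod_cast hc.ne'
  set w := linePoint z.im (z.re + (v : ℕ) / c) with hw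
  have hw0 : w ≠ 0 := linePoint_ne_zero z.im_pos _
  have hv0 : (starRingEnd ℂ) w ≠ 0 := conj_linePoint_ne_zero z.im_pos _
  have hz : (z : ℂ) = w - (v : ℕ) / c := by
    rw [hw, linePoint]; push_cast
    have := Complex.re_add_im (z : ℂ)
    simp only [UpperHalfPlane.coe_re, UpperHalfPlane.coe_im] at this
    linear_combination -this
  set a : ℂ := ((((v : ℕ) : ZMod c)⁻¹).val : ℂ) with ha
  have hdet := sl_det (rowMatrix c v)
  have h00 : (rowMatrix c v) 0 0 = ((((v : ℕ) : ZMod c)⁻¹).val : ℤ) := rfl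
  have h10 : (rowMatrix c v) 1 0 = (c : ℤ) := rfl
  have h11 : (rowMatrix c v) 1 1 = ((v : ℕ) : ℤ) := rfl
  rw [h00, h10, h11] at hdet
  have hdetc : a * (v : ℕ) - ((rowMatrix c v) 0 1 : ℂ) * c = 1 := by
    rw [ha]; exact_mod_cast hdet
  have hden : den (rowMatrix c v) z = ((c : ℝ) : ℂ) * w := by
    rw [den, h10, h11, hz]; push_cast; field_simp; ring
  have hmob : mob (rowMatrix c v) z = a / c - ((1 / (c : ℝ) ^ 2 : ℝ) : ℂ) * w⁻¹ := by
    rw [mob, hden, h00, hz]; push_cast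
    rw [← ha]
    field_simp
    linear_combination -hdetc
  have hmobc : (starRingEnd ℂ) (mob (rowMatrix c v) z) =
      a / c - ((1 / (c : ℝ) ^ 2 : ℝ) : ℂ) * ((starRingEnd ℂ) w)⁻¹ := by
    rw [hmob, map_sub, map_mul, map_div₀, map_inv₀, Complex.conj_ofReal, ha, map_natCast,
      map_natCast]
  have hpow : ((((c : ℝ) ^ (k - 2) : ℝ)) : ℂ) = (c : ℂ)⁻¹ * (c : ℂ) ^ (-((1 - k : ℝ) : ℂ)) := by
    rw [← Complex.cpow_neg_one, ← Complex.cpow_add _ _ hcc, Complex.ofReal_cpow hc'.le]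
    push_cast; congr 1; ring
  rw [kernelTerm, hden, map_mul, Complex.conj_ofReal, ofReal_mul_cpow hc' hv0, hmobc, hmob,
    lineKernel, lineBase, ← hw, hpow, expInt, e]
  simp only [pow_zero, pow_one, one_mul, Complex.ofReal_natCast, mul_inv]
  have hint : Complex.exp (2 * Real.pi * Complex.I * m *
        (a / c - ((1 / (c : ℝ) ^ 2 : ℝ) : ℂ) * w⁻¹)) *
      ∫ u in (0 : ℝ)..1, (kappa k u : ℂ) * Complex.exp (u * (2 * Real.pi * Complex.I * m *
        (a / c - ((1 / (c : ℝ) ^ 2 : ℝ) : ℂ) * ((starRingEnd ℂ) w)⁻¹ -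
          (a / c - ((1 / (c : ℝ) ^ 2 : ℝ) : ℂ) * w⁻¹)))) =
      Complex.exp (2 * Real.pi * Complex.I * (m * a / c)) *
        ∫ u in (0 : ℝ)..1, (kappa k u : ℂ) *
          Complex.exp (-(2 * Real.pi * Complex.I * ((m / (c : ℝ) ^ 2 : ℝ) : ℂ)) *
            ((1 - u) * w⁻¹ + u * ((starRingEnd ℂ) w)⁻¹)) := by
    rw [← intervalIntegral.integral_const_mul, ← intervalIntegral.integral_const_mul]
    refine intervalIntegral.integral_congr fun u _ => ?_
    rw [mul_left_comm (Complex.exp _) (kappa k u : ℂ), mul_left_comm (Complex.exp _) (kappa k u : ℂ),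
      ← Complex.exp_add, ← Complex.exp_add]
    congr 2
    push_cast
    ring
  rw [hint]
  ring

lemma rowMatrix_mem_Gamma0 {N : ℕ} (c : ℕ) (v : CoprimeResidues (N * c)) :
    rowMatrix (N * c) v ∈ CongruenceSubgroup.Gamma0 N :=
  mem_Gamma0_iff.mpr (by simp [rowMatrix])

lemma slash_indexMatrix {k : ℝ} {N : ℕ} (hk : IsAdmissible k N) (hk0 : k < 0) (hN : 0 < N)
    (m : ℤ) (i : RowIndex N) (z : ℍ) :
    slash k (phi m k (1 - k / 2)) (indexMatrix i) z =
      amplitude m k * ((z.im ^ (1 - k) : ℝ) : ℂ) *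
        (multiplier k (N * i.1.1 : ℕ) (i.1.2 : ℕ) *
          ((((N * i.1.1 : ℕ) : ℝ) ^ (k - 2) : ℝ) : ℂ) *
          e (m * (((i.1.2 : ℕ) : ZMod (N * i.1.1))⁻¹).val / (N * i.1.1 : ℕ)) *
        lineKernel k z.im (m / ((N * i.1.1 : ℕ) : ℝ) ^ 2)
          (z.re + (i.1.2 : ℕ) / (N * i.1.1 : ℕ) + i.2)) := by
  obtain ⟨⟨c, v⟩, l⟩ := i
  have hc : 0 < N * (c : ℕ) := Nat.mul_pos hN c.pos
  have hT : ModularGroup.T ^ l ∈ GammaInfty := ⟨l, Or.inl rfl⟩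
  have hT0 : ModularGroup.T ^ l ∈ CongruenceSubgroup.Gamma0 N := mem_Gamma0_iff.mpr (by
    rw [ModularGroup.coe_T_zpow]; simp)
  have hnorm : IsNormalized (rowMatrix (N * c) v) := by
    have h10 : (rowMatrix (N * c) v) 1 0 = ((N * c : ℕ) : ℤ) := rfl
    refine ⟨by rw [h10]; positivity, fun h => ?_⟩
    rw [h10] at h
    exact absurd (by exact_mod_cast h) hc.ne'
  have h1 : slash k (phi m k (1 - k / 2)) (rowMatrix (N * c) v * ModularGroup.T ^ l) z = _ :=
    slash_mul hk _ (rowMatrix_mem_Gamma0 c v) hT0 z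
  rw [autFactor_of_mem_GammaInfty hk hT, one_mul, slash_phi_eq hk hk0 m hnorm,
    kernelTerm_rowMatrix m hc, ModularGroup.im_T_zpow_smul, re_T_zpow_smul] at h1
  rw [indexMatrix, h1, add_right_comm]
  have h10 : (rowMatrix (N * c) v) 1 0 = ((N * c : ℕ) : ℤ) := rfl
  have h11 : (rowMatrix (N * c) v) 1 1 = ((v : ℕ) : ℤ) := rfl
  rw [h10, h11]
  ring

/-! ### The Fourier expansion -/

/-- The coprime residues modulo the positive multiples of `N`. -/
abbrev ResidueIndex (N : ℕ) : Type := Σ c : ℕ+, CoprimeResidues (N * c)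

/-- The factor of the Poincaré series which depends only on the double coset. -/
def residueFactor (m : ℤ) (k : ℝ) {N : ℕ} (p : ResidueIndex N) : ℂ :=
  multiplier k (N * p.1 : ℕ) (p.2 : ℕ) * ((((N * p.1 : ℕ) : ℝ) ^ (k - 2) : ℝ) : ℂ) *
    e (m * (((p.2 : ℕ) : ZMod (N * p.1))⁻¹).val / (N * p.1 : ℕ))

/-- The contribution of a double coset to the `n`-th Fourier coefficient. -/
def residueTerm (m : ℤ) (k : ℝ) {N : ℕ} (z : ℍ) (p : ResidueIndex N) (n : ℤ) : ℂ :=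
  residueFactor m k p *
    (zeroFOne k (-(4 * Real.pi ^ 2 * ((m / ((N * p.1 : ℕ) : ℝ) ^ 2 : ℝ) : ℂ) * n)) *
      profile k z.im n * e (n * ((z.re + (p.2 : ℕ) / (N * p.1 : ℕ) : ℝ) : ℂ)))

lemma norm_e_ofReal (n : ℤ) (x : ℝ) : ‖e (n * x)‖ = 1 := by
  rw [e, show 2 * Real.pi * Complex.I * ((n : ℂ) * x) = ((2 * Real.pi * (n * x) : ℝ) : ℂ) *
    Complex.I by push_cast; ring, Complex.norm_exp_ofReal_mul_I]

lemma norm_residueFactor_le {k : ℝ} {N : ℕ} (hk : IsAdmissible k N) (m : ℤ) (p : ResidueIndex N) :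
    ‖residueFactor m k p‖ ≤ ((N * p.1 : ℕ) : ℝ) ^ (k - 2) := by
  have hv : IsCoprime ((N * p.1 : ℕ) : ℤ) ((p.2 : ℕ) : ℤ) :=
    (Nat.isCoprime_iff_coprime.mpr (Finset.mem_filter.mp p.2.2).2).symm
  have he := norm_e_ofReal m ((((p.2 : ℕ) : ZMod (N * p.1))⁻¹).val / (N * p.1 : ℕ) : ℝ)
  push_cast at he
  rw [residueFactor, norm_mul, norm_mul, norm_multiplier hk hv, one_mul, mul_div_assoc]
  push_cast
  rw [he, mul_one, Complex.norm_of_nonneg (by positivity)]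

lemma summable_level_rpow {N : ℕ} (hN : 0 < N) {a : ℝ} (ha : a < -1) :
    Summable fun c : ℕ+ => ((N * c : ℕ) : ℝ) ^ a := by
  have h := (Real.summable_nat_rpow.mpr ha).comp_injective
    (i := fun c : ℕ+ => N * (c : ℕ)) fun c d h => PNat.coe_injective (Nat.eq_of_mul_eq_mul_left hN h)
  exact h

lemma card_coprimeResidues_le (c : ℕ) : Fintype.card (CoprimeResidues c) ≤ c := by
  rw [Fintype.card_coe]
  exact (Finset.card_filter_le _ _).trans (Finset.card_range c).le

lemma level_pos {N : ℕ} (hN : 0 < N) (c : ℕ+) : (0 : ℝ) < ((N * c : ℕ) : ℝ) := by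
  exact_mod_cast Nat.mul_pos hN c.pos

lemma summable_residue_rpow {k : ℝ} {N : ℕ} (hN : 0 < N) (hk0 : k < 0) :
    Summable fun p : ResidueIndex N => ((N * p.1 : ℕ) : ℝ) ^ (k - 2) := by
  rw [summable_sigma_of_nonneg fun p => by positivity]
  refine ⟨fun c => (hasSum_fintype _).summable, ?_⟩
  refine Summable.of_nonneg_of_le (fun c => tsum_nonneg fun v => by positivity) (fun c => ?_)
    (summable_level_rpow hN (a := k - 1) (by linarith))
  have hc := level_pos hN c
  rw [tsum_fintype]
  change ∑ _v : CoprimeResidues (N * c), ((N * c : ℕ) : ℝ) ^ (k - 2) ≤ _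
  rw [Finset.sum_const, nsmul_eq_mul, Finset.card_univ]
  calc _ ≤ ((N * c : ℕ) : ℝ) * ((N * c : ℕ) : ℝ) ^ (k - 2) := by
        gcongr
        exact card_coprimeResidues_le _
    _ = _ := by
        rw [mul_comm, ← Real.rpow_add_one hc.ne']; congr 1; ring

lemma abs_div_level_le (m : ℤ) {N : ℕ} (hN : 0 < N) (c : ℕ+) :
    |(m / ((N * c : ℕ) : ℝ) ^ 2 : ℝ)| ≤ |(m : ℝ)| := by
  have h : (1 : ℝ) ≤ ((N * c : ℕ) : ℝ) := by exact_mod_cast Nat.mul_pos hN c.pos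
  rw [abs_div, abs_of_nonneg (by positivity : (0 : ℝ) ≤ ((N * c : ℕ) : ℝ) ^ 2)]
  exact div_le_self (abs_nonneg _) (one_le_pow₀ h)

/-- The majorant is a product: `(Nc)^{k-2}` over at most `Nc` residues for each `c`, which is
summable as `k < 0`, times a sequence in `n` valid for all parameters `|m/(Nc)²| ≤ |m|`. This
justifies interchanging residues and frequencies. -/
lemma summable_residueTerm {k : ℝ} {N : ℕ} (hk : IsAdmissible k N) (hk0 : k < 0) (hN : 0 < N)
    (m : ℤ) (z : ℍ) :
    Summable (Function.uncurry (residueTerm m k z : ResidueIndex N → ℤ → ℂ)) := by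
  obtain ⟨b, hb, h⟩ := exists_norm_coefficient_le hk0 z.im_pos |(m : ℝ)|
  have hb0 : 0 ≤ b := fun n => (norm_nonneg _).trans (h 0 n (by simp))
  refine Summable.of_norm_bounded
    ((summable_residue_rpow hN hk0).mul_of_nonneg hb (fun p => by positivity) hb0) fun ⟨p, n⟩ => ?_
  simp only [Function.uncurry]
  rw [residueTerm, norm_mul, norm_mul, norm_e_ofReal, mul_one]
  exact mul_le_mul (norm_residueFactor_le hk m p) (h _ n (abs_div_level_le m hN p.1))
    (norm_nonneg _) (by positivity)

lemma tsum_option {α : Type*} {f : Option α → ℂ} (hf : Summable f) :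
    ∑' o, f o = f none + ∑' a, f (some a) := by
  classical
  rw [hf.tsum_eq_add_tsum_ite none]
  congr 1
  rw [← (Option.some_injective _).tsum_eq]
  · simp
  · intro o ho
    rcases o with _ | a
    · simp at ho
    · exact ⟨a, rfl⟩

lemma hasSum_rowIndex {k : ℝ} {N : ℕ} (hk : IsAdmissible k N) (hk0 : k < 0) (hN : 0 < N)
    (m : ℤ) (z : ℍ) :
    Summable (fun i : RowIndex N => slash k (phi m k (1 - k / 2)) (indexMatrix i) z) ∧
    poincare m k N z (1 - k / 2) = phi m k (1 - k / 2) z +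
      ∑' i : RowIndex N, slash k (phi m k (1 - k / 2)) (indexMatrix i) z := by
  obtain ⟨eqv, heqv⟩ : ∃ eqv : Option (RowIndex N) ≃ Cosets N, ∀ o, eqv o =
      toCoset (o.elim (1 : CongruenceSubgroup.Gamma0 N) indexMatrix) :=
    ⟨Equiv.ofBijective _ (optionIndex_bijective hN), fun _ => rfl⟩
  have hterm : ∀ o : Option (RowIndex N), poincareTerm m k N z (1 - k / 2) (eqv o) =
      slash k (phi m k (1 - k / 2)) (o.elim (1 : CongruenceSubgroup.Gamma0 N) indexMatrix).1 z := by
    intro o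
    rw [heqv]
    exact slash_congr_coset hk (isPeriodic_phi _ _ _) (toCoset_out _) z
  have hs : Summable fun o : Option (RowIndex N) =>
      slash k (phi m k (1 - k / 2)) (o.elim (1 : CongruenceSubgroup.Gamma0 N) indexMatrix).1 z := by
    have h := (summable_poincareTerm hk hk0 m z).comp_injective eqv.injective
    exact h.congr hterm
  have h1 : slash k (phi m k (1 - k / 2)) (1 : SL(2, ℤ)) z = phi m k (1 - k / 2) z := by
    rw [slash_eq, autFactor_one hk, one_mul, one_smul]
  have h2 := tsum_option hs
  simp only [Option.elim_none, Option.elim_some, OneMemClass.coe_one, h1] at h2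
  have h3 := hs.comp_injective (Option.some_injective _)
  refine ⟨h3, ?_⟩
  rw [← h2, poincare, ← eqv.tsum_eq, tsum_congr hterm]

/-- The constant relating the Poincaré series to the sums over residues. -/
def expansionConst (m : ℤ) (k : ℝ) : ℂ :=
  2 * Real.pi * Complex.I ^ (-(k : ℂ)) * (amplitude m k * ((2 ^ (k - 1) : ℝ) : ℂ))

lemma amplitude_mul_rpow (m : ℤ) (k : ℝ) {y : ℝ} (hy : 0 < y) :
    (amplitude m k : ℂ) * ((y ^ (1 - k) : ℝ) : ℂ) = expansionConst m k * lineConst k y := by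
  have h1 : Complex.I ^ (-(k : ℂ)) * Complex.I ^ (k : ℂ) = 1 := by
    rw [← Complex.cpow_add _ _ Complex.I_ne_zero, neg_add_cancel, Complex.cpow_zero]
  have h2 : (2 : ℝ) ^ (k - 1) * (2 : ℝ) ^ (1 - k) = 1 := by
    rw [← Real.rpow_add two_pos]; norm_num
  have h2c : ((2 ^ (k - 1) : ℝ) : ℂ) * ((2 ^ (1 - k) : ℝ) : ℂ) = 1 := by exact_mod_cast h2
  have h3 : (2 * Real.pi : ℂ) ≠ 0 := by exact_mod_cast (by positivity : (2 * Real.pi : ℝ) ≠ 0)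
  rw [expansionConst, lineConst, Real.mul_rpow two_pos.le hy.le]
  push_cast at h2c ⊢
  field_simp
  linear_combination (-(amplitude m k : ℂ) * ((y ^ (1 - k) : ℝ) : ℂ)) *
    (h2c + h1 * ((2 ^ (k - 1) : ℝ) : ℂ) * ((2 ^ (1 - k) : ℝ) : ℂ))

/-- The identity coset gives `φ`. For each residue class the sum over `l` is evaluated by Poisson
summation, `tsum_lineKernel`, and then the two outer sums are exchanged. -/
lemma poincare_eq_tsum {k : ℝ} {N : ℕ} (hk : IsAdmissible k N) (hk0 : k < 0) (hN : 0 < N)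
    (m : ℤ) (z : ℍ) :
    poincare m k N z (1 - k / 2) = phi m k (1 - k / 2) z +
      ∑' n : ℤ, expansionConst m k * ∑' p : ResidueIndex N, residueTerm m k z p n := by
  obtain ⟨hs, h⟩ := hasSum_rowIndex hk hk0 hN m z
  rw [h, tsum_mul_left, (summable_residueTerm hk hk0 hN m z).tsum_comm, hs.tsum_prod, ← tsum_mul_left]
  congr 1
  refine tsum_congr fun p => ?_
  have h1 : ∀ l : ℤ, slash k (phi m k (1 - k / 2)) (indexMatrix ((p, l) : RowIndex N)) z =
      expansionConst m k * lineConst k z.im * residueFactor m k p *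
        lineKernel k z.im (m / ((N * p.1 : ℕ) : ℝ) ^ 2)
          (z.re + (p.2 : ℕ) / (N * p.1 : ℕ) + l) := fun l => by
    rw [slash_indexMatrix hk hk0 hN, amplitude_mul_rpow m k z.im_pos, residueFactor]
    ring
  rw [tsum_congr h1, tsum_mul_left, mul_assoc _ (lineConst k z.im), mul_comm (lineConst k z.im),
    mul_assoc, mul_assoc, tsum_lineKernel hk0 z.im_pos, ← tsum_mul_left]
  rfl

lemma sum_residueFactor (m : ℤ) (k : ℝ) {N : ℕ} (x : ℝ) (c : ℕ+) (n : ℤ) :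
    ∑ v : CoprimeResidues (N * c), residueFactor m k (⟨c, v⟩ : ResidueIndex N) *
        e (n * ((x + (v : ℕ) / (N * c : ℕ) : ℝ) : ℂ)) =
      ((((N * c : ℕ) : ℝ) ^ (k - 2) : ℝ) : ℂ) * kloosterman k m n (N * c) * e (n * x) := by
  rw [kloosterman, ← Finset.sum_coe_sort ((Finset.range (N * c)).filter fun v => v.Coprime (N * c)),
    Finset.mul_sum, Finset.sum_mul]
  refine Finset.sum_congr rfl fun v _ => ?_
  have h1 : e (m * (((v : ℕ) : ZMod (N * c))⁻¹).val / (N * c : ℕ)) *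
      e (n * ((x + (v : ℕ) / (N * c : ℕ) : ℝ) : ℂ)) =
      e ((m * (((v : ℕ) : ZMod (N * c))⁻¹).val + n * (v : ℕ)) / (N * c : ℕ)) * e (n * x) := by
    simp only [e]
    rw [← Complex.exp_add, ← Complex.exp_add]
    congr 1
    push_cast
    ring
  have h2 : multiplier k (N * c : ℕ) (v : ℕ) = open Classical in if IsIntegral k then 1 else
      (quadSymbol (N * c : ℕ) (v : ℕ) : ℂ) ^ (2 * (k : ℂ)) * eps (v : ℕ) ^ (2 * (k : ℂ)) := rfl
  rw [residueFactor, mul_assoc, h1, ← h2]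
  ring

lemma norm_kloosterman_le {k : ℝ} {N : ℕ} (hk : IsAdmissible k N) (m n : ℤ) (c : ℕ) :
    ‖kloosterman k m n c‖ ≤ c := by
  have hcard : (((Finset.range c).filter fun v => v.Coprime c).card : ℝ) ≤ c := by
    exact_mod_cast (Finset.card_filter_le _ _).trans (Finset.card_range c).le
  refine le_trans ?_ hcard
  rw [kloosterman, Finset.cast_card]
  refine norm_sum_le_of_le _ fun v hv => ?_
  have hcop : IsCoprime (c : ℤ) (v : ℤ) :=
    (Nat.isCoprime_iff_coprime.mpr (Finset.mem_filter.mp hv).2).symm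
  have h1 : ‖multiplier k c v‖ = 1 := norm_multiplier hk hcop
  rw [multiplier] at h1
  rw [norm_mul, h1, one_mul]
  have := norm_e_ofReal 1 ((m * (((v : ZMod c)⁻¹).val) + n * v) / c : ℝ)
  push_cast at this
  rw [one_mul] at this
  exact this.le

lemma coeffTerm_mul_coeffScale {k : ℝ} {N : ℕ} (hk0 : k < 0) (hN : 0 < N) (m n : ℤ) (c : ℕ+) :
    coeffTerm m k N n (1 - k / 2) c * (coeffScale k n : ℂ) =
      (amplitude m k * ((2 ^ (k - 1) : ℝ) : ℂ)) *
        (((((N * c : ℕ) : ℝ) ^ (k - 2) : ℝ) : ℂ) * kloosterman k m n (N * c) *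
        zeroFOne k (-(4 * Real.pi ^ 2 * ((m / ((N * c : ℕ) : ℝ) ^ 2 : ℝ) : ℂ) * n))) := by
  have hc := level_pos hN c
  have hcc : (((N * c : ℕ) : ℝ) : ℂ) ≠ 0 := by exact_mod_cast hc.ne'
  have h1 : ((N * c : ℕ) : ℝ) ^ (k - 1) = ((N * c : ℕ) : ℝ) ^ (k - 2) * ((N * c : ℕ) : ℝ) := by
    rw [← Real.rpow_add_one hc.ne']; congr 1; ring
  have h := amplitude_eq_coeffWeight hk0 m n (Nat.mul_pos hN c.pos)
  rw [coeffTerm, mul_assoc, ← h, h1]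
  rw [Complex.ofReal_mul, Complex.ofReal_natCast]
  rw [Complex.ofReal_natCast] at hcc
  field_simp

/-- The trivial bound `|K| ≤ Nc` suffices: the Bessel weight supplies `(Nc)^{k-1}` and a bounded
`₀F₁` factor, so the terms are `O((Nc)^{k-1})` with `k < 0`. -/
lemma summable_coeffTerm {k : ℝ} {N : ℕ} (hk : IsAdmissible k N) (hk0 : k < 0) (hN : 0 < N)
    (m n : ℤ) : Summable (coeffTerm m k N n (1 - k / 2)) := by
  have hS : (coeffScale k n : ℂ) ≠ 0 := by exact_mod_cast (coeffScale_pos hk0 n).ne'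
  refine (summable_mul_right_iff hS).mp ?_
  refine Summable.of_norm_bounded ((summable_level_rpow hN (a := k - 1) (by linarith)).mul_left
    (‖(amplitude m k * ((2 ^ (k - 1) : ℝ) : ℂ))‖ *
      (Real.exp (4 * Real.pi ^ 2 * |(m : ℝ)|) * Real.exp |(n : ℝ)|))) fun c => ?_
  have hc := level_pos hN c
  rw [coeffTerm_mul_coeffScale hk0 hN, norm_mul (_ * _) (_ * _), norm_mul (_ * _) (zeroFOne _ _),
    norm_mul _ (kloosterman _ _ _ _), Complex.norm_of_nonneg (r := ((N * c : ℕ) : ℝ) ^ (k - 2)) (by positivity)]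
  have h1 : ‖(-(4 * Real.pi ^ 2 * ((m / ((N * c : ℕ) : ℝ) ^ 2 : ℝ) : ℂ) * n) : ℂ)‖ ≤
      (4 * Real.pi ^ 2 * |(m : ℝ)|) * |(n : ℝ)| := by
    rw [show (-(4 * Real.pi ^ 2 * ((m / ((N * c : ℕ) : ℝ) ^ 2 : ℝ) : ℂ) * n) : ℂ) =
      ((-(4 * Real.pi ^ 2 * (m / ((N * c : ℕ) : ℝ) ^ 2) * n) : ℝ) : ℂ) by push_cast; rfl,
      Complex.norm_real, Real.norm_eq_abs, abs_neg, abs_mul, abs_mul, abs_of_nonneg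
        (by positivity : (0 : ℝ) ≤ 4 * Real.pi ^ 2)]
    exact mul_le_mul_of_nonneg_right (mul_le_mul_of_nonneg_left (abs_div_level_le m hN c)
      (by positivity)) (abs_nonneg _)
  have h2 := norm_zeroFOne_le hk0 (by positivity) (abs_nonneg _) h1
  have h3 := norm_kloosterman_le hk m n (N * c)
  have h4 : ((N * c : ℕ) : ℝ) ^ (k - 1) = ((N * c : ℕ) : ℝ) ^ (k - 2) * ((N * c : ℕ) : ℝ) := by
    rw [← Real.rpow_add_one hc.ne']; congr 1; ring
  calc _ ≤ ‖(amplitude m k * ((2 ^ (k - 1) : ℝ) : ℂ))‖ * (((N * c : ℕ) : ℝ) ^ (k - 2) *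
        ((N * c : ℕ) : ℝ) * (Real.exp (4 * Real.pi ^ 2 * |(m : ℝ)|) * Real.exp |(n : ℝ)|)) := by
        gcongr
    _ = _ := by rw [h4]; ring

lemma tsum_residueTerm {k : ℝ} {N : ℕ} (hk : IsAdmissible k N) (hk0 : k < 0) (hN : 0 < N)
    (m : ℤ) (z : ℍ) (n : ℤ) :
    expansionConst m k * ∑' p : ResidueIndex N, residueTerm m k z p n =
      coeff m k N n (1 - k / 2) * (coeffScale k n : ℂ) * (profile k z.im n * e (n * z.re)) := by
  have hs : Summable fun p : ResidueIndex N => residueTerm m k z p n :=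
    (summable_residueTerm hk hk0 hN m z).comp_injective (i := fun p => (p, n))
      fun p q h => (Prod.mk.inj h).1
  have h1 : ∀ c : ℕ+, ∑' v : CoprimeResidues (N * c), residueTerm m k z ⟨c, v⟩ n =
      ((((N * c : ℕ) : ℝ) ^ (k - 2) : ℝ) : ℂ) * kloosterman k m n (N * c) *
        zeroFOne k (-(4 * Real.pi ^ 2 * ((m / ((N * c : ℕ) : ℝ) ^ 2 : ℝ) : ℂ) * n)) *
          (profile k z.im n * e (n * z.re)) := fun c => by
    have h2 := sum_residueFactor m k (N := N) z.re c n
    rw [tsum_fintype]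
    simp only [residueTerm]
    calc _ = (∑ v : CoprimeResidues (N * c), residueFactor m k (⟨c, v⟩ : ResidueIndex N) *
          e (n * ((z.re + (v : ℕ) / (N * c : ℕ) : ℝ) : ℂ))) *
          (zeroFOne k (-(4 * Real.pi ^ 2 * ((m / ((N * c : ℕ) : ℝ) ^ 2 : ℝ) : ℂ) * n)) *
            profile k z.im n) := by
          rw [Finset.sum_mul]
          exact Finset.sum_congr rfl fun v _ => by ring
      _ = _ := by rw [h2]; ring
  rw [hs.tsum_sigma, tsum_congr h1, tsum_mul_right, coeff, expansionConst]
  have h3 : (∑' c : ℕ+, coeffTerm m k N n (1 - k / 2) c) * (coeffScale k n : ℂ) =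
      (amplitude m k * ((2 ^ (k - 1) : ℝ) : ℂ)) * ∑' c : ℕ+,
        ((((N * c : ℕ) : ℝ) ^ (k - 2) : ℝ) : ℂ) * kloosterman k m n (N * c) *
        zeroFOne k (-(4 * Real.pi ^ 2 * ((m / ((N * c : ℕ) : ℝ) ^ 2 : ℝ) : ℂ) * n)) := by
    rw [← tsum_mul_right, ← tsum_mul_left]
    exact tsum_congr fun c => coeffTerm_mul_coeffScale hk0 hN m n c
  linear_combination (-(2 * Real.pi * Complex.I ^ (-(k : ℂ)) *
    (profile k z.im n * e (n * z.re)))) * h3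

lemma exp_mul_e (n : ℤ) (z : ℍ) :
    Complex.exp (-(2 * Real.pi * n * z.im)) * e (n * z.re) = e (n * z) := by
  have := Complex.re_add_im (z : ℂ)
  simp only [UpperHalfPlane.coe_re, UpperHalfPlane.coe_im] at this
  rw [e, e, ← Complex.exp_add, ← this]
  congr 1
  linear_combination (-2 * Real.pi * n * z.im) * Complex.I_mul_I

lemma posTerm_eq {k : ℝ} {N : ℕ} (hk0 : k < 0) (m : ℤ) (z : ℍ) {n : ℤ} (hn : 0 < n) :
    coeff m k N n (1 - k / 2) * (coeffScale k n : ℂ) * (profile k z.im n * e (n * z.re)) =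
      posTerm m k N z n := by
  have hn' : (0 : ℝ) < n := by exact_mod_cast hn
  rw [posTerm, profile_of_nonneg hk0 z.im_pos hn'.le, coeffScale, if_neg hn.ne', abs_of_pos hn',
    ← exp_mul_e]
  push_cast; ring

lemma negTerm_eq {k : ℝ} {N : ℕ} (m : ℤ) (z : ℍ) {n : ℤ} (hn : n < 0) :
    coeff m k N n (1 - k / 2) * (coeffScale k n : ℂ) * (profile k z.im n * e (n * z.re)) =
      negTerm m k N z n := by
  have hn' : (n : ℝ) < 0 := by exact_mod_cast hn
  rw [negTerm, profile_of_nonpos z.im_pos hn'.le, coeffScale, if_neg hn.ne, ← exp_mul_e,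
    show -(4 * Real.pi * n * z.im) = -4 * Real.pi * n * z.im by ring]
  push_cast; ring

lemma zeroTerm_eq {k : ℝ} {N : ℕ} (hk0 : k < 0) (m : ℤ) (z : ℍ) :
    coeff m k N 0 (1 - k / 2) * (coeffScale k 0 : ℂ) *
      (profile k z.im (0 : ℤ) * e ((0 : ℤ) * z.re)) =
      (4 * Real.pi : ℂ) ^ (1 - k : ℂ) / ((1 - k) * Complex.Gamma (1 - k)) *
        coeff m k N 0 (1 - k / 2) := by
  have hk1 : (1 - k : ℂ) ≠ 0 := by
    have : (1 - k : ℝ) ≠ 0 := by linarith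
    exact_mod_cast this
  have h1 : ((Real.Gamma (2 - k) : ℝ) : ℂ) = (1 - k) * Complex.Gamma (1 - k) := by
    rw [← Complex.Gamma_add_one _ hk1, ← Complex.Gamma_ofReal]; push_cast; ring_nf
  have h2 : (((4 * Real.pi) ^ (1 - k) : ℝ) : ℂ) = (4 * Real.pi : ℂ) ^ (1 - k : ℂ) := by
    rw [Complex.ofReal_cpow (by positivity)]; push_cast; rfl
  rw [coeffScale, if_pos rfl, profile_of_nonneg hk0 z.im_pos (by simp), Complex.ofReal_div, h1, h2]
  simp [e]
  ring

lemma tsum_int_split {f : ℤ → ℂ} (hf : Summable f) :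
    ∑' n, f n = f 0 + ∑' n : {n : ℤ // 0 < n}, f n + ∑' n : {n : ℤ // n < 0}, f n := by
  have h0 : HasSum (f ∘ ((↑) : ({0} : Set ℤ) → ℤ)) (f 0) := hasSum_singleton 0 f
  have h1 : HasSum (f ∘ ((↑) : {n : ℤ | 0 < n} → ℤ)) (∑' n : {n : ℤ // 0 < n}, f n) :=
    (hf.subtype _).hasSum
  have h2 : HasSum (f ∘ ((↑) : {n : ℤ | n < 0} → ℤ)) (∑' n : {n : ℤ // n < 0}, f n) :=
    (hf.subtype _).hasSum
  have d1 : Disjoint ({0} : Set ℤ) {n : ℤ | 0 < n} := by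
    rw [Set.disjoint_left]; simp
  have d2 : Disjoint (({0} : Set ℤ) ∪ {n : ℤ | 0 < n}) {n : ℤ | n < 0} := by
    rw [Set.disjoint_left]; intro a ha hb
    simp only [Set.mem_union, Set.mem_singleton_iff, Set.mem_ofPred_eq] at ha hb
    omega
  have h3 := (h0.add_disjoint d1 h1).add_disjoint d2 h2
  have hu : (({0} : Set ℤ) ∪ {n : ℤ | 0 < n}) ∪ {n : ℤ | n < 0} = Set.univ := by
    refine Set.eq_univ_of_forall fun n => ?_
    rcases lt_trichotomy n 0 with h | h | h
    · exact Or.inr h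
    · exact Or.inl (Or.inl h)
    · exact Or.inl (Or.inr h)
  rw [hu] at h3
  rw [← h3.tsum_eq]
  exact (tsum_univ f).symm

lemma fourier_expansion {k : ℝ} {N : ℕ} (hk : IsAdmissible k N) (hk0 : k < 0) (hN : 0 < N)
    (m : ℤ) (z : ℍ) :
    Summable (fun n : {n : ℤ // 0 < n} => posTerm m k N z n) ∧
    Summable (fun n : {n : ℤ // n < 0} => negTerm m k N z n) ∧
    poincare m k N z (1 - k / 2) =
      frakM m k z.im * e (m * z) +
      (4 * Real.pi : ℂ) ^ (1 - k : ℂ) / ((1 - k) * Complex.Gamma (1 - k)) *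
        coeff m k N 0 (1 - k / 2) +
      (∑' n : {n : ℤ // 0 < n}, posTerm m k N z n) +
      (∑' n : {n : ℤ // n < 0}, negTerm m k N z n) := by
  set f : ℤ → ℂ := fun n => expansionConst m k * ∑' p : ResidueIndex N, residueTerm m k z p n
    with hf
  have hfn : ∀ n, f n = _ := fun n => tsum_residueTerm hk hk0 hN m z n
  have hs : Summable f := ((summable_residueTerm hk hk0 hN m z).prod_symm.prod).mul_left _
  have hp : ∀ n : {n : ℤ // 0 < n}, f n = posTerm m k N z n := fun n => by
    rw [hfn, posTerm_eq hk0 m z n.2]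
  have hn : ∀ n : {n : ℤ // n < 0}, f n = negTerm m k N z n := fun n => by
    rw [hfn, negTerm_eq m z n.2]
  refine ⟨(hs.subtype {n : ℤ | 0 < n}).congr hp, (hs.subtype {n : ℤ | n < 0}).congr hn, ?_⟩
  rw [poincare_eq_tsum hk hk0 hN, tsum_int_split hs, tsum_congr hp, tsum_congr hn, hfn 0,
    zeroTerm_eq hk0, frakM_mul_e hk0]
  ring

end WeakMaass

end

theorem corollary3p4 (N : ℕ) (hN : 0 < N) (k : ℝ)
    (hk : (∃ l : ℤ, k = 2 * l) ∨ ((∃ l : ℤ, k = l + 1 / 2) ∧ 4 ∣ N))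
    (hk0 : k < 0) (m : ℤ) :
    -- the Poincaré series converges absolutely at `s = 1 - k/2`
    (∀ z : ℍ, Summable (WeakMaass.poincareTerm m k N z (1 - k / 2))) ∧
    -- membership
    (m < 0 → (fun z : ℍ => WeakMaass.poincare m k N z (1 - k / 2)) ∈
      WeakMaass.harmonicMaassFormsCuspidal k N) ∧
    (m = 0 → (fun z : ℍ => WeakMaass.poincare m k N z (1 - k / 2)) ∈
        WeakMaass.harmonicWeakMaassForms k N ∧
      WeakMaass.xi k (fun z : ℍ => WeakMaass.poincare m k N z (1 - k / 2)) ∈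
        WeakMaass.modularForms (2 - k) N) ∧
    (0 < m → (fun z : ℍ => WeakMaass.poincare m k N z (1 - k / 2)) ∈
      WeakMaass.harmonicWeakMaassForms k N) ∧
    -- the Fourier expansion, all of whose series converge absolutely
    (∀ n : ℤ, Summable (WeakMaass.coeffTerm m k N n (1 - k / 2))) ∧
    ∀ z : ℍ,
      Summable (fun n : {n : ℤ // 0 < n} => WeakMaass.posTerm m k N z n) ∧
      Summable (fun n : {n : ℤ // n < 0} => WeakMaass.negTerm m k N z n) ∧
      WeakMaass.poincare m k N z (1 - k / 2) =
        WeakMaass.frakM m k z.im * WeakMaass.e (m * z) +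
        (4 * Real.pi : ℂ) ^ (1 - k : ℂ) / ((1 - k) * Complex.Gamma (1 - k)) *
          WeakMaass.coeff m k N 0 (1 - k / 2) +
        (∑' n : {n : ℤ // 0 < n}, WeakMaass.posTerm m k N z n) +
        (∑' n : {n : ℤ // n < 0}, WeakMaass.negTerm m k N z n) := by
  have hk' : WeakMaass.IsAdmissible k N := hk
  exact ⟨WeakMaass.summable_poincareTerm hk' hk0 m,
    fun hm => ⟨WeakMaass.poincare_mem_harmonicWeakMaassForms hk' hk0 m,
      WeakMaass.isHolomorphic_xi_poincare hk' hk0 m, WeakMaass.isInvariant_xi_poincare hk' hk0 m,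
      fun α => WeakMaass.isZeroAtImInfty_xi_poincare hk' hk0 hm α⟩,
    fun hm => ⟨WeakMaass.poincare_mem_harmonicWeakMaassForms hk' hk0 m,
      WeakMaass.isHolomorphic_xi_poincare hk' hk0 m, WeakMaass.isInvariant_xi_poincare hk' hk0 m,
      fun α => WeakMaass.isBoundedAtImInfty_xi_poincare hk' hk0 hm.le α⟩,
    fun _ => WeakMaass.poincare_mem_harmonicWeakMaassForms hk' hk0 m,
    fun n => WeakMaass.summable_coeffTerm hk' hk0 hN m n,
    fun z => WeakMaass.fourier_expansion hk' hk0 hN m z⟩
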